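/- For a real $m\times n$ matrix $A$ let $\gamma_2(A)$ be the infimum, over all factorizations $A=BC$ into real matrices, of the product of the largest $\ell_2$ norm of a row of $B$ and the largest $\ell_2$ norm of a column of $C$. For $J\subseteq[n]$ let $A_{|J}$ be the $m\times|J|$ submatrix of $A$ formed by the columns in $J$. There are a randomized algorithm, a polynomial $q$ and absolute constants $C,p>0$ such that, given any real $m\times n$ matrix $A$ and any $J\subseteq[n]$, the algorithm always halts after at most $q(m+n)$ steps and returns a coloring $x:J\to\{-1,1\}$, and, if $m\ge 2$, with probability at least $p$ \[ \|A_{|J}\,x\|_\infty\le C\,\gamma_2(A)\sqrt{\log m}. \] Here the algorithm is a single program, independent of the input, for a random access machine over the reals; a step is one exact operation $+,-,\times,\div$ or comparison on real memory cells, one addition, truncated subtraction or comparison on natural-number index registers, one assignment of a rational constant, one copy, one fair coin flip, or one move of the control. Only rational constants occur in the program, and there is no rounding operation. -/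

import Mathlib

noncomputable section

/-! ### The `γ₂` norm -/

/-- `γ₂(A)`: the infimum, over all factorizations `A = B * C` through some `ℝ^k`, of
(largest `ℓ₂` norm of a row of `B`) times (largest `ℓ₂` norm of a column of `C`). -/
def gamma2 {m n : ℕ} (A : Matrix (Fin m) (Fin n) ℝ) : ℝ :=
  sInf {t : ℝ | ∃ (k : ℕ) (B : Matrix (Fin m) (Fin k) ℝ) (C : Matrix (Fin k) (Fin n) ℝ)
    (r s : ℝ), A = B * C ∧ 0 ≤ r ∧ 0 ≤ s ∧
      (∀ i, ‖WithLp.toLp 2 (B i)‖ ≤ r) ∧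
      (∀ j, ‖WithLp.toLp 2 (fun l => C l j)‖ ≤ s) ∧ t = r * s}

/-- `A_{|J}`: the submatrix of `A` formed by the columns in `J`. -/
def restrictCols {m n : ℕ} (A : Matrix (Fin m) (Fin n) ℝ) (J : Finset (Fin n)) :
    Matrix (Fin m) J ℝ :=
  A.submatrix id Subtype.val

/-! ### Randomized real random access machines

A machine has natural-number registers, used as counters and as indices, and an unbounded
supply of two-dimensional arrays of real numbers. One step is one operation: an addition or
truncated subtraction of registers; an exact `+`, `-`, `*`, `/` on real cells; a
comparison of two registers or of two cells; a fair coin flip; or one move of the control.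
There is no rounding and no conversion between reals and naturals, and only rational
constants occur in programs. -/

namespace RealRAM

/-- The contents of the memory. -/
structure State where
  /-- natural-number registers -/
  reg : ℕ → ℕ
  /-- `arr a i j` is the entry `(i, j)` of the array number `a` -/
  arr : ℕ → ℕ → ℕ → ℝ

/-- An indirect reference to a real cell: in the array number `array`, the entry whose row and
column are the current contents of the registers `row` and `col`. -/
structure Cell where
  array : ℕ
  row : ℕ
  col : ℕ

/-- The real number stored in a cell. -/
def State.read (s : State) (x : Cell) : ℝ :=
  s.arr x.array (s.reg x.row) (s.reg x.col)

/-- Overwrite a natural-number register. -/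
def State.setReg (s : State) (r v : ℕ) : State :=
  { s with reg := fun r' => if r' = r then v else s.reg r' }

/-- Overwrite a real cell. -/
def State.write (s : State) (x : Cell) (v : ℝ) : State :=
  { s with arr := fun a i j =>
      if a = x.array ∧ i = s.reg x.row ∧ j = s.reg x.col then v else s.arr a i j }

/-- The elementary operations; the first argument is the destination. -/
inductive Op where
  | natConst (r c : ℕ)
  | natAdd (r s t : ℕ)
  | natSub (r s t : ℕ)
  | realConst (x : Cell) (q : ℚ)
  | realCopy (x y : Cell)
  | realAdd (x y z : Cell)
  | realSub (x y z : Cell)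
  | realMul (x y z : Cell)
  | realDiv (x y z : Cell)
  | coin (r : ℕ)

/-- The effect of an elementary operation. Only `coin` is random: it puts `0` or `1` into its
register, each with probability `1/2` and independently of the past. Division by zero
returns zero. -/
def Op.exec (s : State) : Op → PMF State
  | .natConst r c => PMF.pure (s.setReg r c)
  | .natAdd r u v => PMF.pure (s.setReg r (s.reg u + s.reg v))
  | .natSub r u v => PMF.pure (s.setReg r (s.reg u - s.reg v))
  | .realConst x q => PMF.pure (s.write x (q : ℝ))
  | .realCopy x y => PMF.pure (s.write x (s.read y))
  | .realAdd x y z => PMF.pure (s.write x (s.read y + s.read z))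
  | .realSub x y z => PMF.pure (s.write x (s.read y - s.read z))
  | .realMul x y z => PMF.pure (s.write x (s.read y * s.read z))
  | .realDiv x y z => PMF.pure (s.write x (s.read y / s.read z))
  | .coin r => (PMF.uniformOfFintype Bool).map fun b => s.setReg r (if b then 1 else 0)

/-- Tests: a strict comparison of two registers or of two real cells. -/
inductive Test where
  | natLt (r s : ℕ)
  | realLt (x y : Cell)

/-- The truth of a test in a given state. -/
def Test.Holds (s : State) : Test → Prop
  | .natLt u v => s.reg u < s.reg v
  | .realLt x y => s.read x < s.read y

/-- Programs. A program is a finite object that does not depend on the input. -/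
inductive Prog where
  | skip
  | op (o : Op)
  | seq (c d : Prog)
  | ite (t : Test) (c d : Prog)
  | while (t : Test) (c : Prog)

/-- A configuration: the programs that are still to be executed, in this order, and the
memory. -/
structure Config where
  todo : List Prog
  state : State

/-- The machine has halted. -/
def Config.Halted (c : Config) : Prop := c.todo = []

open Classical in
/-- One step of the machine, as a probability distribution on the next configuration. -/
def step : Config → PMF Config
  | ⟨[], s⟩ => PMF.pure ⟨[], s⟩
  | ⟨.skip :: k, s⟩ => PMF.pure ⟨k, s⟩
  | ⟨.op o :: k, s⟩ => (o.exec s).map fun s' => ⟨k, s'⟩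
  | ⟨.seq c d :: k, s⟩ => PMF.pure ⟨c :: d :: k, s⟩
  | ⟨.ite t c d :: k, s⟩ => PMF.pure ⟨(if t.Holds s then c else d) :: k, s⟩
  | ⟨.while t c :: k, s⟩ =>
      PMF.pure (if t.Holds s then ⟨c :: .while t c :: k, s⟩ else ⟨k, s⟩)

/-- The distribution of the configuration after `T` steps. -/
def run : ℕ → Config → PMF Config
  | 0, c => PMF.pure c
  | T + 1, c => (step c).bind (run T)

/-- The distribution of the configuration of the program `P` after `T` steps from the memory
`s`. -/
def Prog.runFrom (P : Prog) (T : ℕ) (s : State) : PMF Config :=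
  run T ⟨[P], s⟩

open Classical in
/-- The input `(A, J)`: registers `0` and `1` hold `m` and `n`, the array `0` holds `A`, the
row `0` of the array `1` holds the indicator vector of `J`, and everything else is `0`. -/
def inputState {m n : ℕ} (A : Matrix (Fin m) (Fin n) ℝ) (J : Finset (Fin n)) : State where
  reg r := if r = 0 then m else if r = 1 then n else 0
  arr a i j :=
    if a = 0 then (if h : i < m ∧ j < n then A ⟨i, h.1⟩ ⟨j, h.2⟩ else 0)
    else if a = 1 then (if ∃ h : j < n, i = 0 ∧ (⟨j, h⟩ : Fin n) ∈ J then 1 else 0)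
    else 0

/-- The output: the vector indexed by `J` that is stored in the row `0` of the array `2`. -/
def State.output {n : ℕ} (s : State) (J : Finset (Fin n)) : J → ℝ :=
  fun j => s.arr 2 0 (j : Fin n)

end RealRAM

end

/-!
The algorithm has two parts, a search for a Gram matrix and a random walk.

A factorization `A = B C` with value `√r` and columns of `C` of norm at most `1` gives a Gram matrix
`Z = Cᵀ C` with diagonal at most `1` for which all forms `r Z - a aᵀ`, with `a` a row of `A`, are
positive semidefinite. Only the forms matter: if `Q` is positive definite with diagonal at most `3`
and all `r Q - a aᵀ` are positive definite (`GoodGram`), then `Q / 3` is the Gram matrix of vectors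
`v j` in the unit ball, and every row acts on colorings as `x ↦ ⟪θ, ∑ j, x j • v j⟫` for some `θ`
with `‖θ‖ ^ 2 ≤ 3 r` (`exists_inner_position_eq_dot`).

Such a `Q` is found exactly, without eigenvalues or semidefinite programming, by a perceptron.
From `Q = 0`, a diagonal entry above `3` is lowered by `1`, and a vector `v` with
`vᵀ (r Q - a aᵀ) v ≤ 0`, which Gram-Schmidt orthogonalization exhibits, adds `v vᵀ / ‖v‖ ^ 2` to
`Q`. Each of these updates lowers the squared Frobenius distance from `Z + 1` by at least `1`
(`gramDist_diag`, `gramDist_rankOne`), and this distance is at most `4 n ^ 2` initially, so that the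
number of updates is polynomial. As `γ₂` is not known, `r` runs through the multiples of the mean
square of the entries, which is at most `γ₂ ^ 2`; one of the first `m n + 1` multiples has a
certificate, and the first one that has exceeds `γ₂ ^ 2` by a factor of at most `2`
(`exists_level`, `gramCode_spec`).

The walk is the Gram-Schmidt walk of Bansal, Dadush, Garg and Lovett. It moves in `[-1, 1] ^ n`
until all coordinates are frozen at `±1`, always along the component of the last alive vector (the
pivot) that is orthogonal to the other alive ones, to one of the two ends of the feasible segment
and without drift. Its endpoint is subgaussian with the optimal constant, as Harshaw, Sävje,
Spielman and Zhang showed. Here this is proved by a potential: the exponential of the current value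
of `θ`, plus half the energy of `θ` on the span of the other alive vectors, plus what the pivot may
still contribute, which is the cumulant generating function of a sign with the mean `x p`, and a
term for the part of the pivot that is not yet released. It is a supermartingale
(`potential_move_two_le`), because it is affine along the direction of the walk, and freezing
a coordinate releases at least as much energy as the growth of the residual costs
(`signCgf_add_le`). The probabilities of the walk are rounded to `n` bits in favour of the more
likely move, which costs a factor `1 + 2 / 2 ^ n` per step and at most `exp 2` in total. Chernoff's
bound for all rows together finishes the proof (`expect_discrepancy_le`).

Programs are written in a small language of real expressions and counting loops. `Stmt.correct`
compiles it once and for all to machine code that runs in polynomial time; only the drawing of the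
random numbers is written in machine code by hand (`sampleCode`).
-/

namespace RealRAM

/-- The program `P`, started in the memory `s`, surely ends in the memory `s'` after `τ` steps,
whatever remains to be executed afterwards. -/
def RunsTo (P : Prog) (s s' : State) (τ : ℕ) : Prop :=
  ∀ k T, run (T + τ) ⟨P :: k, s⟩ = run T ⟨k, s'⟩

theorem RunsTo.seq {c d : Prog} {s s₁ s₂ : State} {τ₁ τ₂ : ℕ}
    (hc : RunsTo c s s₁ τ₁) (hd : RunsTo d s₁ s₂ τ₂) :
    RunsTo (.seq c d) s s₂ (τ₂ + τ₁ + 1) := by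
  intro k T
  have h : run (T + (τ₂ + τ₁ + 1)) ⟨.seq c d :: k, s⟩ = run ((T + τ₂) + τ₁) ⟨c :: d :: k, s⟩ := by
    change (step _).bind (run (T + (τ₂ + τ₁))) = _
    simp [step, add_assoc]
  rw [h, hc, hd]

theorem runsTo_op {o : Op} {s s' : State} (h : o.exec s = PMF.pure s') :
    RunsTo (.op o) s s' 1 := by
  intro k T
  change (step _).bind (run T) = _
  simp [step, h, PMF.pure_map]

theorem RunsTo.ite_true {t : Test} {c d : Prog} {s s' : State} {τ : ℕ} (ht : t.Holds s)
    (hc : RunsTo c s s' τ) : RunsTo (.ite t c d) s s' (τ + 1) := by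
  intro k T
  rw [← hc]
  change (step _).bind (run (T + τ)) = _
  simp [step, ht]

theorem RunsTo.ite_false {t : Test} {c d : Prog} {s s' : State} {τ : ℕ} (ht : ¬ t.Holds s)
    (hd : RunsTo d s s' τ) : RunsTo (.ite t c d) s s' (τ + 1) := by
  intro k T
  rw [← hd]
  change (step _).bind (run (T + τ)) = _
  simp [step, ht]

theorem RunsTo.while_true {t : Test} {c : Prog} {s s₁ s₂ : State} {τ₁ τ₂ : ℕ} (ht : t.Holds s)
    (hc : RunsTo c s s₁ τ₁) (hw : RunsTo (.while t c) s₁ s₂ τ₂) :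
    RunsTo (.while t c) s s₂ (τ₂ + τ₁ + 1) := by
  intro k T
  have h : run (T + (τ₂ + τ₁ + 1)) ⟨.while t c :: k, s⟩
      = run ((T + τ₂) + τ₁) ⟨c :: .while t c :: k, s⟩ := by
    change (step _).bind (run (T + (τ₂ + τ₁))) = _
    simp [step, ht, add_assoc]
  rw [h, hc, hw]

theorem runsTo_while_false {t : Test} {c : Prog} {s : State} (ht : ¬ t.Holds s) :
    RunsTo (.while t c) s s 1 := by
  intro k T
  change (step _).bind (run T) = _
  simp [step, ht]

/-- Total correctness and running time of a counting loop from an invariant. -/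
theorem exists_runsTo_while {r b N c : ℕ} {body : Prog} (I : ℕ → State → Prop)
    (hI : ∀ k s, I k s → s.reg r = k ∧ s.reg b = N)
    (hstep : ∀ k s, k < N → I k s → ∃ s' τ, RunsTo body s s' τ ∧ τ ≤ c ∧ I (k + 1) s')
    {s : State} (h0 : I 0 s) :
    ∃ s' τ, RunsTo (.while (.natLt r b) body) s s' τ ∧ τ ≤ N * (c + 1) + 1 ∧ I N s' := by
  have key : ∀ j k s, k + j = N → I k s →
      ∃ s' τ, RunsTo (.while (.natLt r b) body) s s' τ ∧ τ ≤ j * (c + 1) + 1 ∧ I N s' := by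
    intro j
    induction j with
    | zero =>
      intro k s hk hs
      obtain rfl : k = N := by omega
      refine ⟨s, 1, runsTo_while_false ?_, by omega, hs⟩
      obtain ⟨h1, h2⟩ := hI _ _ hs
      simp [Test.Holds, h1, h2]
    | succ j ih =>
      intro k s hk hs
      obtain ⟨h1, h2⟩ := hI _ _ hs
      obtain ⟨s₁, τ₁, hr₁, hτ₁, hs₁⟩ := hstep k s (by omega) hs
      obtain ⟨s₂, τ₂, hr₂, hτ₂, hs₂⟩ := ih (k + 1) s₁ (by omega) hs₁
      refine ⟨s₂, _, hr₁.while_true ?_ hr₂, ?_, hs₂⟩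
      · simp [Test.Holds, h1, h2]; omega
      · rw [Nat.succ_mul]; omega
  exact key N 0 s (by omega) h0

/-! ### A structured language with polynomially bounded loops -/

/-- The arrays of a structured program. -/
abbrev Store := ℕ → ℕ → ℕ → ℝ

/-- Overwrite one entry of a store. -/
def Store.upd (σ : Store) (a i j : ℕ) (v : ℝ) : Store :=
  fun a' i' j' => if a' = a ∧ i' = i ∧ j' = j then v else σ a' i' j'

/-- Real-valued expressions. The natural numbers in `cell`, `sum` and `nlt` are names of
registers, except for the first argument of `cell`, the number of an array. -/
inductive Expr where
  | const (q : ℚ)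
  | cell (a i j : ℕ)
  | add (e f : Expr)
  | sub (e f : Expr)
  | mul (e f : Expr)
  | div (e f : Expr)
  /-- `sum r b e` is the sum of `e` as the register `r` runs from `0` up to the content of
  the register `b`, exclusively. -/
  | sum (r b : ℕ) (e : Expr)
  /-- `lt e f g h` is `g` if `e < f`, and `h` otherwise. -/
  | lt (e f g h : Expr)
  /-- `nlt i j g h` is `g` if the content of `i` is less than that of `j`, and `h` otherwise. -/
  | nlt (i j : ℕ) (g h : Expr)

/-- The value of an expression. -/
noncomputable def Expr.eval (ρ : ℕ → ℕ) (σ : Store) : Expr → ℝ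
  | const q => q
  | cell a i j => σ a (ρ i) (ρ j)
  | add e f => e.eval ρ σ + f.eval ρ σ
  | sub e f => e.eval ρ σ - f.eval ρ σ
  | mul e f => e.eval ρ σ * f.eval ρ σ
  | div e f => e.eval ρ σ / f.eval ρ σ
  | sum r b e => ∑ k ∈ Finset.range (ρ b), e.eval (Function.update ρ r k) σ
  | lt e f g h => if e.eval ρ σ < f.eval ρ σ then g.eval ρ σ else h.eval ρ σ
  | nlt i j g h => if ρ i < ρ j then g.eval ρ σ else h.eval ρ σ

/-- Well-formedness where the registers in `L` are in scope: only they are read, bound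
registers are fresh, ranges of sums are given by the constant registers, and the temporary
arrays, from number `100` on, are not used. -/
def Expr.wf (L : List ℕ) : Expr → Bool
  | const _ => true
  | cell a i j => a < 100 && i ∈ L && j ∈ L
  | add e f => e.wf L && f.wf L
  | sub e f => e.wf L && f.wf L
  | mul e f => e.wf L && f.wf L
  | div e f => e.wf L && f.wf L
  | sum r b e => r ∉ L && b < 4 && e.wf (r :: L)
  | lt e f g h => e.wf L && f.wf L && g.wf L && h.wf L
  | nlt i j g h => i ∈ L && j ∈ L && g.wf L && h.wf L

/-- The temporary real cell number `t`. Register `4` always holds `0`. -/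
def tmp (t : ℕ) : Cell := ⟨100 + t, 4, 4⟩

/-- A loop in which the register `r` counts up to the content of `b`. Register `2` always
holds `1`. -/
def Prog.loop (r b : ℕ) (body : Prog) : Prog :=
  .seq (.op (.natConst r 0)) (.while (.natLt r b) (.seq body (.op (.natAdd r r 2))))

/-- Code that stores the value of an expression in the temporary cell `t`, and uses no
temporary cell below `t`. -/
def Expr.code (t : ℕ) : Expr → Prog
  | const q => .op (.realConst (tmp t) q)
  | cell a i j => .op (.realCopy (tmp t) ⟨a, i, j⟩)
  | add e f => .seq (e.code t) (.seq (f.code (t + 1)) (.op (.realAdd (tmp t) (tmp t) (tmp (t + 1)))))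
  | sub e f => .seq (e.code t) (.seq (f.code (t + 1)) (.op (.realSub (tmp t) (tmp t) (tmp (t + 1)))))
  | mul e f => .seq (e.code t) (.seq (f.code (t + 1)) (.op (.realMul (tmp t) (tmp t) (tmp (t + 1)))))
  | div e f => .seq (e.code t) (.seq (f.code (t + 1)) (.op (.realDiv (tmp t) (tmp t) (tmp (t + 1)))))
  | sum r b e => .seq (.op (.realConst (tmp t) 0))
      (.loop r b (.seq (e.code (t + 1)) (.op (.realAdd (tmp t) (tmp t) (tmp (t + 1))))))
  | lt e f g h => .seq (e.code t) (.seq (f.code (t + 1))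
      (.ite (.realLt (tmp t) (tmp (t + 1))) (g.code t) (h.code t)))
  | nlt i j g h => .ite (.natLt i j) (g.code t) (h.code t)

/-- The registers in `L` and the non-temporary arrays of the machine are as in `ρ`, `σ`;
the constant registers hold their constants; `N` bounds the lengths of all loops. -/
structure Agree (L : List ℕ) (N : ℕ) (s : State) (ρ : ℕ → ℕ) (σ : Store) : Prop where
  mem : ∀ r < 5, r ∈ L
  reg : ∀ r ∈ L, s.reg r = ρ r
  arr : ∀ a < 100, s.arr a = σ a
  one : ρ 2 = 1
  zero : ρ 4 = 0
  le : ∀ b < 4, ρ b ≤ N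

namespace Agree

variable {L : List ℕ} {N : ℕ} {s s' : State} {ρ : ℕ → ℕ} {σ : Store}

theorem of_eq (h : Agree L N s ρ σ)
    (hr : ∀ r ∈ L, s'.reg r = s.reg r) (ha : ∀ a < 100, s'.arr a = s.arr a) :
    Agree L N s' ρ σ :=
  ⟨h.mem, fun r hrd => (hr r hrd).trans (h.reg r hrd),
    fun a had => (ha a had).trans (h.arr a had), h.one, h.zero, h.le⟩

theorem reg_one (h : Agree L N s ρ σ) : s.reg 2 = 1 := by
  rw [h.reg 2 (h.mem 2 (by norm_num)), h.one]

theorem reg_zero (h : Agree L N s ρ σ) : s.reg 4 = 0 := by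
  rw [h.reg 4 (h.mem 4 (by norm_num)), h.zero]

/-- The scope of the body of a loop with counter `r`. -/
theorem cons {r k : ℕ} {τ : Store} (h : Agree L N s ρ σ) (hd : r ∉ L)
    (hr : ∀ r ∈ L, s'.reg r = s.reg r) (hk : s'.reg r = k) (ha : ∀ a < 100, s'.arr a = τ a) :
    Agree (r :: L) N s' (Function.update ρ r k) τ := by
  have hne : ∀ q < 5, q ≠ r := fun q hq hqr => hd (hqr ▸ h.mem q hq)
  refine ⟨fun q hq => List.mem_cons_of_mem _ (h.mem q hq), fun q hq => ?_, ha, ?_, ?_, ?_⟩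
  · by_cases hqr : q = r
    · subst hqr; simpa using hk
    · have hqL : q ∈ L := by simpa [hqr] using hq
      rw [Function.update_of_ne hqr, hr q hqL, h.reg q hqL]
  · rw [Function.update_of_ne (hne 2 (by norm_num)), h.one]
  · rw [Function.update_of_ne (hne 4 (by norm_num)), h.zero]
  · intro b hb
    rw [Function.update_of_ne (hne b (by omega))]; exact h.le b hb

end Agree

@[simp] theorem State.setReg_arr (s : State) (r v : ℕ) : (s.setReg r v).arr = s.arr := rfl

theorem State.setReg_reg (s : State) (r v q : ℕ) :
    (s.setReg r v).reg q = if q = r then v else s.reg q := rfl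

@[simp] theorem State.write_reg (s : State) (x : Cell) (v : ℝ) : (s.write x v).reg = s.reg := rfl

theorem State.write_arr_of_ne (s : State) (x : Cell) (v : ℝ) {a : ℕ} (h : a ≠ x.array) :
    (s.write x v).arr a = s.arr a := by
  funext i j
  simp [State.write, h]

theorem State.write_tmp_self {s : State} (h : s.reg 4 = 0) (t : ℕ) (v : ℝ) :
    (s.write (tmp t) v).arr (100 + t) 0 0 = v := by
  simp [State.write, tmp, h]

theorem State.read_tmp {s : State} (h : s.reg 4 = 0) (t : ℕ) :
    s.read (tmp t) = s.arr (100 + t) 0 0 := by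
  simp [State.read, tmp, h]

/-- A counting loop runs its body for `0, …, N - 1`, maintaining an invariant `I` that depends
on the counter and on the memory with the scope `L` of the loop. -/
theorem exists_runsTo_loop {L : List ℕ} {N r b c : ℕ} {body : Prog} {s : State} {ρ : ℕ → ℕ}
    {σ : Store} (h : Agree L N s ρ σ) (hr : r ∉ L) (hb : b < 4) (I : ℕ → State → Prop)
    (h0 : ∀ v, I 0 (s.setReg r v))
    (hI : ∀ k s v, I k s → I k (s.setReg r v))
    (hstep : ∀ k s', k < ρ b → (∀ q ∈ L, s'.reg q = s.reg q) → s'.reg r = k → I k s' →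
      ∃ s'' τ, RunsTo body s' s'' τ ∧ τ ≤ c ∧ (∀ q ∈ r :: L, s''.reg q = s'.reg q) ∧ I (k + 1) s'') :
    ∃ s' τ, RunsTo (.loop r b body) s s' τ ∧ τ ≤ N * (c + 3) + 3 ∧
      (∀ q ∈ L, s'.reg q = s.reg q) ∧ I (ρ b) s' := by
  have hbL : b ∈ L := h.mem b (by omega)
  have h2L : 2 ∈ L := h.mem 2 (by omega)
  have hne : ∀ q ∈ L, q ≠ r := fun q hq hqr => hr (hqr ▸ hq)
  obtain ⟨s', τ, hrun, hτ, ⟨hreg, -, hinv⟩⟩ := exists_runsTo_while (r := r) (b := b) (N := ρ b)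
    (c := c + 2) (body := .seq body (.op (.natAdd r r 2)))
    (fun k s' => (∀ q ∈ L, s'.reg q = s.reg q) ∧ s'.reg r = k ∧ I k s')
    (fun k s' hs' => ⟨hs'.2.1, by rw [hs'.1 b hbL, h.reg b hbL]⟩)
    (by
      rintro k s' hk ⟨hreg, hkr, hinv⟩
      obtain ⟨s'', τ, hrun, hτ, hreg', hinv'⟩ := hstep k s' hk hreg hkr hinv
      refine ⟨_, _, hrun.seq (runsTo_op rfl), by omega, ?_, ?_, hI _ _ _ hinv'⟩
      · intro q hq
        rw [State.setReg_reg, if_neg (hne q hq), hreg' q (List.mem_cons_of_mem _ hq), hreg q hq]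
      · rw [State.setReg_reg, if_pos rfl, hreg' r (List.mem_cons_self ..),
          hreg' 2 (List.mem_cons_of_mem _ h2L), hreg 2 h2L, h.reg_one, hkr])
    (s := s.setReg r 0)
    ⟨fun q hq => by rw [State.setReg_reg, if_neg (hne q hq)], by simp [State.setReg_reg], h0 0⟩
  refine ⟨s', _, (runsTo_op rfl).seq hrun, ?_, hreg, hinv⟩
  have := Nat.mul_le_mul_right (c + 3) (h.le b hb)
  have e : c + 2 + 1 = c + 3 := rfl
  rw [e] at hτ
  omega

/-- The code `c` stores `v` in the temporary cell `t`, changing neither the registers in `L`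
nor the arrays before that cell, in at most `T` steps. -/
def Stores (L : List ℕ) (t : ℕ) (s : State) (c : Prog) (v : ℝ) (T : ℕ) : Prop :=
  ∃ s' τ, RunsTo c s s' τ ∧ τ ≤ T ∧ s'.arr (100 + t) 0 0 = v ∧
    (∀ r ∈ L, s'.reg r = s.reg r) ∧ ∀ a < 100 + t, s'.arr a = s.arr a

theorem stores_op {L : List ℕ} {t : ℕ} {s : State} (h4 : s.reg 4 = 0) {o : Op} {v : ℝ}
    (ho : o.exec s = PMF.pure (s.write (tmp t) v)) : Stores L t s (.op o) v 1 :=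
  ⟨_, _, runsTo_op ho, le_rfl, State.write_tmp_self h4 t v, fun _ _ => rfl,
    fun a ha => State.write_arr_of_ne _ _ _ (by simp [tmp]; omega)⟩

theorem Stores.seq {L : List ℕ} {t u : ℕ} {s : State} {c d : Prog} {v w : ℝ} {T T' : ℕ}
    (hc : Stores L u s c w T) (htu : t ≤ u)
    (hd : ∀ s', s'.arr (100 + u) 0 0 = w → (∀ r ∈ L, s'.reg r = s.reg r) →
      (∀ a < 100 + u, s'.arr a = s.arr a) → Stores L t s' d v T') :
    Stores L t s (.seq c d) v (T' + T + 1) := by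
  obtain ⟨s₁, τ₁, hr₁, hτ₁, hv₁, hreg₁, harr₁⟩ := hc
  obtain ⟨s₂, τ₂, hr₂, hτ₂, hv₂, hreg₂, harr₂⟩ := hd s₁ hv₁ hreg₁ harr₁
  exact ⟨s₂, _, hr₁.seq hr₂, by omega, hv₂, fun r hr => (hreg₂ r hr).trans (hreg₁ r hr),
    fun a ha => (harr₂ a ha).trans (harr₁ a (by omega))⟩

theorem Stores.mono {L : List ℕ} {t : ℕ} {s : State} {c : Prog} {v : ℝ} {T T' : ℕ}
    (h : Stores L t s c v T) (hT : T ≤ T') : Stores L t s c v T' := by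
  obtain ⟨s', τ, h1, h2, h3⟩ := h
  exact ⟨s', τ, h1, h2.trans hT, h3⟩

/-- The code of an expression computes its value, in polynomially many steps. -/
def Expr.Correct (e : Expr) : Prop :=
  ∃ p : Polynomial ℕ, ∀ (L : List ℕ) (N t : ℕ) (s : State) (ρ : ℕ → ℕ) (σ : Store),
    Agree L N s ρ σ → e.wf L → Stores L t s (e.code t) (e.eval ρ σ) (p.eval N)

theorem Expr.Correct.pair {e f : Expr} (he : e.Correct) (hf : f.Correct) :
    ∃ p : Polynomial ℕ, ∀ (L : List ℕ) (N t : ℕ) (s : State) (ρ : ℕ → ℕ) (σ : Store) (c : Prog)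
      (v : ℝ) (T : ℕ), Agree L N s ρ σ → e.wf L → f.wf L →
      (∀ s', s'.arr (100 + t) 0 0 = e.eval ρ σ → s'.arr (100 + (t + 1)) 0 0 = f.eval ρ σ →
        (∀ r ∈ L, s'.reg r = s.reg r) → (∀ a < 100 + t, s'.arr a = s.arr a) →
        Stores L t s' c v T) →
      Stores L t s (.seq (e.code t) (.seq (f.code (t + 1)) c)) v (p.eval N + T) := by
  obtain ⟨p, hp⟩ := he
  obtain ⟨q, hq⟩ := hf
  refine ⟨p + q + 2, fun L N t s ρ σ c v T h hwe hwf hc => ?_⟩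
  refine ((hp L N t s ρ σ h hwe).seq le_rfl fun s₁ hv₁ hreg₁ harr₁ =>
    (hq L N (t + 1) s₁ ρ σ (h.of_eq hreg₁ fun a ha => harr₁ a (by omega)) hwf).seq (by omega)
      fun s₂ hv₂ hreg₂ harr₂ => hc s₂ (by rw [harr₂ _ (by omega), hv₁]) hv₂
        (fun r hr => (hreg₂ r hr).trans (hreg₁ r hr))
        (fun a ha => (harr₂ a (by omega)).trans (harr₁ a (by omega)))).mono ?_
  simp only [Polynomial.eval_add, Polynomial.eval_ofNat]
  omega

theorem Expr.correct (e : Expr) : e.Correct := by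
  induction e with
  | const q => exact ⟨1, fun L N t s ρ σ h _ => by
    rw [Polynomial.eval_one]; exact stores_op h.reg_zero rfl⟩
  | cell a i j =>
    refine ⟨1, fun L N t s ρ σ h hw => ?_⟩
    simp only [Expr.wf, Bool.and_eq_true, decide_eq_true_eq] at hw
    rw [Polynomial.eval_one]
    refine stores_op h.reg_zero ?_
    simp [Op.exec, State.read, Expr.eval, h.arr a hw.1.1, h.reg i hw.1.2, h.reg j hw.2]
  | add e f ihe ihf | sub e f ihe ihf | mul e f ihe ihf | div e f ihe ihf =>
    obtain ⟨p, hp⟩ := ihe.pair ihf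
    refine ⟨p + 1, fun L N t s ρ σ h hw => ?_⟩
    simp only [Expr.wf, Bool.and_eq_true] at hw
    rw [Polynomial.eval_add, Polynomial.eval_one]
    refine hp L N t s ρ σ _ _ 1 h hw.1 hw.2 fun s' he hf hreg harr => ?_
    have h4 : s'.reg 4 = 0 := by rw [hreg 4 (h.mem 4 (by omega)), h.reg_zero]
    refine stores_op h4 ?_
    simp only [Op.exec, State.read_tmp h4, he, hf, Expr.eval]
  | sum r b e ih =>
    obtain ⟨p, hp⟩ := ih
    refine ⟨Polynomial.X * (p + 5) + 5, fun L N t s ρ σ h hw => ?_⟩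
    simp only [Expr.wf, Bool.and_eq_true, decide_eq_true_eq] at hw
    have key := (stores_op (L := L) (t := t) h.reg_zero (o := .realConst (tmp t) 0) rfl).seq
      (t := t) (v := (Expr.sum r b e).eval ρ σ) (T' := N * (p.eval N + 5) + 3)
      (d := .loop r b (.seq (e.code (t + 1)) (.op (.realAdd (tmp t) (tmp t) (tmp (t + 1))))))
      le_rfl ?_
    · refine key.mono ?_
      simp
      omega
    intro s₁ hv₁ hreg₁ harr₁
    have h₁ := h.of_eq hreg₁ fun a ha => harr₁ a (by omega)
    obtain ⟨s', τ, hrun, hτ, hreg, hv, harr⟩ := exists_runsTo_loop h₁ hw.1.1 hw.1.2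
      (c := p.eval N + 2)
      (body := .seq (e.code (t + 1)) (.op (.realAdd (tmp t) (tmp t) (tmp (t + 1)))))
      (fun k s' => s'.arr (100 + t) 0 0 =
          ∑ k ∈ Finset.range k, e.eval (Function.update ρ r k) σ ∧
        ∀ a < 100 + t, s'.arr a = s₁.arr a)
      (fun v => ⟨by simpa using hv₁, fun _ _ => rfl⟩) (fun _ _ _ hk => hk) (by
        rintro k s' hk hreg hkr ⟨hv, harr⟩
        have h' : Agree (r :: L) N s' (Function.update ρ r k) σ :=
          h₁.cons hw.1.1 hreg hkr fun a ha => by rw [harr a (by omega), h₁.arr a ha]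
        obtain ⟨s₂, τ₂, hr₂, hτ₂, hv₂, hreg₂, harr₂⟩ := hp _ N (t + 1) s' _ σ h' hw.2
        have h4 : s₂.reg 4 = 0 := by rw [hreg₂ 4 (h'.mem 4 (by omega)), h'.reg_zero]
        refine ⟨_, _, hr₂.seq (runsTo_op rfl), by omega, hreg₂, ?_, fun a ha => ?_⟩
        · rw [State.write_tmp_self h4, State.read_tmp h4, State.read_tmp h4, hv₂,
            harr₂ _ (by omega), hv, Finset.sum_range_succ]
        · rw [State.write_arr_of_ne _ _ _ (by simp [tmp]; omega), harr₂ a (by omega), harr a ha])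
    exact ⟨s', τ, hrun, by simpa using hτ, hv, hreg, harr⟩
  | lt e f g h ihe ihf ihg ihh =>
    obtain ⟨p, hp⟩ := ihe.pair ihf
    obtain ⟨pg, hpg⟩ := ihg
    obtain ⟨ph, hph⟩ := ihh
    refine ⟨p + (pg + ph + 1), fun L N t s ρ σ h hw => ?_⟩
    simp only [Expr.wf, Bool.and_eq_true] at hw
    rw [Polynomial.eval_add]
    refine hp L N t s ρ σ _ _ _ h hw.1.1.1 hw.1.1.2 fun s' he hf hreg harr => ?_
    have h' := h.of_eq hreg fun a ha => harr a (by omega)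
    have ht : (Test.realLt (tmp t) (tmp (t + 1))).Holds s' ↔ e.eval ρ σ < f.eval ρ σ := by
      simp only [Test.Holds, State.read_tmp h'.reg_zero, he, hf]
    simp only [Polynomial.eval_add, Polynomial.eval_one, Expr.eval]
    split_ifs with hlt
    · obtain ⟨s'', τ, hr, hτ, hpost⟩ := hpg L N t s' ρ σ h' hw.1.2
      exact ⟨s'', _, hr.ite_true (ht.2 hlt), by omega, hpost⟩
    · obtain ⟨s'', τ, hr, hτ, hpost⟩ := hph L N t s' ρ σ h' hw.2
      exact ⟨s'', _, hr.ite_false (mt ht.1 hlt), by omega, hpost⟩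
  | nlt i j g h ihg ihh =>
    obtain ⟨pg, hpg⟩ := ihg
    obtain ⟨ph, hph⟩ := ihh
    refine ⟨pg + ph + 1, fun L N t s ρ σ h hw => ?_⟩
    simp only [Expr.wf, Bool.and_eq_true, decide_eq_true_eq] at hw
    have ht : (Test.natLt i j).Holds s ↔ ρ i < ρ j := by
      simp only [Test.Holds, h.reg i hw.1.1.1, h.reg j hw.1.1.2]
    simp only [Polynomial.eval_add, Polynomial.eval_one, Expr.eval]
    split_ifs with hlt
    · obtain ⟨s'', τ, hr, hτ, hpost⟩ := hpg L N t s ρ σ h hw.1.2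
      exact ⟨s'', _, hr.ite_true (ht.2 hlt), by omega, hpost⟩
    · obtain ⟨s'', τ, hr, hτ, hpost⟩ := hph L N t s ρ σ h hw.2
      exact ⟨s'', _, hr.ite_false (mt ht.1 hlt), by omega, hpost⟩

/-- Deterministic programs with counting loops. -/
inductive Stmt where
  /-- `assign a i j e` stores `e` in the array `a`, at the position held by the registers
  `i` and `j`. -/
  | assign (a i j : ℕ) (e : Expr)
  | seq (c d : Stmt)
  /-- `loop r b c` executes `c` as the register `r` runs from `0` up to the content of the
  register `b`, exclusively. -/
  | loop (r b : ℕ) (c : Stmt)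

/-- Apply `f 0`, …, `f (k - 1)` in turn. -/
def Store.iter (f : ℕ → Store → Store) (σ : Store) : ℕ → Store
  | 0 => σ
  | k + 1 => f k (Store.iter f σ k)

/-- The effect of a statement on the store. -/
noncomputable def Stmt.den (ρ : ℕ → ℕ) (σ : Store) : Stmt → Store
  | assign a i j e => σ.upd a (ρ i) (ρ j) (e.eval ρ σ)
  | seq c d => d.den ρ (c.den ρ σ)
  | loop r b c => Store.iter (fun k τ => c.den (Function.update ρ r k) τ) σ (ρ b)

/-- Well-formedness of statements, as for expressions. -/
def Stmt.wf (L : List ℕ) : Stmt → Bool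
  | assign a i j e => a < 100 && i ∈ L && j ∈ L && e.wf L
  | seq c d => c.wf L && d.wf L
  | loop r b c => r ∉ L && b < 4 && c.wf (r :: L)

/-- The machine code of a statement. -/
def Stmt.code : Stmt → Prog
  | assign a i j e => .seq (e.code 0) (.op (.realCopy ⟨a, i, j⟩ (tmp 0)))
  | seq c d => .seq c.code d.code
  | loop r b c => .loop r b c.code

/-- The code of a statement has the effect of the statement, in polynomially many steps. -/
theorem Stmt.correct (c : Stmt) :
    ∃ p : Polynomial ℕ, ∀ (L : List ℕ) (N : ℕ) (s : State) (ρ : ℕ → ℕ) (σ : Store),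
      Agree L N s ρ σ → c.wf L →
      ∃ s' τ, RunsTo c.code s s' τ ∧ τ ≤ p.eval N ∧ (∀ r ∈ L, s'.reg r = s.reg r) ∧
        ∀ a < 100, s'.arr a = c.den ρ σ a := by
  induction c with
  | assign a i j e =>
    obtain ⟨p, hp⟩ := e.correct
    refine ⟨p + 2, fun L N s ρ σ h hw => ?_⟩
    simp only [Stmt.wf, Bool.and_eq_true, decide_eq_true_eq] at hw
    obtain ⟨s', τ, hr, hτ, hv, hreg, harr⟩ := hp L N 0 s ρ σ h hw.2
    have h' := h.of_eq hreg fun a ha => harr a (by omega)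
    refine ⟨_, _, hr.seq (runsTo_op rfl), by simp; omega, hreg, fun b hb => ?_⟩
    funext k l
    have e1 : s'.read (tmp 0) = e.eval ρ σ := by rw [State.read_tmp h'.reg_zero, hv]
    simp only [State.write, e1, h'.reg i hw.1.1.2, h'.reg j hw.1.2, h'.arr b hb, Stmt.den,
      Store.upd]
  | seq c d ihc ihd =>
    obtain ⟨p, hp⟩ := ihc
    obtain ⟨q, hq⟩ := ihd
    refine ⟨p + q + 1, fun L N s ρ σ h hw => ?_⟩
    simp only [Stmt.wf, Bool.and_eq_true] at hw
    obtain ⟨s₁, τ₁, hr₁, hτ₁, hreg₁, harr₁⟩ := hp L N s ρ σ h hw.1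
    have h₁ : Agree L N s₁ ρ (c.den ρ σ) :=
      ⟨h.mem, fun r hr => (hreg₁ r hr).trans (h.reg r hr), harr₁, h.one, h.zero, h.le⟩
    obtain ⟨s₂, τ₂, hr₂, hτ₂, hreg₂, harr₂⟩ := hq L N s₁ ρ _ h₁ hw.2
    exact ⟨s₂, _, hr₁.seq hr₂, by simp; omega,
      fun r hr => (hreg₂ r hr).trans (hreg₁ r hr), harr₂⟩
  | loop r b c ih =>
    obtain ⟨p, hp⟩ := ih
    refine ⟨Polynomial.X * (p + 3) + 3, fun L N s ρ σ h hw => ?_⟩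
    simp only [Stmt.wf, Bool.and_eq_true, decide_eq_true_eq] at hw
    obtain ⟨s', τ, hrun, hτ, hreg, harr⟩ := exists_runsTo_loop h hw.1.1 hw.1.2
      (c := p.eval N) (body := c.code)
      (fun k s' => ∀ a < 100, s'.arr a =
        Store.iter (fun k τ => c.den (Function.update ρ r k) τ) σ k a)
      (fun v => h.arr) (fun _ _ _ hk => hk) (by
        intro k s' hk hreg hkr hinv
        exact hp _ N s' _ _ (h.cons hw.1.1 hreg hkr hinv) hw.2)
    exact ⟨s', τ, hrun, by simpa using hτ, hreg, harr⟩

/-- Reasoning about a loop by an invariant. -/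
theorem Stmt.den_loop_induction {ρ : ℕ → ℕ} {σ : Store} {r b : ℕ} {c : Stmt}
    (I : ℕ → Store → Prop) (h0 : I 0 σ)
    (hstep : ∀ k τ, k < ρ b → I k τ → I (k + 1) (c.den (Function.update ρ r k) τ)) :
    I (ρ b) ((Stmt.loop r b c).den ρ σ) := by
  have key : ∀ k ≤ ρ b, I k (Store.iter (fun k τ => c.den (Function.update ρ r k) τ) σ k) := by
    intro k
    induction k with
    | zero => exact fun _ => h0
    | succ k ih => exact fun hk => hstep k _ hk (ih (by omega))
  exact key _ le_rfl

end RealRAM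

namespace RealRAM

/-! ### Sampling -/

/-- The random analogue of `RunsTo`: the program ends after exactly `τ` steps, in a random memory
with distribution `D`. -/
def Runs (P : Prog) (s : State) (D : PMF State) (τ : ℕ) : Prop :=
  ∀ k T, run (T + τ) ⟨P :: k, s⟩ = D.bind fun s' => run T ⟨k, s'⟩

theorem RunsTo.runs {P : Prog} {s s' : State} {τ : ℕ} (h : RunsTo P s s' τ) :
    Runs P s (PMF.pure s') τ := by
  intro k T
  rw [h, PMF.pure_bind]

theorem runs_op (o : Op) (s : State) : Runs (.op o) s (o.exec s) 1 := by
  intro k T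
  change (step _).bind (run T) = _
  simp [step, PMF.bind_map, Function.comp_def]

theorem bind_congr_support {α β : Type*} {p : PMF α} {f g : α → PMF β}
    (h : ∀ a ∈ p.support, f a = g a) : p.bind f = p.bind g := by
  ext b
  simp only [PMF.bind_apply]
  refine tsum_congr fun a => ?_
  by_cases ha : p a = 0
  · simp [ha]
  · rw [h a ((p.mem_support_iff a).2 ha)]

theorem Runs.seq {c d : Prog} {s : State} {D : PMF State} {D' : State → PMF State} {τ₁ τ₂ : ℕ}
    (hc : Runs c s D τ₁) (hd : ∀ s' ∈ D.support, Runs d s' (D' s') τ₂) :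
    Runs (.seq c d) s (D.bind D') (τ₂ + τ₁ + 1) := by
  intro k T
  have h : run (T + (τ₂ + τ₁ + 1)) ⟨.seq c d :: k, s⟩ = run ((T + τ₂) + τ₁) ⟨c :: d :: k, s⟩ := by
    change (step _).bind (run (T + (τ₂ + τ₁))) = _
    simp [step, add_assoc]
  rw [h, hc, PMF.bind_bind]
  exact bind_congr_support fun s' hs' => hd s' hs' k T

theorem Runs.while_true {t : Test} {c : Prog} {s : State} {D : PMF State} {D' : State → PMF State}
    {τ₁ τ₂ : ℕ} (ht : t.Holds s)
    (hc : Runs c s D τ₁) (hd : ∀ s' ∈ D.support, Runs (.while t c) s' (D' s') τ₂) :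
    Runs (.while t c) s (D.bind D') (τ₂ + τ₁ + 1) := by
  intro k T
  have h : run (T + (τ₂ + τ₁ + 1)) ⟨.while t c :: k, s⟩
      = run ((T + τ₂) + τ₁) ⟨c :: .while t c :: k, s⟩ := by
    change (step _).bind (run (T + (τ₂ + τ₁))) = _
    simp [step, ht, add_assoc]
  rw [h, hc, PMF.bind_bind]
  exact bind_congr_support fun s' hs' => hd s' hs' k T

/-- The row `0` of the array `3`, where the random numbers are kept. -/
def State.samples (s : State) : ℕ → ℝ := s.arr 3 0

/-- The program ends after exactly `τ` steps, surely in a memory with the property `I`, and the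
distribution of the row `0` of the array `3` is `ν`. -/
def Samples (P : Prog) (s : State) (I : State → Prop) (ν : PMF (ℕ → ℝ)) (τ : ℕ) : Prop :=
  ∃ D, Runs P s D τ ∧ (∀ s' ∈ D.support, I s') ∧ D.map State.samples = ν

theorem RunsTo.samples {P : Prog} {s s' : State} {τ : ℕ} {I : State → Prop}
    (h : RunsTo P s s' τ) (hI : I s') : Samples P s I (PMF.pure s'.samples) τ :=
  ⟨_, h.runs, by simpa using hI, PMF.pure_map _ _⟩

theorem exists_kernel {I J : State → Prop} {P : Prog} {κ : (ℕ → ℝ) → PMF (ℕ → ℝ)} {τ : ℕ}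
    {D : PMF State} (hD : ∀ s' ∈ D.support, I s')
    (h : ∀ s', I s' → Samples P s' J (κ s'.samples) τ) :
    ∃ D' : State → PMF State, (∀ s' ∈ D.support, Runs P s' (D' s') τ) ∧
      (∀ s' ∈ (D.bind D').support, J s') ∧
      (D.bind D').map State.samples = (D.map State.samples).bind κ := by
  choose! D' h1 h2 h3 using h
  refine ⟨D', fun s' hs' => h1 s' (hD s' hs'), fun s' hs' => ?_, ?_⟩
  · obtain ⟨s'', hs'', hmem⟩ := (PMF.mem_support_bind_iff ..).1 hs'
    exact h2 s'' (hD _ hs'') s' hmem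
  · rw [PMF.map_bind, PMF.bind_map]
    exact bind_congr_support fun s' hs' => h3 s' (hD s' hs')

theorem Samples.seq {c d : Prog} {s : State} {I J : State → Prop} {ν : PMF (ℕ → ℝ)}
    {κ : (ℕ → ℝ) → PMF (ℕ → ℝ)} {τ₁ τ₂ : ℕ} (hc : Samples c s I ν τ₁)
    (hd : ∀ s', I s' → Samples d s' J (κ s'.samples) τ₂) :
    Samples (.seq c d) s J (ν.bind κ) (τ₂ + τ₁ + 1) := by
  obtain ⟨D, h1, h2, rfl⟩ := hc
  obtain ⟨D', h1', h2', h3'⟩ := exists_kernel h2 hd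
  exact ⟨_, h1.seq h1', h2', h3'⟩

theorem RunsTo.samples_seq {c d : Prog} {s s₁ : State} {I : State → Prop} {ν : PMF (ℕ → ℝ)}
    {τ₁ τ₂ : ℕ} (hc : RunsTo c s s₁ τ₁) (hd : Samples d s₁ I ν τ₂) :
    Samples (.seq c d) s I ν (τ₂ + τ₁ + 1) := by
  have h := (hc.samples (I := (· = s₁)) rfl).seq (κ := fun _ => ν) (fun s' hs' => hs' ▸ hd)
  rwa [PMF.pure_bind] at h

theorem Samples.seq_runsTo {c d : Prog} {s : State} {I J : State → Prop} {ν : PMF (ℕ → ℝ)}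
    {τ₁ τ₂ : ℕ} (hc : Samples c s I ν τ₁)
    (hd : ∀ s', I s' → ∃ s'', RunsTo d s' s'' τ₂ ∧ J s'' ∧ s''.samples = s'.samples) :
    Samples (.seq c d) s J ν (τ₂ + τ₁ + 1) := by
  have h := hc.seq (κ := PMF.pure) (J := J) (d := d) (τ₂ := τ₂) fun s' hs' => by
    obtain ⟨s'', h1, h2, h3⟩ := hd s' hs'
    rw [← h3]
    exact h1.samples h2
  rwa [PMF.bind_pure] at h

theorem Samples.while_true {t : Test} {c : Prog} {s : State} {I J : State → Prop}
    {ν : PMF (ℕ → ℝ)} {κ : (ℕ → ℝ) → PMF (ℕ → ℝ)} {τ₁ τ₂ : ℕ} (ht : t.Holds s)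
    (hc : Samples c s I ν τ₁)
    (hd : ∀ s', I s' → Samples (.while t c) s' J (κ s'.samples) τ₂) :
    Samples (.while t c) s J (ν.bind κ) (τ₂ + τ₁ + 1) := by
  obtain ⟨D, h1, h2, rfl⟩ := hc
  obtain ⟨D', h1', h2', h3'⟩ := exists_kernel h2 hd
  exact ⟨_, h1.while_true ht h1', h2', h3'⟩

/-- The distribution at time `k` of the Markov chain with the transition kernels `κ 0`, `κ 1`, … -/
noncomputable def chain {α : Type*} (κ : ℕ → α → PMF α) (a : α) : ℕ → PMF α
  | 0 => PMF.pure a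
  | k + 1 => (chain κ a k).bind (κ k)

/-- `j` transitions of a Markov chain from time `k`. -/
noncomputable def chainFrom {α : Type*} (κ : ℕ → α → PMF α) : ℕ → ℕ → α → PMF α
  | _, 0, a => PMF.pure a
  | k, j + 1, a => (κ k a).bind (chainFrom κ (k + 1) j)

theorem chain_bind_chainFrom {α : Type*} (κ : ℕ → α → PMF α) (a : α) (j k : ℕ) :
    (chain κ a k).bind (chainFrom κ k j) = chain κ a (k + j) := by
  induction j generalizing k with
  | zero => simp [chainFrom]
  | succ j ih =>
    have h : chainFrom κ k (j + 1) = fun a => (κ k a).bind (chainFrom κ (k + 1) j) := rfl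
    rw [h, ← PMF.bind_bind]
    change (chain κ a (k + 1)).bind _ = _
    rw [ih, add_assoc, add_comm 1 j]

theorem samples_while {r b N c : ℕ} {body : Prog} (I : ℕ → State → Prop)
    (κ : ℕ → (ℕ → ℝ) → PMF (ℕ → ℝ))
    (hI : ∀ k s, I k s → s.reg r = k ∧ s.reg b = N)
    (hstep : ∀ k s, k < N → I k s → Samples body s (I (k + 1)) (κ k s.samples) c)
    {s : State} (h0 : I 0 s) :
    Samples (.while (.natLt r b) body) s (I N) (chain κ s.samples N) (N * (c + 1) + 1) := by
  have key : ∀ j k s, k + j = N → I k s →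
      Samples (.while (.natLt r b) body) s (I N) (chainFrom κ k j s.samples)
        (j * (c + 1) + 1) := by
    intro j
    induction j with
    | zero =>
      intro k s hk hs
      obtain rfl : k = N := by omega
      obtain ⟨h1, h2⟩ := hI _ _ hs
      have ht : ¬ (Test.natLt r b).Holds s := by simp [Test.Holds, h1, h2]
      simpa [chainFrom] using (runsTo_while_false (c := body) ht).samples (I := I k) hs
    | succ j ih =>
      intro k s hk hs
      obtain ⟨h1, h2⟩ := hI _ _ hs
      have ht : (Test.natLt r b).Holds s := by simp [Test.Holds, h1, h2]; omega
      have := (hstep k s (by omega) hs).while_true ht fun s' hs' => ih (k + 1) s' (by omega) hs'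
      have e : (j + 1) * (c + 1) + 1 = j * (c + 1) + 1 + c + 1 := by ring
      rw [e]
      exact this
  have h := key N 0 s (by omega) h0
  have e := chain_bind_chainFrom κ s.samples N 0
  rw [chain, PMF.pure_bind, Nat.zero_add] at e
  rwa [e] at h

/-- A fair bit becomes the leading binary digit of a number in `(0, 1]`. -/
noncomputable def pushBit (u : ℝ) : PMF ℝ :=
  (PMF.uniformOfFintype Bool).map fun b => (u + if b then 1 else 0) / 2

/-- The uniform distribution on `1 / 2 ^ n, 2 / 2 ^ n, …, 1`. -/
noncomputable def dyadic : ℕ → PMF ℝ := chain (fun _ => pushBit) 1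

/-- Independent samples of `dyadic n` at the positions `0, …, k - 1`; the other entries are `0`. -/
noncomputable def dyadics (n : ℕ) : ℕ → PMF (ℕ → ℝ) :=
  chain (fun t f => (dyadic n).map fun u => Function.update f t u) 0

/-- Push the bit in register `7` to the entry of the array `3` whose column is in register `5`;
then advance register `6`. -/
def pushCode : Prog :=
  .seq (.ite (.natLt 4 7) (.op (.realConst (tmp 0) 1)) (.op (.realConst (tmp 0) 0))) <|
  .seq (.op (.realAdd ⟨3, 4, 5⟩ ⟨3, 4, 5⟩ (tmp 0))) <|
  .seq (.op (.realConst (tmp 1) 2)) <|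
  .seq (.op (.realDiv ⟨3, 4, 5⟩ ⟨3, 4, 5⟩ (tmp 1))) <|
  .op (.natAdd 6 6 2)

/-- Fill the array `3` with `n` random numbers of `n` bits, where `n` is in register `1`. -/
def sampleCode : Prog :=
  .seq (.op (.natConst 5 0)) <|
  .while (.natLt 5 1) <|
    .seq (.op (.realConst ⟨3, 4, 5⟩ 1)) <|
    .seq (.op (.natConst 6 0)) <|
    .seq (.while (.natLt 6 1) (.seq (.op (.coin 7)) pushCode)) <|
    .op (.natAdd 5 5 2)

/-- The memory while the numbers are drawn: the array `3` and the temporary arrays are exempted. -/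
structure Sampling (m n t i : ℕ) (σ : Store) (s : State) : Prop where
  reg0 : s.reg 0 = m
  reg1 : s.reg 1 = n
  reg2 : s.reg 2 = 1
  reg3 : s.reg 3 = 5
  reg4 : s.reg 4 = 0
  reg5 : s.reg 5 = t
  reg6 : s.reg 6 = i
  arr : ∀ a < 100, a ≠ 3 → s.arr a = σ a

theorem exists_runsTo_pushCode {m n t i : ℕ} {σ : Store} {s : State}
    (h : Sampling m n t i σ s) (b : Bool) :
    ∃ s', RunsTo pushCode (s.setReg 7 (if b then 1 else 0)) s' 10 ∧
      Sampling m n t (i + 1) σ s' ∧ s'.samples =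
        Function.update s.samples t ((s.samples t + if b then 1 else 0) / 2) := by
  have hite : RunsTo (.ite (.natLt 4 7) (.op (.realConst (tmp 0) 1))
    (.op (.realConst (tmp 0) 0))) (s.setReg 7 (if b then 1 else 0))
      ((s.setReg 7 (if b then 1 else 0)).write (tmp 0) (if b then 1 else 0)) 2 := by
    cases b
    · refine (runsTo_op ?_).ite_false ?_
      · simp [Op.exec]
      · simp [Test.Holds, State.setReg_reg]
    · refine (runsTo_op ?_).ite_true ?_
      · simp [Op.exec]
      · simp [Test.Holds, State.setReg_reg, h.reg4]
  refine ⟨_, hite.seq <| (runsTo_op rfl).seq <| (runsTo_op rfl).seq <| (runsTo_op rfl).seq <|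
    runsTo_op rfl, ?_, ?_⟩
  · constructor <;>
      simp [State.setReg_reg, h.reg0, h.reg1, h.reg2, h.reg3, h.reg4, h.reg5, h.reg6]
    intro a ha ha3
    rw [← h.arr a ha ha3]
    rw [State.write_arr_of_ne _ _ _ ha3, State.write_arr_of_ne _ _ _ (by simp [tmp]; omega),
      State.write_arr_of_ne _ _ _ ha3, State.write_arr_of_ne _ _ _ (by simp [tmp]; omega)]
    rfl
  · funext j
    simp only [State.samples, State.setReg_arr, State.write, State.read, tmp, State.setReg_reg,
      Function.update_apply, h.reg4, h.reg5]
    by_cases hj : j = t <;> simp [hj]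

theorem samples_coin_pushCode {m n t i : ℕ} {σ : Store} {s : State} (h : Sampling m n t i σ s) :
    Samples (.seq (.op (.coin 7)) pushCode) s (Sampling m n t (i + 1) σ)
      ((pushBit (s.samples t)).map fun u => Function.update s.samples t u) 12 := by
  choose g hg hI hs using exists_runsTo_pushCode h
  have hrun := (runs_op (.coin 7) s).seq (D' := fun s' => PMF.pure (g (decide (s'.reg 7 = 1))))
    (τ₂ := 10) (d := pushCode) (by
      intro s' hs'
      simp only [Op.exec, PMF.mem_support_map_iff] at hs'
      obtain ⟨b, -, rfl⟩ := hs'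
      have := (hg b).runs
      cases b <;> simpa [State.setReg_reg] using this)
  have hD : (PMF.uniformOfFintype Bool).map g =
      ((Op.coin 7).exec s).bind fun s' => PMF.pure (g (decide (s'.reg 7 = 1))) := by
    simp only [Op.exec, PMF.bind_map, Function.comp_def]
    refine bind_congr_support fun b _ => ?_
    cases b <;> simp [State.setReg_reg]
  refine ⟨(PMF.uniformOfFintype Bool).map g, hD ▸ hrun, ?_, ?_⟩
  · intro s' hs'
    obtain ⟨b, -, rfl⟩ := (PMF.mem_support_map_iff ..).1 hs'
    exact hI b
  · rw [PMF.map_comp, pushBit, PMF.map_comp]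
    congr 1
    funext b
    exact hs b

theorem chain_map_update (κ : ℝ → PMF ℝ) (f : ℕ → ℝ) (t k : ℕ) :
    chain (fun _ g => (κ (g t)).map fun u => Function.update g t u) f k =
      (chain (fun _ => κ) (f t) k).map fun u => Function.update f t u := by
  induction k with
  | zero => simp [chain, PMF.pure_map]
  | succ k ih =>
    simp only [chain, ih, PMF.bind_map, PMF.map_bind, Function.comp_def, Function.update_self,
      Function.update_idem]

theorem samples_sampleCode {m n : ℕ} {s : State} (h0 : s.reg 0 = m) (h1 : s.reg 1 = n)
    (h2 : s.reg 2 = 1)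
    (h3 : s.reg 3 = 5) (h4 : s.reg 4 = 0) (hs : s.arr 3 = 0) :
    Samples sampleCode s (fun s' => ∃ i, Sampling m n n i s.arr s') (dyadics n n)
      (n * (n * 13 + 8) + 3) := by
  have hbody : ∀ t s', t < n → (∃ i, Sampling m n t i s.arr s') →
      Samples (.seq (.op (.realConst ⟨3, 4, 5⟩ 1)) <| .seq (.op (.natConst 6 0)) <|
        .seq (.while (.natLt 6 1) (.seq (.op (.coin 7)) pushCode)) <| .op (.natAdd 5 5 2)) s'
        (fun s'' => ∃ i, Sampling m n (t + 1) i s.arr s'')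
        ((dyadic n).map fun u => Function.update s'.samples t u) (n * 13 + 7) := by
    rintro t s' - ⟨i, h⟩
    have hstart : Sampling m n t 0 s.arr ((s'.write ⟨3, 4, 5⟩ ((1 : ℚ) : ℝ)).setReg 6 0) := by
      constructor <;>
        simp [State.setReg_reg, h.reg0, h.reg1, h.reg2, h.reg3, h.reg4, h.reg5]
      intro a ha ha3
      rw [State.write_arr_of_ne _ _ _ ha3, h.arr a ha ha3]
    have hwhile := samples_while (r := 6) (b := 1) (N := n) (c := 12)
      (fun i s'' => Sampling m n t i s.arr s'')
      (fun _ f => (pushBit (f t)).map fun u => Function.update f t u)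
      (fun i s'' h'' => ⟨h''.reg6, h''.reg1⟩) (fun i s'' _ h'' => samples_coin_pushCode h'') hstart
    have hstart' : ((s'.write ⟨3, 4, 5⟩ ((1 : ℚ) : ℝ)).setReg 6 0).samples =
        Function.update s'.samples t 1 := by
      funext j
      simp only [State.samples, State.setReg_arr, State.write, Function.update_apply, h.reg4, h.reg5]
      by_cases hj : j = t <;> simp [hj]
    rw [hstart', chain_map_update, Function.update_self] at hwhile
    simp only [Function.update_idem] at hwhile
    have hend := hwhile.seq_runsTo (d := .op (.natAdd 5 5 2)) (τ₂ := 1)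
      (J := fun s'' => ∃ i, Sampling m n (t + 1) i s.arr s'') (fun s'' h'' => by
        refine ⟨_, runsTo_op rfl, ⟨n, ?_⟩, rfl⟩
        constructor <;> simp [State.setReg_reg, h''.reg0, h''.reg1, h''.reg2, h''.reg3, h''.reg4,
          h''.reg5, h''.reg6]
        exact h''.arr)
    have e : 1 + (n * (12 + 1) + 1) + 1 = n * 13 + 3 := by ring
    rw [e] at hend
    exact (runsTo_op rfl).samples_seq ((runsTo_op rfl).samples_seq hend)
  have hstart : Sampling m n 0 (s.reg 6) s.arr (s.setReg 5 0) := by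
    constructor <;> simp [State.setReg_reg, h0, h1, h2, h3, h4]
  have hwhile := samples_while (r := 5) (b := 1) (N := n) (c := n * 13 + 7)
    (fun t s' => ∃ i, Sampling m n t i s.arr s')
    (fun t f => (dyadic n).map fun u => Function.update f t u)
    (fun t s' ⟨i, h⟩ => ⟨h.reg5, h.reg1⟩) hbody ⟨_, hstart⟩
  have hzero : (s.setReg 5 0).samples = 0 := by
    funext j; simp [State.samples, hs]
  rw [hzero] at hwhile
  exact (runsTo_op rfl).samples_seq hwhile

/-! ### Expectations -/

/-- The expectation of a nonnegative function. -/
noncomputable def expect {α : Type*} (D : PMF α) (f : α → ENNReal) : ENNReal := ∑' a, D a * f a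

theorem expect_pure {α : Type*} (a : α) (f : α → ENNReal) : expect (PMF.pure a) f = f a := by
  rw [expect, tsum_eq_single a (by intro b hb; simp [hb])]
  simp

theorem expect_bind {α β : Type*} (D : PMF α) (κ : α → PMF β) (f : β → ENNReal) :
    expect (D.bind κ) f = expect D fun a => expect (κ a) f := by
  simp only [expect, PMF.bind_apply, ← ENNReal.tsum_mul_right, ← ENNReal.tsum_mul_left]
  rw [ENNReal.tsum_comm]
  simp only [mul_assoc]

theorem expect_map {α β : Type*} (D : PMF α) (g : α → β) (f : β → ENNReal) :
    expect (D.map g) f = expect D (f ∘ g) := by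
  rw [← PMF.bind_pure_comp, expect_bind]
  simp [expect_pure, Function.comp_def]

theorem expect_mono {α : Type*} {D : PMF α} {f g : α → ENNReal} (h : ∀ a, f a ≤ g a) :
    expect D f ≤ expect D g :=
  ENNReal.tsum_le_tsum fun a => by gcongr; exact h a

theorem expect_const_mul {α : Type*} (D : PMF α) (c : ENNReal) (f : α → ENNReal) :
    expect D (fun a => c * f a) = c * expect D f := by
  simp only [expect, ← ENNReal.tsum_mul_left]
  exact tsum_congr fun a => by ring

theorem expect_const {α : Type*} (D : PMF α) (c : ENNReal) : expect D (fun _ => c) = c := by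
  rw [expect, ENNReal.tsum_mul_right, D.tsum_coe, one_mul]

theorem expect_add {α : Type*} (D : PMF α) (f g : α → ENNReal) :
    expect D (fun a => f a + g a) = expect D f + expect D g := by
  simp only [expect, mul_add, ENNReal.tsum_add]

theorem expect_finsetSum {α ι : Type*} (D : PMF α) (s : Finset ι) (f : ι → α → ENNReal) :
    expect D (fun a => ∑ i ∈ s, f i a) = ∑ i ∈ s, expect D (f i) := by
  induction s using Finset.cons_induction with
  | empty => simp [expect_const]
  | cons i s hi ih => simp only [Finset.sum_cons, expect_add, ih]

theorem expect_pushBit (u : ℝ) (f : ℝ → ENNReal) :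
    expect (pushBit u) f = (f (u / 2) + f ((u + 1) / 2)) / 2 := by
  rw [pushBit, expect_map, expect, tsum_fintype]
  simp only [Fintype.sum_bool, PMF.uniformOfFintype_apply, Fintype.card_bool, Function.comp]
  simp [ENNReal.div_eq_inv_mul, mul_add, add_comm]

theorem expect_dyadic_succ (n : ℕ) (f : ℝ → ENNReal) :
    expect (dyadic (n + 1)) f =
      (expect (dyadic n) (fun u => f (u / 2)) + expect (dyadic n) fun u => f ((u + 1) / 2)) / 2 := by
  have h : dyadic (n + 1) = (dyadic n).bind pushBit := rfl
  rw [h, expect_bind]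
  simp only [expect_pushBit, ENNReal.div_eq_inv_mul, expect_const_mul, expect_add]

theorem expect_dyadic_zero (f : ℝ → ENNReal) : expect (dyadic 0) f = f 1 := expect_pure _ _

theorem expect_dyadic_succ_le (n : ℕ) (q : ℝ) (c d : ENNReal) :
    expect (dyadic (n + 1)) (fun u => if u ≤ q then c else d) =
      (expect (dyadic n) (fun u => if u ≤ 2 * q then c else d) +
        expect (dyadic n) (fun u => if u ≤ 2 * q - 1 then c else d)) / 2 := by
  rw [expect_dyadic_succ]
  have h1 : ∀ u : ℝ, u / 2 ≤ q ↔ u ≤ 2 * q := fun u => by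
    rw [div_le_iff₀ two_pos, mul_comm]
  simp only [h1, le_sub_iff_add_le]

theorem expect_dyadic_of_nonpos (n : ℕ) {q : ℝ} (hq : q ≤ 0) (c d : ENNReal) :
    expect (dyadic n) (fun u => if u ≤ q then c else d) = d := by
  induction n generalizing q with
  | zero => rw [expect_dyadic_zero, if_neg (by linarith)]
  | succ n ih =>
    rw [expect_dyadic_succ_le, ih (by linarith), ih (by linarith), ← two_mul, mul_div_assoc,
      ENNReal.mul_div_cancel (by simp) (by simp)]

theorem expect_dyadic_of_one_le (n : ℕ) {q : ℝ} (hq : 1 ≤ q) (c d : ENNReal) :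
    expect (dyadic n) (fun u => if u ≤ q then c else d) = c := by
  induction n generalizing q with
  | zero => rw [expect_dyadic_zero, if_pos (by linarith)]
  | succ n ih =>
    rw [expect_dyadic_succ_le, ih (by linarith), ih (by linarith), ← two_mul, mul_div_assoc,
      ENNReal.mul_div_cancel (by simp) (by simp)]

theorem half_le_ofReal {a b : ENNReal} {x y z : ℝ} (ha : a ≤ ENNReal.ofReal x)
    (hb : b ≤ ENNReal.ofReal y) (hx : 0 ≤ x) (hy : 0 ≤ y) (h : (x + y) / 2 ≤ z) :
    (a + b) / 2 ≤ ENNReal.ofReal z := by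
  refine le_trans ?_ (ENNReal.ofReal_le_ofReal h)
  rw [ENNReal.ofReal_div_of_pos two_pos, ENNReal.ofReal_add hx hy]
  simp only [ENNReal.ofReal_ofNat]
  gcongr

theorem expect_dyadic_le (n : ℕ) {q : ℝ} (hq : 0 ≤ q) :
    expect (dyadic n) (fun u => if u ≤ q then 1 else 0) ≤ ENNReal.ofReal q := by
  induction n generalizing q with
  | zero =>
    rw [expect_dyadic_zero]
    split_ifs with h
    · simpa using h
    · simp
  | succ n ih =>
    rw [expect_dyadic_succ_le]
    rcases le_total q (1 / 2) with h | h
    · rw [expect_dyadic_of_nonpos n (q := 2 * q - 1) (by linarith)]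
      exact half_le_ofReal (ih (by linarith)) (y := 0) (by simp) (by linarith) le_rfl (by linarith)
    · rw [expect_dyadic_of_one_le n (q := 2 * q) (by linarith)]
      exact half_le_ofReal (x := 1) (by simp) (ih (by linarith)) (by simp) (by linarith)
        (by linarith)

theorem expect_dyadic_gt (n : ℕ) {q : ℝ} (hq : q ≤ 1) :
    expect (dyadic n) (fun u => if u ≤ q then 0 else 1) ≤ ENNReal.ofReal (1 - q + 1 / 2 ^ n) := by
  induction n generalizing q with
  | zero =>
    rw [expect_dyadic_zero]
    split_ifs with h
    · simp
    · simpa using hq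
  | succ n ih =>
    have hpos : (0 : ℝ) < 1 / 2 ^ n := by positivity
    have hpow : (1 : ℝ) / 2 ^ (n + 1) = 1 / 2 ^ n / 2 := by rw [pow_succ]; field_simp
    rw [expect_dyadic_succ_le, hpow]
    rcases le_total q (1 / 2) with h | h
    · rw [expect_dyadic_of_nonpos n (q := 2 * q - 1) (by linarith)]
      exact half_le_ofReal (ih (by linarith)) (y := 1) (by simp) (by linarith) (by simp)
        (by linarith)
    · rw [expect_dyadic_of_one_le n (q := 2 * q) (by linarith)]
      exact half_le_ofReal (x := 0) (by simp) (ih (by linarith)) (by simp) (by linarith)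
        (by linarith)

/-- An event of probability `q ≤ 1 / 2` is simulated with `n` bits. Rounding the smaller of the
two probabilities down changes expectations by a factor of at most `1 + 2 / 2 ^ n`. -/
theorem expect_dyadic_ite_le (n : ℕ) {q F G : ℝ} (hq : 0 ≤ q) (hq' : q ≤ 1 / 2) (hF : 0 ≤ F)
    (hG : 0 ≤ G) :
    expect (dyadic n) (fun u => if u ≤ q then ENNReal.ofReal F else ENNReal.ofReal G) ≤
      ENNReal.ofReal ((1 + 2 / 2 ^ n) * (q * F + (1 - q) * G)) := by
  have h1 : (fun u : ℝ => if u ≤ q then ENNReal.ofReal F else ENNReal.ofReal G) = fun u =>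
      ENNReal.ofReal F * (if u ≤ q then 1 else 0) + ENNReal.ofReal G * (if u ≤ q then 0 else 1) := by
    ext u; split_ifs <;> simp
  have hpos : (0 : ℝ) < 1 / 2 ^ n := by positivity
  rw [h1, expect_add, expect_const_mul, expect_const_mul]
  calc _ ≤ ENNReal.ofReal F * ENNReal.ofReal q +
        ENNReal.ofReal G * ENNReal.ofReal (1 - q + 1 / 2 ^ n) := by
        gcongr
        · exact expect_dyadic_le n hq
        · exact expect_dyadic_gt n (by linarith)
    _ = ENNReal.ofReal (F * q + G * (1 - q + 1 / 2 ^ n)) := by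
        rw [← ENNReal.ofReal_mul hF, ← ENNReal.ofReal_mul hG, ← ENNReal.ofReal_add (by positivity)
          (mul_nonneg hG (by linarith))]
    _ ≤ _ := by
        refine ENNReal.ofReal_le_ofReal ?_
        have e : (2 : ℝ) / 2 ^ n = 2 * (1 / 2 ^ n) := by ring
        rw [e]
        have h2 : 0 ≤ 1 / 2 ^ n * (q * F) := by positivity
        have h3 : 0 ≤ 1 / 2 ^ n * G * (1 - 2 * q) :=
          mul_nonneg (by positivity) (by linarith)
        nlinarith

end RealRAM

namespace GramSchmidtWalk

open Real

/-! ### The moment generating function of a sign -/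

/-- The logarithm of the moment generating function, at `a`, of `X - x`, where `X` is a random
sign with mean `x`. -/
noncomputable def signCgf (a x : ℝ) : ℝ := log (cosh a + x * sinh a) - a * x

theorem cosh_add_mul_sinh_pos (a : ℝ) {x : ℝ} (hx : |x| ≤ 1) : 0 < cosh a + x * sinh a := by
  obtain ⟨h1, h2⟩ := abs_le.1 hx
  rw [cosh_eq, sinh_eq]
  have e : (exp a + exp (-a)) / 2 + x * ((exp a - exp (-a)) / 2) =
      ((1 + x) * exp a + (1 - x) * exp (-a)) / 2 := by ring
  rw [e]
  rcases le_total 0 x with h | h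
  · have : 0 < (1 + x) * exp a := by have := exp_pos a; positivity
    have : 0 ≤ (1 - x) * exp (-a) := mul_nonneg (by linarith) (exp_pos _).le
    linarith
  · have : 0 < (1 - x) * exp (-a) := mul_pos (by linarith) (exp_pos _)
    have : 0 ≤ (1 + x) * exp a := mul_nonneg (by linarith) (exp_pos _).le
    linarith

theorem signCgf_zero (x : ℝ) : signCgf 0 x = 0 := by simp [signCgf]

theorem signCgf_neg (a x : ℝ) : signCgf (-a) x = signCgf a (-x) := by simp [signCgf]

theorem signCgf_of_abs_eq_one (a : ℝ) {x : ℝ} (hx : |x| = 1) : signCgf a x = 0 := by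
  rcases (abs_eq zero_le_one).1 hx with rfl | rfl
  · simp [signCgf, cosh_add_sinh]
  · rw [signCgf, neg_one_mul, ← sub_eq_add_neg, cosh_sub_sinh]; simp

theorem hasDerivAt_signCgf (a : ℝ) {x : ℝ} (hx : |x| ≤ 1) :
    HasDerivAt (fun a => signCgf a x) ((sinh a + x * cosh a) / (cosh a + x * sinh a) - x) a := by
  have h := (((hasDerivAt_cosh a).add ((hasDerivAt_sinh a).const_mul x)).log
    (cosh_add_mul_sinh_pos a hx).ne').sub ((hasDerivAt_id a).mul_const x)
  simp only [one_mul] at h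
  exact h

theorem signCgf_monotoneOn {x : ℝ} (hx : |x| ≤ 1) :
    MonotoneOn (fun a => signCgf a x) (Set.Ici 0) := by
  refine monotoneOn_of_deriv_nonneg (convex_Ici 0)
    (fun a _ => (hasDerivAt_signCgf a hx).continuousAt.continuousWithinAt)
    (fun a _ => (hasDerivAt_signCgf a hx).differentiableAt.differentiableWithinAt) fun a ha => ?_
  rw [interior_Ici] at ha
  have hpos := cosh_add_mul_sinh_pos a hx
  rw [(hasDerivAt_signCgf a hx).deriv, sub_nonneg, le_div_iff₀ hpos]
  have hs : 0 < sinh a := sinh_pos_iff.2 ha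
  have hx2 : x ^ 2 ≤ 1 := (sq_le_one_iff_abs_le_one x).2 hx
  nlinarith

/-- The slope of `signCgf · x` at `a ≥ 0` is at most `a`: its derivative is at most `1`. -/
theorem signCgf_slope_le {a x : ℝ} (hx : |x| ≤ 1) (ha : 0 ≤ a) :
    (sinh a + x * cosh a) / (cosh a + x * sinh a) - x - a ≤ 0 := by
  have hd : ∀ b, HasDerivAt (fun b => (sinh b + x * cosh b) / (cosh b + x * sinh b) - x - b)
      (-((sinh b + x * cosh b) / (cosh b + x * sinh b)) ^ 2) b := by
    intro b
    have hpos := cosh_add_mul_sinh_pos b hx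
    have h := (((((hasDerivAt_sinh b).add ((hasDerivAt_cosh b).const_mul x)).div
      ((hasDerivAt_cosh b).add ((hasDerivAt_sinh b).const_mul x)) hpos.ne').sub_const x).sub
      (hasDerivAt_id b))
    refine h.congr_deriv ?_
    simp only [Pi.add_apply]
    field_simp
    ring
  have hanti : Antitone fun b => (sinh b + x * cosh b) / (cosh b + x * sinh b) - x - b :=
    antitone_of_deriv_nonpos (fun b => (hd b).differentiableAt) fun b => by
      rw [(hd b).deriv]; exact neg_nonpos.2 (sq_nonneg _)
  simpa using hanti ha

theorem signCgf_sub_sq_antitoneOn {x : ℝ} (hx : |x| ≤ 1) :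
    AntitoneOn (fun a => signCgf a x - a ^ 2 / 2) (Set.Ici 0) := by
  have hd : ∀ a, HasDerivAt (fun a => signCgf a x - a ^ 2 / 2)
      ((sinh a + x * cosh a) / (cosh a + x * sinh a) - x - a) a := fun a => by
    refine ((hasDerivAt_signCgf a hx).sub (((hasDerivAt_id a).pow 2).div_const 2)).congr_deriv ?_
    simp
  refine antitoneOn_of_deriv_nonpos (convex_Ici 0)
    (fun a _ => (hd a).continuousAt.continuousWithinAt)
    (fun a _ => (hd a).differentiableAt.differentiableWithinAt) fun a ha => ?_
  rw [interior_Ici] at ha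
  rw [(hd a).deriv]
  exact signCgf_slope_le hx (le_of_lt ha)

theorem signCgf_nonneg (a : ℝ) {x : ℝ} (hx : |x| ≤ 1) : 0 ≤ signCgf a x := by
  have key : ∀ {b y : ℝ}, |y| ≤ 1 → 0 ≤ b → 0 ≤ signCgf b y := fun {b y} hy hb => by
    simpa [signCgf_zero] using signCgf_monotoneOn hy (Set.mem_Ici.2 le_rfl) (Set.mem_Ici.2 hb) hb
  rcases le_total 0 a with h | h
  · exact key hx h
  · have := key (b := -a) (y := -x) (by simpa) (by linarith)
    rwa [signCgf_neg, neg_neg] at this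

/-- Hoeffding's lemma for a sign. -/
theorem signCgf_le (a : ℝ) {x : ℝ} (hx : |x| ≤ 1) : signCgf a x ≤ a ^ 2 / 2 := by
  have key : ∀ {b y : ℝ}, |y| ≤ 1 → 0 ≤ b → signCgf b y ≤ b ^ 2 / 2 := fun {b y} hy hb => by
    simpa [signCgf_zero] using
      signCgf_sub_sq_antitoneOn hy (Set.mem_Ici.2 le_rfl) (Set.mem_Ici.2 hb) hb
  rcases le_total 0 a with h | h
  · exact key hx h
  · have := key (b := -a) (y := -x) (by simpa) (by linarith)
    rwa [signCgf_neg, neg_neg, neg_sq] at this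

/-- By Titu's inequality `(a + ε) ^ 2 / (s + t) ≤ a ^ 2 / s + ε ^ 2 / t`, it remains to compare
`signCgf - a ^ 2 / 2` at `a` and at `a + ε`. This function decreases on the nonnegative reals; if `ε`
is negative, the slack in Titu's inequality is used instead. -/
theorem signCgf_add_le_of_nonneg {a ε s t x : ℝ} (hx : |x| ≤ 1) (ha : 0 ≤ a) (hs : 0 < s)
    (ht : 0 < t) (hst : s + t ≤ 1) :
    signCgf (a + ε) x + (a + ε) ^ 2 / 2 * (1 / (s + t) - 1) ≤
      signCgf a x + a ^ 2 / 2 * (1 / s - 1) + ε ^ 2 / t / 2 := by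
  have hdiff : a ^ 2 / s + ε ^ 2 / t - (a + ε) ^ 2 / (s + t) =
      (a * t - ε * s) ^ 2 / (s * t * (s + t)) := by field_simp; ring
  have hsplit : ∀ b r : ℝ, b ^ 2 / 2 * (1 / r - 1) = b ^ 2 / r / 2 - b ^ 2 / 2 := fun b r => by ring
  rw [hsplit, hsplit]
  rcases le_total 0 ε with hε | hε
  · have h1 := signCgf_sub_sq_antitoneOn hx (Set.mem_Ici.2 ha)
      (Set.mem_Ici.2 (add_nonneg ha hε)) (by linarith)
    have h2 : 0 ≤ (a * t - ε * s) ^ 2 / (s * t * (s + t)) := by positivity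
    simp only at h1
    linarith
  · have h2 : -4 * (a * ε) ≤ (a * t - ε * s) ^ 2 / (s * t * (s + t)) := by
      rw [le_div_iff₀ (by positivity)]
      have hae : 0 ≤ -(a * ε) * (s * t) := by
        have := mul_nonneg ha (neg_nonneg.2 hε); have := mul_pos hs ht; nlinarith
      nlinarith [sq_nonneg (a * t + ε * s)]
    have hae : a * ε ≤ 0 := mul_nonpos_of_nonneg_of_nonpos ha hε
    rcases le_total 0 (a + ε) with h | h
    · have h1 := signCgf_monotoneOn hx (Set.mem_Ici.2 h) (Set.mem_Ici.2 ha) (by linarith)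
      simp only at h1
      nlinarith [sq_nonneg ε]
    · have h1 := signCgf_le (a + ε) hx
      have h3 := signCgf_nonneg a hx
      nlinarith

/-- When part of the direction of the walk is released (`t` of squared length, along which the
functional grows by `ε`), the growth of the potential is paid for by the energy `D` released. -/
theorem signCgf_add_le {a ε s t x D : ℝ} (hx : |x| ≤ 1) (hs : 0 < s)
    (ht : 0 ≤ t) (hst : s + t ≤ 1) (hD : 0 ≤ D) (hε : ε ^ 2 ≤ t * D) :
    signCgf (a + ε) x + (a + ε) ^ 2 / 2 * (1 / (s + t) - 1) ≤
      signCgf a x + a ^ 2 / 2 * (1 / s - 1) + D / 2 := by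
  rcases ht.eq_or_lt with rfl | ht
  · have : ε = 0 := by
      have : ε ^ 2 ≤ 0 := by simpa using hε
      simpa using this
    subst this
    simp only [add_zero]
    linarith
  · have h1 : ε ^ 2 / t ≤ D := by rw [div_le_iff₀ ht]; linarith
    rcases le_total 0 a with ha | ha
    · linarith [signCgf_add_le_of_nonneg (ε := ε) hx ha hs ht hst]
    · have h := signCgf_add_le_of_nonneg (a := -a) (ε := -ε) (x := -x) (by simpa) (by linarith)
        hs ht hst
      rw [← neg_add, signCgf_neg, signCgf_neg, neg_neg, neg_sq, neg_sq, neg_sq] at h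
      linarith

/-! ### The potential of the walk -/

section Potential

variable {E : Type*} [NormedAddCommGroup E] [InnerProductSpace ℝ E]

local notation "⟪" x ", " y "⟫" => inner ℝ x y

/-- The span of the vectors with indices in `S`. -/
def spanOf (v : ℕ → E) (S : Finset ℕ) : Submodule ℝ E := Submodule.span ℝ (v '' S)

theorem spanOf_mono (v : ℕ → E) {S T : Finset ℕ} (h : S ⊆ T) : spanOf v S ≤ spanOf v T :=
  Submodule.span_mono (Set.image_mono (by exact_mod_cast h))

theorem mem_spanOf (v : ℕ → E) {S : Finset ℕ} {j : ℕ} (hj : j ∈ S) : v j ∈ spanOf v S :=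
  Submodule.subset_span ⟨j, by exact_mod_cast hj, rfl⟩

/-- The point of the walk with coordinates `x`. -/
def position (v : ℕ → E) (n : ℕ) (x : ℕ → ℝ) : E := ∑ j ∈ Finset.range n, x j • v j

theorem position_add_mul (v : ℕ → E) (n : ℕ) (x u : ℕ → ℝ) (δ : ℝ) :
    position v n (fun j => x j + δ * u j) = position v n x + δ • position v n u := by
  simp only [position, add_smul, Finset.sum_add_distrib, Finset.smul_sum, mul_smul]

variable [FiniteDimensional ℝ E]

/-- The squared length of the projection of `θ` to `K`. -/
noncomputable def energy (θ : E) (K : Submodule ℝ E) : ℝ := ‖K.starProjection θ‖ ^ 2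

theorem inner_sq_le_energy_sub {θ e : E} {K V : Submodule ℝ E} (hVK : V ≤ K) (he : e ∈ K)
    (heV : e ∈ Vᗮ) : 0 ≤ energy θ K - energy θ V ∧
      ⟪θ, e⟫ ^ 2 ≤ ‖e‖ ^ 2 * (energy θ K - energy θ V) := by
  set d := K.starProjection θ - V.starProjection θ with hd
  have hdV : d ∈ Vᗮ := by
    have h1 : θ - V.starProjection θ ∈ Vᗮ := V.sub_starProjection_mem_orthogonal θ
    have h2 : θ - K.starProjection θ ∈ Vᗮ :=
      Submodule.orthogonal_le hVK (K.sub_starProjection_mem_orthogonal θ)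
    have : d = (θ - V.starProjection θ) - (θ - K.starProjection θ) := by rw [hd]; abel
    rw [this]
    exact sub_mem h1 h2
  have hpyth : energy θ K - energy θ V = ‖d‖ ^ 2 := by
    have h0 : ⟪V.starProjection θ, d⟫ = 0 :=
      Submodule.inner_right_of_mem_orthogonal (Submodule.starProjection_apply_mem V θ) hdV
    have : K.starProjection θ = V.starProjection θ + d := by rw [hd]; abel
    rw [energy, energy, this, ← real_inner_self_eq_norm_sq, ← real_inner_self_eq_norm_sq,
      ← real_inner_self_eq_norm_sq, inner_add_add_self, real_inner_comm (V.starProjection θ) d, h0]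
    ring
  have hinner : ⟪θ, e⟫ = ⟪d, e⟫ := by
    have h1 : ⟪θ - K.starProjection θ, e⟫ = 0 :=
      Submodule.inner_left_of_mem_orthogonal he (K.sub_starProjection_mem_orthogonal θ)
    have h2 : ⟪V.starProjection θ, e⟫ = 0 :=
      Submodule.inner_right_of_mem_orthogonal (Submodule.starProjection_apply_mem V θ) heV
    rw [inner_sub_left] at h1
    rw [hd, inner_sub_left, h2]
    linarith
  rw [hpyth, hinner]
  refine ⟨by positivity, ?_⟩
  rw [← mul_pow, mul_comm]
  exact sq_le_sq' (by linarith [abs_le.1 (abs_real_inner_le_norm d e)])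
    (real_inner_le_norm d e)

theorem energy_le (θ : E) (K : Submodule ℝ E) : energy θ K ≤ ‖θ‖ ^ 2 := by
  have := K.norm_starProjection_apply_le θ
  exact pow_le_pow_left₀ (norm_nonneg _) this 2

/-- The component of `v p` orthogonal to the other vectors with indices in `S`. -/
noncomputable def residual (v : ℕ → E) (S : Finset ℕ) (p : ℕ) : E :=
  v p - (spanOf v (S.erase p)).starProjection (v p)

theorem residual_mem_orthogonal (v : ℕ → E) (S : Finset ℕ) (p : ℕ) :
    residual v S p ∈ (spanOf v (S.erase p))ᗮ :=
  Submodule.sub_starProjection_mem_orthogonal _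

theorem residual_mem (v : ℕ → E) {S : Finset ℕ} {p : ℕ} (hp : p ∈ S) :
    residual v S p ∈ spanOf v S :=
  sub_mem (mem_spanOf v hp)
    (spanOf_mono v (Finset.erase_subset p S) (Submodule.starProjection_apply_mem _ _))

theorem norm_residual_sq_le {v : ℕ → E} (S : Finset ℕ) {p : ℕ} (hv : ‖v p‖ ≤ 1) :
    ‖residual v S p‖ ^ 2 ≤ 1 := by
  have h : ⟪residual v S p, (spanOf v (S.erase p)).starProjection (v p)⟫ = 0 :=
    Submodule.inner_left_of_mem_orthogonal (Submodule.starProjection_apply_mem _ _)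
      (residual_mem_orthogonal v S p)
  have e : v p = residual v S p + (spanOf v (S.erase p)).starProjection (v p) := by
    rw [residual]; abel
  have h2 := norm_add_sq_real (residual v S p) ((spanOf v (S.erase p)).starProjection (v p))
  rw [← e, h] at h2
  have h3 : ‖v p‖ ^ 2 ≤ 1 := by
    have := norm_nonneg (v p)
    nlinarith
  nlinarith [sq_nonneg ‖(spanOf v (S.erase p)).starProjection (v p)‖]

/-- The logarithm of the potential during the phase with pivot `p`, where `L` is the current value
of the functional `θ`, and `x` that of the coordinate `p`. The cumulant function accounts for the
steps of the pivot along the present residual. The last term anticipates the growth of the residual;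
it vanishes when the residual has length `1`, its maximum. -/
noncomputable def phaseLog (θ : E) (v : ℕ → E) (S : Finset ℕ) (p : ℕ) (L x : ℝ) : ℝ :=
  L + energy θ (spanOf v (S.erase p)) / 2 + signCgf ⟪θ, residual v S p⟫ x +
    ⟪θ, residual v S p⟫ ^ 2 / 2 * (1 / ‖residual v S p‖ ^ 2 - 1)

/-- At the beginning of a phase the potential is bounded by the energy of any space that contains
the alive vectors. -/
theorem phaseLog_le (θ : E) (v : ℕ → E) {S : Finset ℕ} {p : ℕ} (L : ℝ) {x : ℝ} (hp : p ∈ S)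
    (hx : |x| ≤ 1) {K : Submodule ℝ E} (hK : spanOf v S ≤ K) :
    phaseLog θ v S p L x ≤ L + energy θ K / 2 := by
  obtain ⟨h0, h1⟩ := inner_sq_le_energy_sub (θ := θ)
    ((spanOf_mono v (Finset.erase_subset p S)).trans hK) (hK (residual_mem v hp))
    (residual_mem_orthogonal v S p)
  have h2 := signCgf_le ⟪θ, residual v S p⟫ hx
  have h3 : ⟪θ, residual v S p⟫ ^ 2 * (1 / ‖residual v S p‖ ^ 2) ≤
      energy θ K - energy θ (spanOf v (S.erase p)) := by
    rcases (sq_nonneg ‖residual v S p‖).eq_or_lt with h | h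
    · rw [← h]; simpa using h0
    · rw [mul_one_div, div_le_iff₀ h]; linarith
  rw [phaseLog]
  linarith

theorem phaseLog_of_abs_eq_one (θ : E) {v : ℕ → E} {S : Finset ℕ} {p : ℕ} (L : ℝ) {x : ℝ}
    (hx : |x| = 1) (hv : ‖v p‖ ≤ 1) :
    L + energy θ (spanOf v (S.erase p)) / 2 ≤ phaseLog θ v S p L x := by
  rw [phaseLog, signCgf_of_abs_eq_one _ hx]
  have h1 := norm_residual_sq_le S hv
  have h2 : 0 ≤ ⟪θ, residual v S p⟫ ^ 2 / 2 * (1 / ‖residual v S p‖ ^ 2 - 1) := by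
    rcases (sq_nonneg ‖residual v S p‖).eq_or_lt with h | h
    · have : residual v S p = 0 := by simpa using h.symm
      simp [this]
    · refine mul_nonneg (by positivity) ?_
      rw [sub_nonneg, le_div_iff₀ h]
      linarith
  linarith

/-- Freezing coordinates other than the pivot does not increase the potential. -/
theorem phaseLog_mono (θ : E) {v : ℕ → E} {S S' : Finset ℕ} {p : ℕ} (L : ℝ) {x : ℝ}
    (hx : |x| ≤ 1) (hS : S' ⊆ S) (hv : ‖v p‖ ≤ 1) (hw : residual v S p ≠ 0) :
    phaseLog θ v S' p L x ≤ phaseLog θ v S p L x := by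
  set V := spanOf v (S.erase p)
  set V' := spanOf v (S'.erase p)
  have hVV : V' ≤ V := spanOf_mono v (Finset.erase_subset_erase p hS)
  set e := residual v S' p - residual v S p with he
  have he' : e = V.starProjection (v p) - V'.starProjection (v p) := by
    rw [he, residual, residual]; abel
  have heV : e ∈ V := by
    rw [he']
    exact sub_mem (Submodule.starProjection_apply_mem _ _)
      (hVV (Submodule.starProjection_apply_mem _ _))
  have heV' : e ∈ V'ᗮ := sub_mem (residual_mem_orthogonal v S' p)
    (Submodule.orthogonal_le hVV (residual_mem_orthogonal v S p))
  obtain ⟨h0, h1⟩ := inner_sq_le_energy_sub (θ := θ) hVV heV heV'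
  have horth : ⟪residual v S p, e⟫ = 0 :=
    Submodule.inner_left_of_mem_orthogonal heV (residual_mem_orthogonal v S p)
  have hsum : residual v S' p = residual v S p + e := by rw [he]; abel
  have hnorm : ‖residual v S' p‖ ^ 2 = ‖residual v S p‖ ^ 2 + ‖e‖ ^ 2 := by
    rw [hsum, norm_add_sq_real, horth]; ring
  have key := signCgf_add_le (a := ⟪θ, residual v S p⟫) (ε := ⟪θ, e⟫) (s := ‖residual v S p‖ ^ 2)
    (t := ‖e‖ ^ 2) hx (by positivity) (by positivity)
    (by rw [← hnorm]; exact norm_residual_sq_le S' hv) h0 h1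
  rw [← inner_add_right, ← hsum, ← hnorm] at key
  rw [phaseLog, phaseLog]
  linarith

/-- The coordinates of `x` that are not yet frozen. -/
noncomputable def alive (n : ℕ) (x : ℕ → ℝ) : Finset ℕ := (Finset.range n).filter fun j => |x j| < 1

open Classical in
/-- The potential of the walk. The pivot is the largest alive index. -/
noncomputable def potential (θ : E) (v : ℕ → E) (n : ℕ) (x : ℕ → ℝ) : ℝ :=
  if h : (alive n x).Nonempty then
    exp (phaseLog θ v (alive n x) ((alive n x).max' h) ⟪θ, position v n x⟫ (x ((alive n x).max' h)))
  else exp ⟪θ, position v n x⟫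

theorem potential_pos (θ : E) (v : ℕ → E) (n : ℕ) (x : ℕ → ℝ) : 0 < potential θ v n x := by
  rw [potential]; split_ifs <;> exact exp_pos _

theorem mem_alive {n : ℕ} {x : ℕ → ℝ} {j : ℕ} : j ∈ alive n x ↔ j < n ∧ |x j| < 1 := by
  simp [alive]

theorem potential_le (θ : E) (v : ℕ → E) {n : ℕ} {x : ℕ → ℝ} {K : Submodule ℝ E}
    (hK : spanOf v (alive n x) ≤ K) :
    potential θ v n x ≤ exp (⟪θ, position v n x⟫ + energy θ K / 2) := by
  rw [potential]
  split_ifs with h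
  · exact exp_le_exp.2 (phaseLog_le θ v _ ((alive n x).max'_mem h)
      (mem_alive.1 ((alive n x).max'_mem h)).2.le hK)
  · refine exp_le_exp.2 ?_
    have : 0 ≤ energy θ K := sq_nonneg _
    linarith

theorem potential_zero_le (θ : E) (v : ℕ → E) (n : ℕ) :
    potential θ v n 0 ≤ exp (‖θ‖ ^ 2 / 2) := by
  refine (potential_le θ v (K := ⊤) le_top).trans (exp_le_exp.2 ?_)
  have : position v n 0 = 0 := by simp [position]
  rw [this, inner_zero_right]
  linarith [energy_le θ ⊤]

/-- A direction of the walk: it moves the pivot at unit speed and only alive coordinates, along the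
residual of the pivot. -/
structure IsDirection (v : ℕ → E) (n : ℕ) (S : Finset ℕ) (p : ℕ) (u : ℕ → ℝ) : Prop where
  pivot : u p = 1
  frozen : ∀ j < n, j ∉ S → u j = 0
  position_eq : position v n u = residual v S p

/-- After a move along a direction, the potential is bounded by a function that is affine in the
length of the move. -/
theorem potential_move_le (θ : E) {v : ℕ → E} {n : ℕ} {x u : ℕ → ℝ} {δ : ℝ}
    (h : (alive n x).Nonempty) (hu : IsDirection v n (alive n x) ((alive n x).max' h) u)
    (hv : ∀ j < n, ‖v j‖ ≤ 1) (hw : residual v (alive n x) ((alive n x).max' h) ≠ 0)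
    (hx' : ∀ j < n, |x j + δ * u j| ≤ 1) :
    potential θ v n (fun j => x j + δ * u j) ≤
      exp (phaseLog θ v (alive n x) ((alive n x).max' h)
        (⟪θ, position v n x⟫ + δ * ⟪θ, residual v (alive n x) ((alive n x).max' h)⟫)
        (x ((alive n x).max' h) + δ)) := by
  set S := alive n x with hS
  set p := S.max' h with hp
  set x' : ℕ → ℝ := fun j => x j + δ * u j with hx'def
  have hpS : p ∈ S := S.max'_mem h
  have hpn : p < n := (mem_alive.1 hpS).1
  have hL : ⟪θ, position v n x'⟫ = ⟪θ, position v n x⟫ + δ * ⟪θ, residual v S p⟫ := by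
    rw [position_add_mul, hu.position_eq, inner_add_right, inner_smul_right]
  have hxp : x' p = x p + δ := by simp [hx'def, hu.pivot]
  have hsub : alive n x' ⊆ S := by
    intro j hj
    obtain ⟨hjn, hj1⟩ := mem_alive.1 hj
    by_contra hjS
    have : x' j = x j := by simp [hx'def, hu.frozen j hjn hjS]
    exact hjS (mem_alive.2 ⟨hjn, this ▸ hj1⟩)
  rw [← hL, ← hxp]
  by_cases hpa : p ∈ alive n x'
  · have hne : (alive n x').Nonempty := ⟨p, hpa⟩
    have hmax : (alive n x').max' hne = p :=
      le_antisymm (Finset.max'_subset hne hsub) (Finset.le_max' _ _ hpa)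
    rw [potential, dif_pos hne, hmax]
    exact exp_le_exp.2 (phaseLog_mono θ _ (hx' p hpn) hsub (hv p hpn) hw)
  -- the pivot is frozen, so that a new phase begins, whatever the new pivot is
  · have h1 : |x' p| = 1 :=
      le_antisymm (hx' p hpn) (not_lt.1 fun hlt => hpa (mem_alive.2 ⟨hpn, hlt⟩))
    refine (potential_le θ v (K := spanOf v (S.erase p)) ?_).trans
      (exp_le_exp.2 (phaseLog_of_abs_eq_one θ _ h1 (hv p hpn)))
    exact spanOf_mono v fun j hj => Finset.mem_erase.2 ⟨fun e => hpa (e ▸ hj), hsub hj⟩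

/-- The potential does not increase in expectation under the driftless choice between two opposite
moves. -/
theorem potential_move_two_le (θ : E) {v : ℕ → E} {n : ℕ} {x u : ℕ → ℝ} {δ δ' : ℝ}
    (h : (alive n x).Nonempty) (hu : IsDirection v n (alive n x) ((alive n x).max' h) u)
    (hv : ∀ j < n, ‖v j‖ ≤ 1) (hw : residual v (alive n x) ((alive n x).max' h) ≠ 0)
    (hx : ∀ j < n, |x j| ≤ 1) (hδ : 0 < δ) (hδ' : 0 < δ')
    (h1 : ∀ j < n, |x j + δ * u j| ≤ 1) (h2 : ∀ j < n, |x j + -δ' * u j| ≤ 1) :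
    δ' / (δ + δ') * potential θ v n (fun j => x j + δ * u j) +
      δ / (δ + δ') * potential θ v n (fun j => x j + -δ' * u j) ≤ potential θ v n x := by
  have hp1 := potential_move_le θ h hu hv hw h1
  have hp2 := potential_move_le θ h hu hv hw h2
  set S := alive n x with hS
  set p := S.max' h with hp
  have hpn : p < n := (mem_alive.1 (S.max'_mem h)).1
  set a := ⟪θ, residual v S p⟫ with ha
  set c := exp (⟪θ, position v n x⟫ + energy θ (spanOf v (S.erase p)) / 2 - a * x p +
    a ^ 2 / 2 * (1 / ‖residual v S p‖ ^ 2 - 1)) with hc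
  -- on the segment of the walk, the bound is affine in the coordinate of the pivot
  have key : ∀ ε : ℝ, |x p + ε * u p| ≤ 1 →
      exp (phaseLog θ v S p (⟪θ, position v n x⟫ + ε * a) (x p + ε)) =
        c * (cosh a + (x p + ε) * sinh a) := by
    intro ε hε
    rw [hu.pivot, mul_one] at hε
    have hpos := cosh_add_mul_sinh_pos a hε
    rw [phaseLog, ← ha, signCgf, hc]
    rw [← exp_log hpos, ← exp_add, exp_log hpos]
    congr 1
    ring
  have h0 : potential θ v n x = c * (cosh a + x p * sinh a) := by
    rw [potential, dif_pos h, ← add_zero (x p), ← key 0 (by simpa using hx p hpn), zero_mul,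
      add_zero, add_zero]
  rw [key δ (h1 p hpn)] at hp1
  rw [key (-δ') (h2 p hpn)] at hp2
  have hsum : 0 < δ + δ' := by linarith
  calc _ ≤ δ' / (δ + δ') * (c * (cosh a + (x p + δ) * sinh a)) +
        δ / (δ + δ') * (c * (cosh a + (x p + -δ') * sinh a)) := by gcongr
    _ = potential θ v n x := by rw [h0]; field_simp; ring

theorem potential_of_alive_eq_empty (θ : E) (v : ℕ → E) {n : ℕ} {x : ℕ → ℝ}
    (h : alive n x = ∅) : potential θ v n x = exp ⟪θ, position v n x⟫ := by
  rw [potential, dif_neg (by simp [h])]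

end Potential

end GramSchmidtWalk

namespace RealRAM

open Finset

/-! ### Array operations in structured programs -/

instance : Add Expr := ⟨Expr.add⟩
instance : Sub Expr := ⟨Expr.sub⟩
instance : Mul Expr := ⟨Expr.mul⟩
instance : Div Expr := ⟨Expr.div⟩

namespace Expr

variable {ρ : ℕ → ℕ} {σ : Store}

theorem eval_const (q : ℚ) : (const q).eval ρ σ = q := rfl
theorem eval_cell (a i j : ℕ) : (cell a i j).eval ρ σ = σ a (ρ i) (ρ j) := rfl
theorem eval_add (e f : Expr) : (e + f).eval ρ σ = e.eval ρ σ + f.eval ρ σ := rfl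
theorem eval_sub (e f : Expr) : (e - f).eval ρ σ = e.eval ρ σ - f.eval ρ σ := rfl
theorem eval_mul (e f : Expr) : (e * f).eval ρ σ = e.eval ρ σ * f.eval ρ σ := rfl
theorem eval_div (e f : Expr) : (e / f).eval ρ σ = e.eval ρ σ / f.eval ρ σ := rfl
theorem eval_sum (r b : ℕ) (e : Expr) :
    (sum r b e).eval ρ σ = ∑ k ∈ range (ρ b), e.eval (Function.update ρ r k) σ := rfl
theorem eval_lt (e f g h : Expr) : (lt e f g h).eval ρ σ =
    if e.eval ρ σ < f.eval ρ σ then g.eval ρ σ else h.eval ρ σ := rfl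
theorem eval_nlt (i j : ℕ) (g h : Expr) : (nlt i j g h).eval ρ σ =
    if ρ i < ρ j then g.eval ρ σ else h.eval ρ σ := rfl

end Expr

namespace Stmt

theorem den_seq {ρ : ℕ → ℕ} {σ : Store} (c d : Stmt) :
    (seq c d).den ρ σ = d.den ρ (c.den ρ σ) := rfl

theorem den_assign {ρ : ℕ → ℕ} {σ : Store} (a i j : ℕ) (e : Expr) :
    (assign a i j e).den ρ σ = Function.update σ a fun i' j' =>
      if i' = ρ i ∧ j' = ρ j then e.eval ρ σ else σ a i' j' := by
  funext a' i' j'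
  rw [den, Store.upd]
  by_cases ha : a' = a
  · subst ha; simp
  · simp [ha]

/-- The arrays that a statement may change. -/
def writes : Stmt → List ℕ
  | assign a _ _ _ => [a]
  | seq c d => c.writes ++ d.writes
  | loop _ _ c => c.writes

theorem den_eq_of_notMem_writes {c : Stmt} {a : ℕ} (h : a ∉ c.writes) (ρ : ℕ → ℕ) (σ : Store) :
    c.den ρ σ a = σ a := by
  induction c generalizing ρ σ with
  | assign b i j e =>
    rw [den_assign, Function.update_of_ne (by simpa [writes] using h)]
  | seq c d ihc ihd =>
    simp only [writes, List.mem_append, not_or] at h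
    rw [den_seq, ihd h.2, ihc h.1]
  | loop r b c ih =>
    exact den_loop_induction (fun _ τ => τ a = σ a) rfl fun k τ _ hτ => by rw [ih h, hτ]

/-- Fill an initial segment of the row held by register `i` of the array `a`. -/
def row (a i c b : ℕ) (e : Expr) : Stmt := loop c b (assign a i c e)

theorem den_row {ρ : ℕ → ℕ} {σ : Store} {a i c b : ℕ} {e : Expr} (g : ℕ → ℝ) (hic : i ≠ c)
    (h : ∀ j < ρ b, ∀ τ : Store, (∀ a', a' ≠ a → τ a' = σ a') →
      (∀ i', i' ≠ ρ i → τ a i' = σ a i') → τ a (ρ i) j = σ a (ρ i) j →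
      e.eval (Function.update ρ c j) τ = g j) :
    (row a i c b e).den ρ σ = Function.update σ a fun i' j =>
      if i' = ρ i ∧ j < ρ b then g j else σ a i' j := by
  refine den_loop_induction (fun k τ => τ = Function.update σ a fun i' j =>
      if i' = ρ i ∧ j < k then g j else σ a i' j) (by simp) ?_
  rintro k τ hk rfl
  rw [den_assign, Function.update_idem, Function.update_of_ne hic, Function.update_self]
  congr 1
  funext i' j
  rw [h k hk]
  · by_cases hi : i' = ρ i
    · rcases lt_trichotomy j k with hj | rfl | hj
      · simp [hi, hj, hj.ne, hj.trans (Nat.lt_succ_self k)]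
      · simp [hi]
      · simp [hi, hj.ne', hj.not_gt, Nat.not_lt.2 (Nat.succ_le_of_lt hj)]
    · simp [hi]
  · exact fun a' ha' => Function.update_of_ne ha' _ _
  · exact fun i' hi' => by funext j; simp [hi']
  · simp

/-- Fill an upper left block of the array `a`. -/
def table (a r b c d : ℕ) (e : Expr) : Stmt := loop r b (row a r c d e)

theorem den_table {ρ : ℕ → ℕ} {σ : Store} {a r b c d : ℕ} {e : Expr} (g : ℕ → ℕ → ℝ)
    (hrc : r ≠ c) (hrd : d ≠ r)
    (h : ∀ i < ρ b, ∀ j < ρ d, ∀ τ : Store, (∀ a', a' ≠ a → τ a' = σ a') →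
      τ a i j = σ a i j →
      e.eval (Function.update (Function.update ρ r i) c j) τ = g i j) :
    (table a r b c d e).den ρ σ = Function.update σ a fun i j =>
      if i < ρ b ∧ j < ρ d then g i j else σ a i j := by
  refine den_loop_induction (fun k τ => τ = Function.update σ a fun i j =>
      if i < k ∧ j < ρ d then g i j else σ a i j) (by simp) ?_
  rintro k τ hk rfl
  rw [den_row (g k) hrc, Function.update_idem]
  · congr 1
    funext i j
    rw [Function.update_self, Function.update_self, Function.update_of_ne hrd]
    rcases lt_trichotomy i k with hi | rfl | hi
    · simp [hi, hi.ne, hi.trans (Nat.lt_succ_self k)]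
    · simp
    · simp [hi.ne', hi.not_gt, Nat.not_lt.2 (Nat.succ_le_of_lt hi)]
  · intro j hj τ h1 h2 h3
    rw [Function.update_of_ne hrd] at hj
    refine h k hk j hj τ (fun a' ha' => ?_) ?_
    · rw [h1 a' ha', Function.update_of_ne ha']
    · rw [Function.update_self] at h3
      rw [h3]
      simp

end Stmt

/-! ### Gram-Schmidt orthogonalization for a bilinear form -/

/-- The bilinear form with matrix `M` on `ℝⁿ`. -/
def bil (n : ℕ) (M : ℕ → ℕ → ℝ) (x y : ℕ → ℝ) : ℝ :=
  ∑ a ∈ range n, ∑ b ∈ range n, x a * M a b * y b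

/-- The row `k` of the Gram-Schmidt process, with respect to the form `M`, of those standard basis
vectors on which the weight `μ` is `1`. The rows of weight `0` vanish; they do not contribute to
later rows, as division by zero returns zero. -/
noncomputable def gsRow (n : ℕ) (M : ℕ → ℕ → ℝ) (μ : ℕ → ℝ) (k : ℕ) : ℕ → ℝ := fun c =>
  μ k * ((if k = c then 1 else 0) - ∑ j : Fin k,
    (∑ l ∈ range n, M k l * gsRow n M μ j l) / bil n M (gsRow n M μ j) (gsRow n M μ j) *
      gsRow n M μ j c)
termination_by k
decreasing_by all_goals exact j.2

theorem gsRow_eq (n : ℕ) (M : ℕ → ℕ → ℝ) (μ : ℕ → ℝ) (k c : ℕ) :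
    gsRow n M μ k c = μ k * ((if k = c then 1 else 0) - ∑ j ∈ range k,
      (∑ l ∈ range n, M k l * gsRow n M μ j l) / bil n M (gsRow n M μ j) (gsRow n M μ j) *
        gsRow n M μ j c) := by
  rw [gsRow, ← Fin.sum_univ_eq_sum_range (fun j => (∑ l ∈ range n, M k l * gsRow n M μ j l) /
    bil n M (gsRow n M μ j) (gsRow n M μ j) * gsRow n M μ j c)]

/-- The quadratic form of the array `M` at the row held by register `k` of the array `V`. -/
def quadExpr (V k M r s : ℕ) : Expr :=
  .sum r 1 (.sum s 1 (.cell V k r * .cell M r s * .cell V k s))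

/-- The Gram-Schmidt process for the form in the array `M` and the weights in the array `7`. The
rows are stored in the array `8`, their values under the quadratic form in the array `9`. -/
def gsCode (M : ℕ) : Stmt :=
  .loop 20 1 <| .seq
    (.row 8 20 21 1 (.cell 7 4 20 * (.nlt 20 21 (.const 0) (.nlt 21 20 (.const 0) (.const 1)) -
      .sum 22 1 (.nlt 22 20 (.sum 23 1 (.cell M 20 23 * .cell 8 22 23) / .cell 9 4 22 *
        .cell 8 22 21) (.const 0)))))
    (.assign 9 4 20 (quadExpr 8 20 M 23 24))

theorem sum_range_ite_lt {n k : ℕ} (hk : k ≤ n) (f : ℕ → ℝ) :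
    (∑ j ∈ range n, if j < k then f j else 0) = ∑ j ∈ range k, f j := by
  rw [← sum_filter]
  congr 1
  ext j
  simp only [mem_filter, mem_range]
  omega

theorem bil_congr {n : ℕ} {M M' : ℕ → ℕ → ℝ} {x x' y y' : ℕ → ℝ}
    (hM : ∀ a < n, ∀ b < n, M a b = M' a b) (hx : ∀ a < n, x a = x' a) (hy : ∀ a < n, y a = y' a) :
    bil n M x y = bil n M' x' y' :=
  sum_congr rfl fun a ha => sum_congr rfl fun b hb => by
    rw [mem_range] at ha hb
    rw [hM a ha b hb, hx a ha, hy b hb]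

theorem ite_lt_ite_lt (k c : ℕ) :
    (if k < c then (0 : ℝ) else if c < k then 0 else 1) = if k = c then 1 else 0 := by
  split_ifs <;> first | rfl | omega

theorem gsCode_spec {n aM : ℕ} {ρ : ℕ → ℕ} {σ : Store} {M : ℕ → ℕ → ℝ} {μ : ℕ → ℝ}
    (h1 : ρ 1 = n) (h4 : ρ 4 = 0) (h8 : aM ≠ 8) (h9 : aM ≠ 9)
    (hM : ∀ a < n, ∀ b < n, σ aM a b = M a b) (hμ : ∀ k < n, σ 7 0 k = μ k) :
    (∀ k < n, ∀ c < n, (gsCode aM).den ρ σ 8 k c = gsRow n M μ k c) := by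
  have key := Stmt.den_loop_induction (ρ := ρ) (σ := σ) (r := 20) (b := 1)
    (c := .seq
    (.row 8 20 21 1 (.cell 7 4 20 * (.nlt 20 21 (.const 0) (.nlt 21 20 (.const 0) (.const 1)) -
      .sum 22 1 (.nlt 22 20 (.sum 23 1 (.cell aM 20 23 * .cell 8 22 23) / .cell 9 4 22 *
        .cell 8 22 21) (.const 0)))))
    (.assign 9 4 20 (quadExpr 8 20 aM 23 24)))
    (fun k τ => (∀ a, a ≠ 8 → a ≠ 9 → τ a = σ a) ∧
      (∀ j < k, ∀ c < n, τ 8 j c = gsRow n M μ j c) ∧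
      (∀ j < k, τ 9 0 j = bil n M (gsRow n M μ j) (gsRow n M μ j)))
    ⟨by simp, by simp, by simp⟩ ?_
  · rw [h1] at key
    exact key.2.1
  · rintro k τ hk ⟨hframe, hV, hD⟩
    rw [h1] at hk
    rw [Stmt.den_seq, Stmt.den_row (gsRow n M μ k) (by norm_num)]
    · rw [Stmt.den_assign]
      have e1 : (quadExpr 8 20 aM 23 24).eval (Function.update ρ 20 k)
          (Function.update τ 8 fun i' j => if i' = Function.update ρ 20 k 20 ∧
            j < Function.update ρ 20 k 1 then gsRow n M μ k j else τ 8 i' j) =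
          bil n M (gsRow n M μ k) (gsRow n M μ k) := by
        simp only [quadExpr, Expr.eval_sum, Expr.eval_mul, Expr.eval_cell]
        simp [h1, h8, hframe aM h8 h9, bil]
        refine sum_congr rfl fun a ha => sum_congr rfl fun b hb => ?_
        rw [mem_range] at ha hb
        simp [ha, hb, hM a ha b hb]
      rw [e1]
      refine ⟨fun a ha8 ha9 => ?_, fun j hj c hc => ?_, fun j hj => ?_⟩
      · simp [ha8, ha9, hframe a ha8 ha9]
      · simp only [Function.update_apply]
        simp [h1, hc]
        split_ifs with hjk
        · rw [hjk]
        · exact hV j (by omega) c hc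
      · simp only [Function.update_apply]
        simp [h4]
        split_ifs with hjk
        · rw [hjk]
        · exact hD j (by omega)
    · intro c hc τ' hτ1 hτ2 hτ3
      rw [gsRow_eq, ← sum_range_ite_lt hk.le]
      simp only [Expr.eval_mul, Expr.eval_sub, Expr.eval_sum, Expr.eval_nlt, Expr.eval_div,
        Expr.eval_const, Expr.eval_cell]
      simp [h1, h4] at hc hτ2 hτ3 ⊢
      rw [ite_lt_ite_lt, hτ1 7 (by norm_num), hframe 7 (by norm_num) (by norm_num), hμ k hk]
      congr 2
      refine sum_congr rfl fun j hj => ?_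
      split_ifs with hjk
      · rw [hτ2 j hjk.ne, hV j hjk c hc, hτ1 9 (by norm_num), hD j hjk]
        congr 2
        refine sum_congr rfl fun l hl => ?_
        rw [mem_range] at hl
        rw [hV j hjk l hl, hτ1 aM h8, hframe aM h8 h9, hM k hk l hl]
      · rfl

end RealRAM

namespace RealRAM

open Finset

section Bil

variable {n : ℕ} {M : ℕ → ℕ → ℝ} {μ : ℕ → ℝ}

/-- The upper left block of size `n` is symmetric. -/
def SymmOn (n : ℕ) (M : ℕ → ℕ → ℝ) : Prop := ∀ a < n, ∀ b < n, M a b = M b a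

theorem bil_comm (hM : SymmOn n M) (x y : ℕ → ℝ) : bil n M x y = bil n M y x := by
  rw [bil, sum_comm]
  refine sum_congr rfl fun a ha => sum_congr rfl fun b hb => ?_
  rw [hM b (mem_range.1 hb) a (mem_range.1 ha)]
  ring

theorem bil_single_right (x : ℕ → ℝ) {k : ℕ} (hk : k < n) :
    bil n M x (fun c => if k = c then 1 else 0) = ∑ l ∈ range n, x l * M l k :=
  sum_congr rfl fun a _ => by
    rw [sum_eq_single_of_mem k (mem_range.2 hk) (fun b _ hb => by simp [hb.symm])]; simp

theorem bil_single_right_of_symm (hM : SymmOn n M) (x : ℕ → ℝ) {k : ℕ} (hk : k < n) :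
    bil n M x (fun c => if k = c then 1 else 0) = ∑ l ∈ range n, M k l * x l := by
  rw [bil_single_right x hk]
  exact sum_congr rfl fun l hl => by rw [hM l (mem_range.1 hl) k hk, mul_comm]

theorem bil_sub_right (x y z : ℕ → ℝ) :
    bil n M x (fun c => y c - z c) = bil n M x y - bil n M x z := by
  simp only [bil, mul_sub, sum_sub_distrib]

theorem bil_smul_right (x y : ℕ → ℝ) (r : ℝ) :
    bil n M x (fun c => r * y c) = r * bil n M x y := by
  simp only [bil, mul_sum]
  exact sum_congr rfl fun a _ => sum_congr rfl fun b _ => by ring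

theorem bil_sum_right (x : ℕ → ℝ) (s : Finset ℕ) (t : ℕ → ℝ) (z : ℕ → ℕ → ℝ) :
    bil n M x (fun c => ∑ j ∈ s, t j * z j c) = ∑ j ∈ s, t j * bil n M x (z j) := by
  induction s using Finset.cons_induction with
  | empty => simp [bil]
  | cons i s hi ih =>
    simp only [sum_cons]
    rw [← ih, ← bil_smul_right]
    simp only [bil, mul_add, sum_add_distrib]

theorem bil_sum_left (y : ℕ → ℝ) (s : Finset ℕ) (t : ℕ → ℝ) (z : ℕ → ℕ → ℝ) :
    bil n M (fun c => ∑ j ∈ s, t j * z j c) y = ∑ j ∈ s, t j * bil n M (z j) y := by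
  have h : ∀ x y, bil n M x y = bil n (fun a b => M b a) y x := fun x y => by
    rw [bil, sum_comm]
    exact sum_congr rfl fun a _ => sum_congr rfl fun b _ => by ring
  rw [h, bil_sum_right]
  simp only [← h]

theorem gsRow_of_lt {k c : ℕ} (hkc : k < c) : gsRow n M μ k c = 0 := by
  induction k using Nat.strong_induction_on with
  | _ k ih =>
    rw [gsRow_eq, if_neg hkc.ne, sum_eq_zero]
    · simp
    · intro j hj
      rw [mem_range] at hj
      rw [ih j hj (hj.trans hkc), mul_zero]

theorem gsRow_self (k : ℕ) : gsRow n M μ k k = μ k := by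
  rw [gsRow_eq, if_pos rfl, sum_eq_zero]
  · simp
  · intro j hj
    rw [gsRow_of_lt (mem_range.1 hj), mul_zero]

theorem gsRow_of_weight_eq_zero {k : ℕ} (hk : μ k = 0) (c : ℕ) : gsRow n M μ k c = 0 := by
  rw [gsRow_eq, hk, zero_mul]

theorem gsRow_apply_of_weight_eq_zero {c : ℕ} (hc : μ c = 0) (k : ℕ) : gsRow n M μ k c = 0 := by
  induction k using Nat.strong_induction_on with
  | _ k ih =>
    by_cases hkc : k = c
    · subst hkc; exact gsRow_of_weight_eq_zero hc _
    · rw [gsRow_eq, if_neg hkc, sum_eq_zero]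
      · simp
      · exact fun j hj => by rw [ih j (mem_range.1 hj), mul_zero]

/-- The rows of the Gram-Schmidt process are orthogonal. -/
theorem bil_gsRow_eq_zero (hM : SymmOn n M)
    (h : ∀ j < n, bil n M (gsRow n M μ j) (gsRow n M μ j) = 0 → ∀ c < n, gsRow n M μ j c = 0)
    {k : ℕ} (hk : k < n) {j : ℕ} (hj : j < k) : bil n M (gsRow n M μ j) (gsRow n M μ k) = 0 := by
  induction k using Nat.strong_induction_on generalizing j with
  | _ k ih =>
    have e : gsRow n M μ k = fun c => μ k * ((if k = c then 1 else 0) - ∑ j ∈ range k,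
        (∑ l ∈ range n, M k l * gsRow n M μ j l) / bil n M (gsRow n M μ j) (gsRow n M μ j) *
        gsRow n M μ j c) := funext fun c => gsRow_eq n M μ k c
    rw [e, bil_smul_right, bil_sub_right, bil_sum_right, bil_single_right_of_symm hM _ hk,
      sum_eq_single_of_mem j (mem_range.2 hj)]
    · by_cases h0 : bil n M (gsRow n M μ j) (gsRow n M μ j) = 0
      · have : ∑ l ∈ range n, M k l * gsRow n M μ j l = 0 :=
          sum_eq_zero fun l hl => by rw [h j (hj.trans hk) h0 l (mem_range.1 hl), mul_zero]
        simp [this]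
      · rw [div_mul_cancel₀ _ h0, sub_self, mul_zero]
    · intro i hi hij
      rw [mem_range] at hi
      rcases lt_or_gt_of_ne hij with hlt | hlt
      · rw [bil_comm hM (gsRow n M μ j), ih j hj (hj.trans hk) hlt, mul_zero]
      · rw [ih i hi (hi.trans hk) hlt, mul_zero]

theorem exists_eq_sum_gsRow (hμ : ∀ k < n, μ k = 1) {k : ℕ} (hk : k ≤ n) (x : ℕ → ℝ)
    (hx : ∀ c < n, k ≤ c → x c = 0) :
    ∃ y : ℕ → ℝ, ∀ c < n, x c = ∑ j ∈ range k, y j * gsRow n M μ j c := by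
  induction k generalizing x with
  | zero => exact ⟨0, fun c hc => by simp [hx c hc]⟩
  | succ k ih =>
    obtain ⟨y, hy⟩ := ih (by omega) (fun c => x c - x k * gsRow n M μ k c) (fun c hc hkc => by
      rcases hkc.eq_or_lt with rfl | hlt
      · simp [gsRow_self, hμ k hc]
      · simp [gsRow_of_lt hlt, hx c hc hlt])
    refine ⟨Function.update y k (x k), fun c hc => ?_⟩
    rw [sum_range_succ, Function.update_self, ← sub_eq_iff_eq_add, hy c hc]
    exact sum_congr rfl fun j hj => by rw [Function.update_of_ne (mem_range.1 hj).ne]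

/-- If the Gram-Schmidt process only meets positive values, then the form is positive definite. -/
theorem bil_self_pos (hM : SymmOn n M) (hμ : ∀ k < n, μ k = 1)
    (h : ∀ k < n, 0 < bil n M (gsRow n M μ k) (gsRow n M μ k)) {x : ℕ → ℝ}
    (hx : ∃ c < n, x c ≠ 0) : 0 < bil n M x x := by
  obtain ⟨y, hy⟩ := exists_eq_sum_gsRow (M := M) hμ le_rfl x (fun c hc hnc => by omega)
  have e : bil n M x x = ∑ j ∈ range n, y j ^ 2 * bil n M (gsRow n M μ j) (gsRow n M μ j) := by
    rw [bil_congr (fun _ _ _ _ => rfl) hy hy, bil_sum_left]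
    refine sum_congr rfl fun j hj => ?_
    rw [bil_sum_right, sum_eq_single_of_mem j hj, sq, mul_assoc]
    intro i hi hij
    rw [mem_range] at hi hj
    have h0 : ∀ j < n, bil n M (gsRow n M μ j) (gsRow n M μ j) = 0 →
      ∀ c < n, gsRow n M μ j c = 0 := fun j hj h0 => absurd h0 (h j hj).ne'
    rcases lt_or_gt_of_ne hij with hlt | hlt
    · rw [bil_comm hM, bil_gsRow_eq_zero hM h0 hj hlt, mul_zero]
    · rw [bil_gsRow_eq_zero hM h0 hi hlt, mul_zero]
  have hnn : ∀ j ∈ range n, 0 ≤ y j ^ 2 * bil n M (gsRow n M μ j) (gsRow n M μ j) :=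
    fun j hj => mul_nonneg (sq_nonneg _) (h j (mem_range.1 hj)).le
  rw [e]
  refine (sum_nonneg hnn).lt_of_ne fun h0 => ?_
  obtain ⟨c, hc, hxc⟩ := hx
  refine hxc ?_
  rw [hy c hc]
  refine sum_eq_zero fun j hj => ?_
  have h1 := (sum_eq_zero_iff_of_nonneg hnn).1 h0.symm j hj
  have h2 : y j = 0 := by
    rcases mul_eq_zero.1 h1 with h2 | h2
    · exact pow_eq_zero_iff two_ne_zero |>.1 h2
    · exact absurd h2 (h j (mem_range.1 hj)).ne'
  rw [h2, zero_mul]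

end Bil

/-! ### Convergence of the search for a Gram matrix -/

section Gram

variable {m n : ℕ} {A : ℕ → ℕ → ℝ} {r : ℝ}

/-- The sum of the products of the first `n` entries. -/
def dot (n : ℕ) (x y : ℕ → ℝ) : ℝ := ∑ j ∈ range n, x j * y j

/-- The form `r Q - a aᵀ`. -/
def gap (r : ℝ) (Q : ℕ → ℕ → ℝ) (a : ℕ → ℝ) : ℕ → ℕ → ℝ := fun b c => r * Q b c - a b * a c

theorem bil_gap (n : ℕ) (r : ℝ) (Q : ℕ → ℕ → ℝ) (a x : ℕ → ℝ) :
    bil n (gap r Q a) x x = r * bil n Q x x - dot n a x * dot n a x := by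
  rw [dot, sum_mul_sum]
  simp only [bil, gap, mul_sum, ← sum_sub_distrib]
  exact sum_congr rfl fun b _ => sum_congr rfl fun c _ => by ring

/-- `Q` is an approximately optimal Gram matrix: its diagonal is bounded, and the forms
`r Q - a aᵀ` are positive definite for all rows `a` of `A`. -/
structure GoodGram (m n : ℕ) (A : ℕ → ℕ → ℝ) (r : ℝ) (Q : ℕ → ℕ → ℝ) : Prop where
  diag : ∀ j < n, Q j j ≤ 3
  pos : ∀ i < m, ∀ x : ℕ → ℝ, (∃ c < n, x c ≠ 0) → 0 < bil n (gap r Q (A i)) x x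

/-- `Z` certifies that the squared factorization norm is at most `r`. The bound on the
other entries holds for every Gram matrix with such a diagonal. -/
structure Certificate (m n : ℕ) (A : ℕ → ℕ → ℝ) (r : ℝ) (Z : ℕ → ℕ → ℝ) : Prop where
  diag : ∀ j < n, Z j j ≤ 1
  abs_le : ∀ j < n, ∀ k < n, |Z j k| ≤ 1
  nonneg : ∀ i < m, ∀ x : ℕ → ℝ, 0 ≤ bil n (gap r Z (A i)) x x

/-- The squared distance of `Q` from `Z + 1`. The identity matrix is added to the certificate `Z` so
that it satisfies all constraints with a margin, which turns every violated constraint into progress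
by a fixed amount. -/
def gramDist (n : ℕ) (Z Q : ℕ → ℕ → ℝ) : ℝ :=
  ∑ a ∈ range n, ∑ b ∈ range n, (Q a b - (Z a b + if a = b then 1 else 0)) ^ 2

theorem gramDist_nonneg (n : ℕ) (Z Q : ℕ → ℕ → ℝ) : 0 ≤ gramDist n Z Q :=
  sum_nonneg fun _ _ => sum_nonneg fun _ _ => sq_nonneg _

theorem gramDist_zero_le {Z : ℕ → ℕ → ℝ} (hZ : Certificate m n A r Z) {Q : ℕ → ℕ → ℝ}
    (hQ : ∀ a < n, ∀ b < n, Q a b = 0) : gramDist n Z Q ≤ 4 * n ^ 2 := by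
  have : gramDist n Z Q ≤ ∑ a ∈ range n, ∑ b ∈ range n, (4 : ℝ) := by
    refine sum_le_sum fun a ha => sum_le_sum fun b hb => ?_
    rw [mem_range] at ha hb
    rw [hQ a ha b hb]
    obtain ⟨h1, h2⟩ := abs_le.1 (hZ.abs_le a ha b hb)
    split_ifs <;> nlinarith
  refine this.trans (le_of_eq ?_)
  simp
  ring

/-- Lowering a diagonal entry that exceeds `3` decreases the distance. -/
theorem gramDist_diag {Z : ℕ → ℕ → ℝ} (hZ : Certificate m n A r Z) {Q : ℕ → ℕ → ℝ} {j : ℕ}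
    (hj : j < n) (hQ : 3 < Q j j) :
    gramDist n Z (fun a b => if a = j ∧ b = j then Q j j - 1 else Q a b) ≤
      gramDist n Z Q - 1 := by
  have hs : gramDist n Z (fun a b => if a = j ∧ b = j then Q j j - 1 else Q a b) =
      gramDist n Z Q + ((Q j j - 1 - (Z j j + 1)) ^ 2 - (Q j j - (Z j j + 1)) ^ 2) := by
    have h1 : ((Q j j - 1 - (Z j j + 1)) ^ 2 - (Q j j - (Z j j + 1)) ^ 2) =
        ∑ a ∈ range n, ∑ b ∈ range n, if a = j ∧ b = j then
          ((Q j j - 1 - (Z j j + 1)) ^ 2 - (Q j j - (Z j j + 1)) ^ 2) else 0 := by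
      rw [sum_eq_single_of_mem j (mem_range.2 hj) (fun a _ ha => sum_eq_zero fun b _ => by simp [ha]),
        sum_eq_single_of_mem j (mem_range.2 hj) (fun b _ hb => by simp [hb])]
      simp
    rw [h1, gramDist, gramDist, ← sum_add_distrib]
    refine sum_congr rfl fun a _ => ?_
    rw [← sum_add_distrib]
    refine sum_congr rfl fun b _ => ?_
    by_cases h : a = j ∧ b = j
    · obtain ⟨rfl, rfl⟩ := h; simp
    · simp [h]
  rw [hs]
  have := hZ.diag j hj
  nlinarith

/-- Adding the normalized projection to a direction in which the form is not positive decreases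
the distance. -/
theorem gramDist_rankOne {Z : ℕ → ℕ → ℝ} (hZ : Certificate m n A r Z) (hr : 0 < r)
    {Q : ℕ → ℕ → ℝ} {i : ℕ} (hi : i < m) {v : ℕ → ℝ} (hv : ∃ c < n, v c ≠ 0)
    (hQ : bil n (gap r Q (A i)) v v ≤ 0) :
    gramDist n Z (fun a b => Q a b + v a * v b / dot n v v) ≤ gramDist n Z Q - 1 := by
  have hN : 0 < dot n v v := by
    obtain ⟨c, hc, hvc⟩ := hv
    exact sum_pos' (fun _ _ => mul_self_nonneg _) ⟨c, mem_range.2 hc, mul_self_pos.2 hvc⟩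
  set N := dot n v v with hNdef
  have hsq : ∑ a ∈ range n, ∑ b ∈ range n, (v a * v b / N) ^ 2 = 1 := by
    have : ∑ a ∈ range n, ∑ b ∈ range n, (v a * v b / N) ^ 2 = N * N / N ^ 2 := by
      have hNN : N * N = ∑ a ∈ range n, ∑ b ∈ range n, v a * v a * (v b * v b) := by
        rw [hNdef, dot, sum_mul_sum]
      rw [hNN, sum_div]
      refine sum_congr rfl fun a _ => ?_
      rw [sum_div]
      exact sum_congr rfl fun b _ => by ring
    rw [this]
    field_simp
  have hcross : ∑ a ∈ range n, ∑ b ∈ range n,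
      (v a * v b / N) * (Q a b - (Z a b + if a = b then 1 else 0)) =
      (bil n Q v v - bil n Z v v - N) / N := by
    have hI : N = ∑ a ∈ range n, ∑ b ∈ range n, v a * (if a = b then 1 else 0) * v b := by
      rw [hNdef, dot]
      refine sum_congr rfl fun a ha => ?_
      rw [sum_eq_single_of_mem a ha (fun b _ hb => by simp [hb.symm])]
      simp
    rw [eq_div_iff hN.ne', sum_mul]
    conv_rhs => rw [hI]
    rw [bil, bil, ← sum_sub_distrib, ← sum_sub_distrib]
    refine sum_congr rfl fun a _ => ?_
    rw [sum_mul, ← sum_sub_distrib, ← sum_sub_distrib]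
    refine sum_congr rfl fun b _ => ?_
    field_simp
    ring
  have hexp : gramDist n Z (fun a b => Q a b + v a * v b / N) = gramDist n Z Q +
      2 * ((bil n Q v v - bil n Z v v - N) / N) + 1 := by
    rw [← hsq, ← hcross, mul_sum, gramDist, gramDist, ← sum_add_distrib, ← sum_add_distrib]
    refine sum_congr rfl fun a _ => ?_
    rw [mul_sum, ← sum_add_distrib, ← sum_add_distrib]
    exact sum_congr rfl fun b _ => by ring
  -- both sides are compared with `(a · v) ^ 2 / r`
  have hle : bil n Q v v ≤ bil n Z v v := by
    have := hZ.nonneg i hi v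
    rw [bil_gap] at this hQ
    nlinarith
  have : (bil n Q v v - bil n Z v v - N) / N ≤ -1 := by
    rw [div_le_iff₀ hN]; linarith
  rw [hexp]
  linarith

theorem GoodGram.bil_pos {Q : ℕ → ℕ → ℝ} (h : GoodGram m n A r Q) (hm : 0 < m) (hr : 0 ≤ r)
    {x : ℕ → ℝ} (hx : ∃ c < n, x c ≠ 0) : 0 < bil n Q x x := by
  have := h.pos 0 hm x hx
  rw [bil_gap] at this
  have h1 : 0 < r * bil n Q x x := by nlinarith [mul_self_nonneg (dot n (A 0) x)]
  exact pos_of_mul_pos_right h1 hr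

theorem GoodGram.mono {Q : ℕ → ℕ → ℝ} (h : GoodGram m n A r Q) (hm : 0 < m) (hr : 0 ≤ r) {r' : ℝ}
    (hrr : r ≤ r') : GoodGram m n A r' Q :=
  ⟨h.diag, fun i hi x hx => by
    have h1 := h.pos i hi x hx
    have h2 := h.bil_pos hm hr hx
    rw [bil_gap] at h1 ⊢
    nlinarith⟩

/-- A good Gram matrix is recognized by finitely many evaluations. -/
theorem goodGram_iff {Q : ℕ → ℕ → ℝ} {μ : ℕ → ℝ} (hQ : SymmOn n Q) (hμ : ∀ k < n, μ k = 1) :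
    GoodGram m n A r Q ↔ (∀ j < n, Q j j ≤ 3) ∧ ∀ i < m, ∀ k < n,
      0 < bil n (gap r Q (A i)) (gsRow n (gap r Q (A i)) μ k) (gsRow n (gap r Q (A i)) μ k) := by
  refine ⟨fun h => ⟨h.diag, fun i hi k hk => h.pos i hi _ ⟨k, hk, ?_⟩⟩, fun h => ⟨h.1, ?_⟩⟩
  · rw [gsRow_self, hμ k hk]; exact one_ne_zero
  · intro i hi x hx
    refine bil_self_pos (fun a ha b hb => ?_) hμ (h.2 i hi) hx
    rw [gap, gap, hQ a ha b hb, mul_comm (A i a)]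

end Gram

end RealRAM

namespace RealRAM

open Finset

/-! ### The program that finds a Gram matrix -/

/-- Add the normalized projection to the row held by register `13` of the array `8` to the array
`5`, unless the form `r Q - a aᵀ` is positive there; set the flag `13` if so. -/
def rankOneCode : Stmt :=
  .seq (.assign 14 4 4 (.cell 11 4 4 * quadExpr 8 13 5 14 15 -
    .sum 14 1 (.cell 4 10 14 * .cell 8 13 14) * .sum 14 1 (.cell 4 10 14 * .cell 8 13 14))) <|
  .seq (.assign 13 4 4 (.lt (.const 0) (.cell 14 4 4) (.cell 13 4 4) (.const 1))) <|
  .table 5 11 1 12 1 (.lt (.const 0) (.cell 14 4 4) (.cell 5 11 12)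
    (.cell 5 11 12 + .cell 8 13 11 * .cell 8 13 12 / .sum 14 1 (.cell 8 13 14 * .cell 8 13 14)))

/-- Test the form of the row held by register `10` for positivity, and react. -/
def formCode : Stmt :=
  .seq (.table 6 11 1 12 1 (.cell 11 4 4 * .cell 5 11 12 - .cell 4 10 11 * .cell 4 10 12)) <|
  .seq (gsCode 6) <|
  .loop 13 1 rankOneCode

/-- Test the diagonal entry at register `10`, and react. -/
def diagCode : Stmt :=
  .seq (.assign 13 4 4 (.lt (.const 3) (.cell 5 10 10) (.const 1) (.cell 13 4 4))) <|
  .assign 5 10 10 (.lt (.const 3) (.cell 5 10 10) (.cell 5 10 10 - .const 1) (.cell 5 10 10))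

/-- One pass over all constraints. -/
def passCode : Stmt :=
  .seq (.assign 13 4 4 (.const 0)) <| .seq (.loop 10 1 diagCode) (.loop 10 0 formCode)

/-- One round: raise the bound by the increment in the array `12`, start again from `0` unless the
flag `13` is clear, and make `5 n²` passes. If there is a certificate, then at most `4 n²` of the passes
change the matrix, so that the last one leaves the flag clear. -/
def roundCode : Stmt :=
  .seq (.assign 11 4 4 (.cell 11 4 4 + .cell 12 4 4)) <|
  .seq (.table 5 11 1 12 1 (.lt (.const 0) (.cell 13 4 4) (.const 0) (.cell 5 11 12))) <|
  .loop 30 1 <| .loop 31 1 <| .loop 32 3 passCode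

/-- Restrict `A` to the columns in `J`, in the array `4`; set the increment to the mean of the
squares of its entries, and make `m n` rounds. The bound of the first round is twice the increment,
and that of the last one exceeds the sum of the squares. -/
def gramCode : Stmt :=
  .seq (.table 4 11 0 12 1 (.cell 0 11 12 * .cell 1 4 12)) <|
  .seq (.row 7 4 11 1 (.const 1)) <|
  .seq (.assign 12 4 4 (.sum 11 0 (.sum 12 1 (.cell 4 11 12 * .cell 4 11 12)) /
    .sum 11 0 (.sum 12 1 (.const 1)))) <|
  .seq (.assign 11 4 4 (.cell 12 4 4)) <|
  .seq (.assign 13 4 4 (.const 1)) <|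
  .loop 33 0 <| .loop 34 1 roundCode

/-- The distance to every certificate decreases by at least `1`. -/
def Drops (m n : ℕ) (A : ℕ → ℕ → ℝ) (r : ℝ) (Q Q' : ℕ → ℕ → ℝ) : Prop :=
  ∀ Z, Certificate m n A r Z → gramDist n Z Q' ≤ gramDist n Z Q - 1

/-- A piece of a pass whose tests amount to the condition `P` on the initial matrix: if it
holds nothing changes, otherwise the flag is set and the matrix approaches the certificates. -/
structure Advance (m n : ℕ) (P : Prop) (σ τ : Store) : Prop where
  frame : ∀ a, a ∉ [5, 6, 8, 9, 13, 14] → τ a = σ a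
  symm : SymmOn n (τ 5)
  alt : (P ∧ τ 5 = σ 5 ∧ τ 13 = σ 13) ∨
    (¬ P ∧ τ 13 0 0 = 1 ∧ Drops m n (σ 4) (σ 11 0 0) (σ 5) (τ 5))

section

variable {m n : ℕ} {ρ : ℕ → ℕ} {σ τ υ : Store}

theorem Advance.refl {P : Prop} (hσ : SymmOn n (σ 5)) (hP : P) : Advance m n P σ σ :=
  ⟨fun _ _ => rfl, hσ, .inl ⟨hP, rfl, rfl⟩⟩

theorem Advance.trans {P R : Prop} {S : Prop} (h : Advance m n P σ τ) (h' : Advance m n R τ υ)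
    (hS : S → P) (hR : P → τ 5 = σ 5 → (S ↔ R)) : Advance m n S σ υ := by
  refine ⟨fun a ha => (h'.frame a ha).trans (h.frame a ha), h'.symm, ?_⟩
  have h4 := h.frame 4 (by decide)
  have h11 := h.frame 11 (by decide)
  rcases h.alt with ⟨hP, h5, h13⟩ | ⟨hP, h13, hdrop⟩
  · rcases h'.alt with ⟨hr, h5', h13'⟩ | ⟨hr, h13', hdrop'⟩
    · exact .inl ⟨(hR hP h5).2 hr, h5'.trans h5, h13'.trans h13⟩
    · rw [h4, h11, h5] at hdrop'
      exact .inr ⟨fun hs => hr ((hR hP h5).1 hs), h13', hdrop'⟩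
  · refine .inr ⟨fun hs => hP (hS hs), ?_⟩
    rcases h'.alt with ⟨-, h5', h13'⟩ | ⟨-, h13', hdrop'⟩
    · rw [h5', h13']
      exact ⟨h13, hdrop⟩
    · rw [h4, h11] at hdrop'
      exact ⟨h13', fun Z hZ => by linarith [hdrop Z hZ, hdrop' Z hZ]⟩

theorem Advance.loop {r b : ℕ} {c : Stmt} (P : ℕ → (ℕ → ℕ → ℝ) → Prop) (I : Store → Prop)
    (hσ : SymmOn n (σ 5)) (hI : I σ)
    (hstep : ∀ k < ρ b, ∀ τ, I τ → SymmOn n (τ 5) → (∀ a, a ∉ [5, 6, 8, 9, 13, 14] → τ a = σ a) →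
      I (c.den (Function.update ρ r k) τ) ∧
      Advance m n (P k (τ 5)) τ (c.den (Function.update ρ r k) τ)) :
    Advance m n (∀ k < ρ b, P k (σ 5)) σ ((Stmt.loop r b c).den ρ σ) := by
  refine (Stmt.den_loop_induction (fun k τ => I τ ∧ Advance m n (∀ j < k, P j (σ 5)) σ τ)
    ⟨hI, Advance.refl hσ (by simp)⟩ ?_).2
  rintro k τ hk ⟨hIτ, h⟩
  obtain ⟨h1, h2⟩ := hstep k hk τ hIτ h.symm h.frame
  refine ⟨h1, h.trans h2 (fun hS j hj => hS j (by omega)) fun hP h5 => ?_⟩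
  rw [h5]
  refine ⟨fun hS => hS k (by omega), fun hk' j hj => ?_⟩
  rcases Nat.lt_succ_iff_lt_or_eq.1 hj with hj | rfl
  · exact hP j hj
  · exact hk'

theorem advance_diagCode {j : ℕ} (h4 : ρ 4 = 0) (h10 : ρ 10 = j) (hj : j < n)
    (hσ : SymmOn n (σ 5)) : Advance m n (σ 5 j j ≤ 3) σ (diagCode.den ρ σ) := by
  have e : diagCode.den ρ σ = Function.update (Function.update σ 13 fun a b =>
      if a = 0 ∧ b = 0 then (if 3 < σ 5 j j then 1 else σ 13 0 0) else σ 13 a b) 5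
      (fun a b => if a = j ∧ b = j then (if 3 < σ 5 j j then σ 5 j j - 1 else σ 5 j j)
        else σ 5 a b) := by
    rw [diagCode, Stmt.den_seq, Stmt.den_assign, Stmt.den_assign]
    simp [Expr.eval_lt, Expr.eval_sub, Expr.eval_const, Expr.eval_cell, h4, h10]
  rw [e]
  by_cases h3 : 3 < σ 5 j j
  · simp only [h3, if_true]
    refine ⟨fun a ha => ?_, ?_, .inr ⟨not_le.2 h3, by simp, fun Z hZ => ?_⟩⟩
    · simp only [List.mem_cons, not_or] at ha
      rw [Function.update_of_ne ha.1, Function.update_of_ne ha.2.2.2.2.1]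
    · intro a ha b hb
      rw [Function.update_self]
      by_cases hab : a = j ∧ b = j
      · simp [hab]
      · rw [if_neg hab, if_neg (fun h => hab h.symm), hσ a ha b hb]
    · rw [Function.update_self]
      exact gramDist_diag hZ hj h3
  · simp only [h3, if_false]
    have e5 : (fun a b => if a = j ∧ b = j then σ 5 j j else σ 5 a b) = σ 5 := by
      funext a b; split_ifs with h
      · rw [h.1, h.2]
      · rfl
    have e13 : (fun a b => if a = 0 ∧ b = 0 then σ 13 0 0 else σ 13 a b) = σ 13 := by
      funext a b; split_ifs with h
      · rw [h.1, h.2]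
      · rfl
    have e' : Function.update (Function.update σ 13 (σ 13)) 5 (σ 5) = σ := by simp
    rw [e5, e13, e']
    exact Advance.refl hσ (not_lt.1 h3)

theorem eval_quadExpr {V k M r s : ℕ} (h1 : ρ 1 = n) (hr : r ≠ 1) (hkr : k ≠ r) (hks : k ≠ s)
    (hrs : r ≠ s) : (quadExpr V k M r s).eval ρ σ = bil n (σ M) (σ V (ρ k)) (σ V (ρ k)) := by
  simp [quadExpr, Expr.eval_sum, Expr.eval_mul, Expr.eval_cell, bil, h1,
    hr.symm, hkr, hks, hrs]

theorem advance_rankOneCode {i k : ℕ} (h1 : ρ 1 = n) (h4 : ρ 4 = 0) (h10 : ρ 10 = i)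
    (h13 : ρ 13 = k) (hi : i < m) (hr : 0 < σ 11 0 0) (hv : ∃ c < n, σ 8 k c ≠ 0)
    (hσ : SymmOn n (σ 5)) :
    Advance m n (0 < bil n (gap (σ 11 0 0) (σ 5) (σ 4 i)) (σ 8 k) (σ 8 k)) σ
      (rankOneCode.den ρ σ) := by
  set d := bil n (gap (σ 11 0 0) (σ 5) (σ 4 i)) (σ 8 k) (σ 8 k) with hd
  have e1 : (Expr.cell 11 4 4 * quadExpr 8 13 5 14 15 -
      .sum 14 1 (.cell 4 10 14 * .cell 8 13 14) *
        .sum 14 1 (.cell 4 10 14 * .cell 8 13 14)).eval ρ σ = d := by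
    rw [Expr.eval_sub, Expr.eval_mul, Expr.eval_mul, eval_quadExpr h1 (by norm_num) (by norm_num)
      (by norm_num) (by norm_num), hd, bil_gap]
    simp [Expr.eval_sum, Expr.eval_cell, Expr.eval_mul, h1, h4, h10, h13, dot]
  have e : rankOneCode.den ρ σ = Function.update (Function.update (Function.update σ 14 fun a b =>
      if a = 0 ∧ b = 0 then d else σ 14 a b) 13 fun a b =>
      if a = 0 ∧ b = 0 then (if 0 < d then σ 13 0 0 else 1) else σ 13 a b) 5
      (fun a b => if a < n ∧ b < n then (if 0 < d then σ 5 a b else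
        σ 5 a b + σ 8 k a * σ 8 k b / dot n (σ 8 k) (σ 8 k)) else σ 5 a b) := by
    rw [rankOneCode, Stmt.den_seq, Stmt.den_assign, Stmt.den_seq, Stmt.den_assign, e1, h4,
      Stmt.den_table (fun a b => if 0 < d then σ 5 a b else
        σ 5 a b + σ 8 k a * σ 8 k b / dot n (σ 8 k) (σ 8 k)) (by norm_num) (by norm_num)]
    · simp [Expr.eval_lt, Expr.eval_const, Expr.eval_cell, h1, h4]
    · intro a _ b _ τ hτ hτ'
      simp [Expr.eval_lt, Expr.eval_const, Expr.eval_cell, Expr.eval_add, Expr.eval_mul,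
        Expr.eval_div, Expr.eval_sum, h1, h4, h13, hτ, hτ', dot]
  rw [e]
  by_cases h0 : 0 < d
  · simp only [h0, if_true]
    have e5 : (fun a b => if a < n ∧ b < n then σ 5 a b else σ 5 a b) = σ 5 := by
      funext a b; simp
    have e13 : (fun a b => if a = 0 ∧ b = 0 then σ 13 0 0 else σ 13 a b) = σ 13 := by
      funext a b; split_ifs with h
      · rw [h.1, h.2]
      · rfl
    rw [e5, e13]
    refine ⟨fun a ha => ?_, by simpa using hσ, .inl ⟨trivial, by simp, by simp⟩⟩
    simp only [List.mem_cons, not_or] at ha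
    rw [Function.update_of_ne ha.1, Function.update_of_ne ha.2.2.2.2.1,
      Function.update_of_ne ha.2.2.2.2.2.1]
  · simp only [h0, if_false]
    refine ⟨fun a ha => ?_, ?_, .inr ⟨not_false, by simp, fun Z hZ => ?_⟩⟩
    · simp only [List.mem_cons, not_or] at ha
      rw [Function.update_of_ne ha.1, Function.update_of_ne ha.2.2.2.2.1,
        Function.update_of_ne ha.2.2.2.2.2.1]
    · intro a ha b hb
      simp only [Function.update_self, ha, hb, and_self, if_true]
      rw [hσ a ha b hb, mul_comm (σ 8 k a)]
    · rw [Function.update_self]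
      refine le_trans (le_of_eq ?_) (gramDist_rankOne hZ hr hi hv (not_lt.1 h0))
      refine sum_congr rfl fun a ha => sum_congr rfl fun b hb => ?_
      rw [mem_range] at ha hb
      simp [ha, hb]

theorem advance_formCode {i : ℕ} (h1 : ρ 1 = n) (h4 : ρ 4 = 0) (h10 : ρ 10 = i) (hi : i < m)
    (hr : 0 < σ 11 0 0) (hμ : ∀ k < n, σ 7 0 k = 1) (hσ : SymmOn n (σ 5)) :
    Advance m n (∀ k < n, 0 < bil n (gap (σ 11 0 0) (σ 5) (σ 4 i))
      (gsRow n (gap (σ 11 0 0) (σ 5) (σ 4 i)) (σ 7 0) k)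
      (gsRow n (gap (σ 11 0 0) (σ 5) (σ 4 i)) (σ 7 0) k)) σ (formCode.den ρ σ) := by
  rw [formCode, Stmt.den_seq, Stmt.den_seq, Stmt.den_table (gap (σ 11 0 0) (σ 5) (σ 4 i))
    (by norm_num) (by norm_num)]
  swap
  · intro a _ b _ τ hτ _
    simp [Expr.eval_cell, Expr.eval_sub, Expr.eval_mul, h4, h10, hτ, gap]
  set σ₁ : Store := Function.update σ 6 fun a b => if a < ρ 1 ∧ b < ρ 1 then
    gap (σ 11 0 0) (σ 5) (σ 4 i) a b else σ 6 a b with hσ₁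
  set σ₂ := (gsCode 6).den ρ σ₁ with hσ₂
  have hV : ∀ k < n, ∀ c < n, σ₂ 8 k c = gsRow n (gap (σ 11 0 0) (σ 5) (σ 4 i)) (σ 7 0) k c :=
    gsCode_spec h1 h4 (by norm_num) (by norm_num)
      (fun a ha b hb => by simp [hσ₁, h1, ha, hb]) (fun k hk => by simp [hσ₁])
  have hframe : ∀ a, a ∉ [6, 8, 9] → σ₂ a = σ a := by
    intro a ha
    simp only [List.mem_cons, not_or] at ha
    rw [hσ₂, Stmt.den_eq_of_notMem_writes, hσ₁, Function.update_of_ne ha.1]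
    simp [gsCode, Stmt.row, Stmt.writes, ha.2.1, ha.2.2.1]
  have hadv : Advance m n (∀ k < ρ 1, 0 < bil n (gap (σ₂ 11 0 0) (σ₂ 5) (σ₂ 4 i))
      (σ₂ 8 k) (σ₂ 8 k)) σ₂ ((Stmt.loop 13 1 rankOneCode).den ρ σ₂) := by
    refine Advance.loop (I := fun τ => τ 8 = σ₂ 8)
      (fun k Q => 0 < bil n (gap (σ₂ 11 0 0) Q (σ₂ 4 i)) (σ₂ 8 k) (σ₂ 8 k))
      (by rw [hframe 5 (by decide)]; exact hσ) rfl ?_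
    intro k hk τ hτ8 hτs hτf
    rw [h1] at hk
    have h4' := hτf 4 (by decide)
    have h11' := hτf 11 (by decide)
    rw [← hτ8, ← h4', ← h11']
    refine ⟨Stmt.den_eq_of_notMem_writes (by decide) _ _, advance_rankOneCode (by simpa) (by simpa)
      (by simpa) (by simp) hi (by rwa [h11', hframe 11 (by decide)]) ⟨k, hk, ?_⟩ hτs⟩
    rw [hτ8, hV k hk k hk, gsRow_self, hμ k hk]
    exact one_ne_zero
  have e : (∀ k < ρ 1, 0 < bil n (gap (σ₂ 11 0 0) (σ₂ 5) (σ₂ 4 i)) (σ₂ 8 k) (σ₂ 8 k)) ↔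
      ∀ k < n, 0 < bil n (gap (σ 11 0 0) (σ 5) (σ 4 i))
      (gsRow n (gap (σ 11 0 0) (σ 5) (σ 4 i)) (σ 7 0) k)
      (gsRow n (gap (σ 11 0 0) (σ 5) (σ 4 i)) (σ 7 0) k) := by
    rw [h1, hframe 4 (by decide), hframe 5 (by decide), hframe 11 (by decide)]
    refine forall₂_congr fun k hk => ?_
    rw [bil_congr (fun _ _ _ _ => rfl) (hV k hk) (hV k hk)]
  rw [e] at hadv
  refine ⟨fun a ha => ?_, hadv.symm, ?_⟩
  · rw [hadv.frame a ha, hframe a (by simp only [List.mem_cons, not_or] at ha ⊢; tauto)]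
  · have := hadv.alt
    rwa [hframe 4 (by decide), hframe 5 (by decide), hframe 11 (by decide), hframe 13 (by decide)]
      at this

/-- A pass leaves good matrices alone, and improves others. -/
theorem advance_passCode (h0 : ρ 0 = m) (h1 : ρ 1 = n) (h4 : ρ 4 = 0)
    (hr : 0 < σ 11 0 0) (hμ : ∀ k < n, σ 7 0 k = 1) (hσ : SymmOn n (σ 5)) :
    let τ := passCode.den ρ σ
    (∀ a, a ∉ [5, 6, 8, 9, 13, 14] → τ a = σ a) ∧ SymmOn n (τ 5) ∧
      ((GoodGram m n (σ 4) (σ 11 0 0) (σ 5) ∧ τ 5 = σ 5 ∧ τ 13 0 0 = 0) ∨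
      (¬ GoodGram m n (σ 4) (σ 11 0 0) (σ 5) ∧ τ 13 0 0 = 1 ∧
        Drops m n (σ 4) (σ 11 0 0) (σ 5) (τ 5))) := by
  intro τ
  set σ₁ := (Stmt.assign 13 4 4 (.const 0)).den ρ σ with hσ₁
  have hframe : ∀ a, a ≠ 13 → σ₁ a = σ a := fun a ha =>
    Stmt.den_eq_of_notMem_writes (by simpa [Stmt.writes] using ha) _ _
  have h13 : σ₁ 13 0 0 = 0 := by
    rw [hσ₁, Stmt.den_assign]
    simp [h4, Expr.eval_const]
  have hs₁ : SymmOn n (σ₁ 5) := by rwa [hframe 5 (by norm_num)]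
  have hdiag : Advance m n (∀ j < ρ 1, σ₁ 5 j j ≤ 3) σ₁ ((Stmt.loop 10 1 diagCode).den ρ σ₁) :=
    Advance.loop (I := fun _ => True) (fun j Q => Q j j ≤ 3) hs₁ trivial fun j hj τ _ hτs _ =>
      ⟨trivial, advance_diagCode (by simpa) (by simp) (h1 ▸ hj) hτs⟩
  set σ₂ := (Stmt.loop 10 1 diagCode).den ρ σ₁ with hσ₂
  have hform : Advance m n (∀ i < ρ 0, ∀ k < n, 0 < bil n (gap (σ₁ 11 0 0) (σ₂ 5) (σ₁ 4 i))
      (gsRow n (gap (σ₁ 11 0 0) (σ₂ 5) (σ₁ 4 i)) (σ₁ 7 0) k)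
      (gsRow n (gap (σ₁ 11 0 0) (σ₂ 5) (σ₁ 4 i)) (σ₁ 7 0) k)) σ₂
        ((Stmt.loop 10 0 formCode).den ρ σ₂) := by
    refine Advance.loop (I := fun _ => True) (fun i Q =>
      ∀ k < n, 0 < bil n (gap (σ₁ 11 0 0) Q (σ₁ 4 i)) (gsRow n (gap (σ₁ 11 0 0) Q (σ₁ 4 i))
        (σ₁ 7 0) k) (gsRow n (gap (σ₁ 11 0 0) Q (σ₁ 4 i)) (σ₁ 7 0) k)) hdiag.symm trivial
      fun i hi τ _ hτs hτf => ⟨trivial, ?_⟩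
    have e4 : τ 4 = σ₁ 4 := (hτf 4 (by decide)).trans (hdiag.frame 4 (by decide))
    have e7 : τ 7 = σ₁ 7 := (hτf 7 (by decide)).trans (hdiag.frame 7 (by decide))
    have e11 : τ 11 = σ₁ 11 := (hτf 11 (by decide)).trans (hdiag.frame 11 (by decide))
    rw [← e4, ← e7, ← e11]
    refine advance_formCode (by simpa) (by simpa) (by simp) (h0 ▸ hi) ?_ ?_ hτs
    · rwa [e11, hframe 11 (by norm_num)]
    · rwa [e7, hframe 7 (by norm_num)]
  have hall : Advance m n (GoodGram m n (σ₁ 4) (σ₁ 11 0 0) (σ₁ 5)) σ₁ τ := by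
    have hμ₁ : ∀ k < n, σ₁ 7 0 k = 1 := by rwa [hframe 7 (by norm_num)]
    refine hdiag.trans hform (fun h => ?_) (fun hP h5 => ?_)
    · rw [h1]; exact h.diag
    · rw [h5, goodGram_iff hs₁ hμ₁, h0]
      rw [h1] at hP
      exact and_iff_right hP
  refine ⟨fun a ha => ?_, hall.symm, ?_⟩
  · rw [hall.frame a ha, hframe a (by simp only [List.mem_cons, not_or] at ha; tauto)]
  · have := hall.alt
    rw [hframe 4 (by norm_num), hframe 5 (by norm_num), hframe 11 (by norm_num)] at this
    rcases this with ⟨h, h5, h13'⟩ | h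
    · exact .inl ⟨h, h5, by rw [h13', h13]⟩
    · exact .inr h

end

end RealRAM

namespace RealRAM

open Finset

/-- Reasoning about a loop that only counts. -/
theorem Stmt.den_loop_count {ρ : ℕ → ℕ} {σ : Store} {r b : ℕ} {c : Stmt}
    (I : ℕ → Store → Prop) (k w : ℕ) (h0 : I k σ)
    (hstep : ∀ i l τ, I l τ → I (l + w) (c.den (Function.update ρ r i) τ)) :
    I (k + ρ b * w) ((Stmt.loop r b c).den ρ σ) :=
  Stmt.den_loop_induction (fun i τ => I (k + i * w) τ) (by simpa using h0) fun i τ _ hτ => by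
    have := hstep i _ τ hτ
    rwa [add_assoc, ← Nat.succ_mul] at this

section

variable {m n : ℕ} {ρ : ℕ → ℕ} {σ τ υ : Store}

/-- A round keeps a good matrix, as raising the bound relaxes the constraints; otherwise it starts
the search from `0`, and succeeds if there is a certificate. -/
theorem roundCode_spec (h0 : ρ 0 = m) (h1 : ρ 1 = n) (h3 : ρ 3 = 5) (h4 : ρ 4 = 0)
    (hm : 0 < m) (hn : 0 < n) (hr : 0 < σ 11 0 0) (hinc : 0 ≤ σ 12 0 0)
    (hμ : ∀ k < n, σ 7 0 k = 1) (hσ : SymmOn n (σ 5)) (hflag : σ 13 0 0 = 0 ∨ σ 13 0 0 = 1)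
    (hgood : σ 13 0 0 = 0 → GoodGram m n (σ 4) (σ 11 0 0) (σ 5)) :
    let τ := roundCode.den ρ σ
    τ 11 0 0 = σ 11 0 0 + σ 12 0 0 ∧ SymmOn n (τ 5) ∧ (τ 13 0 0 = 0 ∨ τ 13 0 0 = 1) ∧
      (τ 13 0 0 = 0 → GoodGram m n (σ 4) (σ 11 0 0 + σ 12 0 0) (τ 5)) ∧
      (σ 13 0 0 = 0 → τ 5 = σ 5 ∧ τ 13 0 0 = 0) ∧
      (∀ Z, Certificate m n (σ 4) (σ 11 0 0 + σ 12 0 0) Z → τ 13 0 0 = 0) := by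
  intro τ
  set r := σ 11 0 0 + σ 12 0 0 with hrdef
  set Q₀ : ℕ → ℕ → ℝ := fun a b => if a < n ∧ b < n then
    (if 0 < σ 13 0 0 then 0 else σ 5 a b) else σ 5 a b with hQ₀
  set σ₁ : Store := Function.update (Function.update σ 11 fun a b =>
    if a = 0 ∧ b = 0 then r else σ 11 a b) 5 Q₀ with hσ₁
  have hτ : τ = (Stmt.loop 30 1 <| .loop 31 1 <| .loop 32 3 passCode).den ρ σ₁ := by
    change roundCode.den ρ σ = _
    rw [roundCode, Stmt.den_seq, Stmt.den_assign, Stmt.den_seq, Stmt.den_table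
      (fun a b => if 0 < σ 13 0 0 then 0 else σ 5 a b) (by norm_num) (by norm_num)]
    · simp [Expr.eval_add, Expr.eval_cell, h1, h4, hσ₁, hQ₀, hrdef]
    · intro a _ b _ τ hτ hτ'
      simp [Expr.eval_lt, Expr.eval_const, Expr.eval_cell, h4, hτ, hτ']
  have hσ₁s : SymmOn n (σ₁ 5) := by
    intro a ha b hb
    simp only [hσ₁, hQ₀, Function.update_self, ha, hb, and_self, if_true]
    rw [hσ a ha b hb]
  have hσ₁a : ∀ a, a ≠ 5 → a ≠ 11 → σ₁ a = σ a := fun a h5 h11 => by simp [hσ₁, h5, h11]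
  have hσ₁r : σ₁ 11 0 0 = r := by simp [hσ₁]
  have hr' : 0 < r := by linarith
  -- after `c` passes either the matrix is good, or all of them made progress
  let I : ℕ → Store → Prop := fun c τ =>
    (∀ a, a ∉ [5, 6, 8, 9, 13, 14] → τ a = σ₁ a) ∧ SymmOn n (τ 5) ∧
      (σ 13 0 0 = 0 → τ 5 = σ₁ 5 ∧ τ 13 0 0 = 0) ∧
      ((τ 13 0 0 = 0 ∧ GoodGram m n (σ 4) r (τ 5)) ∨
        (τ 13 0 0 = 1 ∧ ∀ Z, Certificate m n (σ 4) r Z → gramDist n Z (τ 5) + c ≤ 4 * n ^ 2))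
  have key := Stmt.den_loop_count (ρ := ρ) (σ := σ₁) (r := 30) (b := 1)
    (c := .loop 31 1 <| .loop 32 3 passCode) I 0 (n * 5)
    ⟨fun _ _ => rfl, hσ₁s, fun h => ⟨rfl, by simpa [hσ₁] using h⟩, ?_⟩ ?_
  · rw [← hτ, h1, zero_add] at key
    obtain ⟨hf, hs, hkeep, halt⟩ := key
    refine ⟨by rw [hf 11 (by decide), hσ₁r], hs, ?_, ?_, ?_, ?_⟩
    · rcases halt with h | h
      · exact .inl h.1
      · exact .inr h.1
    · intro h
      rcases halt with h' | h'
      · exact h'.2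
      · exact absurd (h.symm.trans h'.1) zero_ne_one
    · intro h
      obtain ⟨h5, h13⟩ := hkeep h
      refine ⟨h5.trans ?_, h13⟩
      simp [hσ₁, hQ₀, h]
    · intro Z hZ
      rcases halt with h' | h'
      · exact h'.1
      · have h2 := h'.2 Z hZ
        have h3 := gramDist_nonneg n Z (τ 5)
        have h4 : (0 : ℝ) < (n : ℝ) ^ 2 := by positivity
        push_cast at h2
        nlinarith
  · rcases hflag with h | h
    · refine .inl ⟨by simpa [hσ₁] using h, ?_⟩
      have : σ₁ 5 = σ 5 := by simp [hσ₁, hQ₀, h]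
      rw [this]
      exact (hgood h).mono hm hr.le (by linarith)
    · refine .inr ⟨by simpa [hσ₁] using h, fun Z hZ => ?_⟩
      rw [Nat.cast_zero, add_zero]
      refine gramDist_zero_le hZ fun a ha b hb => ?_
      simp [hσ₁, hQ₀, ha, hb, h]
  · intro i l τ hτ
    have e1 : n * 5 = (Function.update ρ 30 i) 1 * 5 := by simp [h1]
    rw [e1]
    refine Stmt.den_loop_count I l 5 hτ fun j l τ hτ => ?_
    have e2 : (Function.update (Function.update ρ 30 i) 31 j) 3 * 1 = 5 := by simp [h3]
    have hloop := Stmt.den_loop_count (ρ := Function.update (Function.update ρ 30 i) 31 j)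
      (r := 32) (b := 3) (c := passCode) I l 1 hτ ?_
    · rwa [e2] at hloop
    rintro k l τ ⟨hf, hs, hkeep, halt⟩
    have hp := advance_passCode (m := m) (n := n)
      (ρ := Function.update (Function.update (Function.update ρ 30 i) 31 j) 32 k) (σ := τ)
      (by simpa) (by simpa) (by simpa) (by rwa [hf 11 (by decide), hσ₁r])
      (by rwa [hf 7 (by decide), hσ₁a 7 (by norm_num) (by norm_num)]) hs
    rw [hf 4 (by decide), hσ₁a 4 (by norm_num) (by norm_num), hf 11 (by decide), hσ₁r] at hp
    obtain ⟨hf', hs', halt'⟩ := hp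
    refine ⟨fun a ha => (hf' a ha).trans (hf a ha), hs', fun h => ?_, ?_⟩
    · obtain ⟨h5, h13⟩ := hkeep h
      have hg : GoodGram m n (σ 4) r (τ 5) := by
        rcases halt with h' | h'
        · exact h'.2
        · exact absurd (h13.symm.trans h'.1) zero_ne_one
      rcases halt' with h' | h'
      · exact ⟨h'.2.1.trans h5, h'.2.2⟩
      · exact absurd hg h'.1
    · rcases halt' with h' | h'
      · exact .inl ⟨h'.2.2, h'.2.1 ▸ h'.1⟩
      · refine .inr ⟨h'.2.1, fun Z hZ => ?_⟩
        rcases halt with h | h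
        · exact absurd h.2 h'.1
        · have h2 := h.2 Z hZ
          have h3 := h'.2.2 Z hZ
          push_cast
          linarith

/-- The search finds a good Gram matrix for the first multiple of the increment that has a
certificate. -/
theorem gramCode_spec {A : ℕ → ℕ → ℝ} {s : ℝ} (h0 : ρ 0 = m) (h1 : ρ 1 = n) (h3 : ρ 3 = 5)
    (h4 : ρ 4 = 0) (hm : 0 < m) (hn : 0 < n)
    (hA : ∀ i j, i < m ∧ j < n → σ 0 i j * σ 1 0 j = A i j)
    (hA' : ∀ i j, ¬ (i < m ∧ j < n) → σ 4 i j = A i j) (hQ : SymmOn n (σ 5))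
    (hs : (∑ i ∈ range m, ∑ j ∈ range n, A i j * A i j) / (m * n) = s) (hspos : 0 < s)
    {K : ℕ} (hK : 2 ≤ K) (hK' : K ≤ m * n + 1) {Z : ℕ → ℕ → ℝ}
    (hZ : Certificate m n A (K * s) Z) :
    SymmOn n (gramCode.den ρ σ 5) ∧ GoodGram m n A (K * s) (gramCode.den ρ σ 5) := by
  set σ₁ : Store := Function.update (Function.update (Function.update (Function.update
    (Function.update σ 4 A) 7 fun i j => if i = 0 ∧ j < n then 1 else σ 7 i j) 12 fun i j =>
    if i = 0 ∧ j = 0 then s else σ 12 i j) 11 fun i j => if i = 0 ∧ j = 0 then s else σ 11 i j) 13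
    fun i j => if i = 0 ∧ j = 0 then 1 else σ 13 i j with hσ₁
  have e : gramCode.den ρ σ = (Stmt.loop 33 0 <| .loop 34 1 roundCode).den ρ σ₁ := by
    have eA : (fun i j => if i < ρ 0 ∧ j < ρ 1 then A i j else σ 4 i j) = A := by
      funext i j
      rw [h0, h1]
      split_ifs with h
      · rfl
      · exact hA' i j h
    rw [gramCode, Stmt.den_seq, Stmt.den_table A (by norm_num) (by norm_num), eA, Stmt.den_seq,
      Stmt.den_row (fun _ => 1) (by norm_num), Stmt.den_seq, Stmt.den_assign, Stmt.den_seq,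
      Stmt.den_assign, Stmt.den_seq, Stmt.den_assign]
    · simp only [Expr.eval_div, Expr.eval_sum, Expr.eval_mul, Expr.eval_const, Expr.eval_cell]
      simp [h0, h1, h4, hs, hσ₁]
    · intro j _ τ _ _ _
      simp [Expr.eval_const]
    · intro i hi j hj τ hτ _
      rw [h0] at hi
      rw [h1] at hj
      simp [Expr.eval_mul, Expr.eval_cell, hτ, h4, hA i j ⟨hi, hj⟩]
  -- the matrix found in the round that reaches `K`, or before, is kept until the end
  let I : ℕ → Store → Prop := fun c τ =>
    (τ 4 = A ∧ (∀ k < n, τ 7 0 k = 1) ∧ τ 12 0 0 = s ∧ τ 11 0 0 = (c + 1 : ℕ) * s) ∧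
      SymmOn n (τ 5) ∧ (τ 13 0 0 = 0 ∨ τ 13 0 0 = 1) ∧
      (τ 13 0 0 = 0 → GoodGram m n A ((c + 1 : ℕ) * s) (τ 5)) ∧
      (K ≤ c + 1 → τ 13 0 0 = 0 ∧ GoodGram m n A (K * s) (τ 5))
  have key := Stmt.den_loop_count (ρ := ρ) (σ := σ₁) (r := 33) (b := 0)
    (c := .loop 34 1 roundCode) I 0 n
    ⟨⟨by simp [hσ₁], by simp +contextual [hσ₁], by simp [hσ₁], by simp [hσ₁]⟩,
      by simpa [hσ₁] using hQ, .inr (by simp [hσ₁]), by simp [hσ₁], fun h => by omega⟩ ?_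
  · rw [← e, h0, zero_add] at key
    exact ⟨key.2.1, (key.2.2.2.2 hK').2⟩
  · intro i l τ hτ
    have e1 : n = (Function.update ρ 33 i) 1 * 1 := by simp [h1]
    have hstep := Stmt.den_loop_count (ρ := Function.update ρ 33 i) (r := 34) (b := 1)
      (c := roundCode) I l 1 hτ ?_
    · rwa [← e1] at hstep
    rintro j c τ ⟨⟨hτ4, hτ7, hτ12, hτ11⟩, hsymm, hflag, hgood, hKc⟩
    have hr : (0 : ℝ) < (c + 1 : ℕ) * s := by positivity
    have hround := roundCode_spec (m := m) (n := n)
      (ρ := Function.update (Function.update ρ 33 i) 34 j) (σ := τ) (by simpa) (by simpa) (by simpa)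
      (by simpa) hm hn (by rwa [hτ11]) (by rw [hτ12]; exact hspos.le) hτ7 hsymm hflag
      (by rwa [hτ4, hτ11])
    have hframe : ∀ a ∈ [4, 7, 12],
        roundCode.den (Function.update (Function.update ρ 33 i) 34 j) τ a = τ a := fun a ha =>
      Stmt.den_eq_of_notMem_writes (by fin_cases ha <;> decide) _ _
    have e2 : ((c + 1 : ℕ) : ℝ) * s + s = (c + 1 + 1 : ℕ) * s := by push_cast; ring
    rw [hτ4, hτ11, hτ12, e2] at hround
    obtain ⟨h11, hs', hflag', hgood', hkeep, hcert⟩ := hround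
    refine ⟨⟨by rw [hframe 4 (by decide), hτ4], by rwa [hframe 7 (by decide)],
      by rw [hframe 12 (by decide), hτ12], h11⟩, hs', hflag', hgood', fun hKc' => ?_⟩
    rcases Nat.lt_or_ge (c + 1) K with hlt | hge
    · obtain rfl : K = c + 1 + 1 := by omega
      have := hcert Z hZ
      exact ⟨this, hgood' this⟩
    · obtain ⟨h13, hg⟩ := hKc hge
      obtain ⟨h5, h13'⟩ := hkeep h13
      exact ⟨h13', h5 ▸ hg⟩

end

end RealRAM

namespace GramSchmidtWalk

open Finset RealRAM

/-! ### The Gram-Schmidt walk in coordinates -/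

/-- The indicator of the coordinates that are not frozen. -/
noncomputable def aliveWeight (x : ℕ → ℝ) (j : ℕ) : ℝ := if x j * x j < 1 then 1 else 0

/-- The direction of the walk: the Gram-Schmidt row of the last alive coordinate. This coordinate is
selected from all of them by arithmetic, as in the program, which has no registers for it. -/
noncomputable def direction (n : ℕ) (Q : ℕ → ℕ → ℝ) (x : ℕ → ℝ) (c : ℕ) : ℝ :=
  ∑ j ∈ range n, if 0 < ∑ i ∈ range n, (if j < i then aliveWeight x i else 0) then 0
    else gsRow n Q (aliveWeight x) j c

/-- The largest step from `x` in the direction `u` that leaves the coordinates below `k` between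
`-1` and `1`, capped at `2`. The cap is never the minimum for a direction of the walk, which moves an
alive coordinate at unit speed. -/
noncomputable def maxStep (x u : ℕ → ℝ) : ℕ → ℝ
  | 0 => 2
  | k + 1 =>
    if 0 < u k then if (1 - x k) / u k < maxStep x u k then (1 - x k) / u k else maxStep x u k
    else if u k < 0 then
      if (-1 - x k) / u k < maxStep x u k then (-1 - x k) / u k else maxStep x u k
    else maxStep x u k

/-- The choice between the steps `d` and `-e` by means of a uniform random number `U`. The rarer
step, the longer one, is taken for small `U`. -/
noncomputable def chooseStep (d e U : ℝ) : ℝ :=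
  if d < e then if d < U * (d + e) then d else 0 - e
  else if e < U * (d + e) then 0 - e else d

/-- One step of the walk. -/
noncomputable def walkStep (n : ℕ) (Q : ℕ → ℕ → ℝ) (x : ℕ → ℝ) (U : ℝ) : ℕ → ℝ := fun j =>
  x j + chooseStep (maxStep x (direction n Q x) n)
    (maxStep x (fun j => 0 - direction n Q x j) n) U * direction n Q x j

/-- The walk driven by the random numbers `f`. -/
noncomputable def walk (n : ℕ) (Q : ℕ → ℕ → ℝ) (f : ℕ → ℝ) : ℕ → ℕ → ℝ
  | 0 => 0
  | t + 1 => walkStep n Q (walk n Q f t) (f t)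

theorem walk_congr {n : ℕ} {Q : ℕ → ℕ → ℝ} {f g : ℕ → ℝ} {t : ℕ} (h : ∀ s < t, f s = g s) :
    walk n Q f t = walk n Q g t := by
  induction t with
  | zero => rfl
  | succ t ih => rw [walk, walk, ih fun s hs => h s (by omega), h t (by omega)]

theorem aliveWeight_eq_one {n : ℕ} {x : ℕ → ℝ} {j : ℕ} (hj : j ∈ alive n x) :
    aliveWeight x j = 1 := by
  have h := (abs_lt.1 (mem_alive.1 hj).2)
  rw [aliveWeight, if_pos (by nlinarith)]

theorem aliveWeight_eq_zero {n : ℕ} {x : ℕ → ℝ} {j : ℕ} (hjn : j < n) (hj : j ∉ alive n x) :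
    aliveWeight x j = 0 := by
  rw [aliveWeight, if_neg]
  intro h
  refine hj (mem_alive.2 ⟨hjn, abs_lt.2 ?_⟩)
  constructor <;> nlinarith

theorem aliveWeight_nonneg (x : ℕ → ℝ) (j : ℕ) : 0 ≤ aliveWeight x j := by
  rw [aliveWeight]; split_ifs <;> norm_num

theorem direction_eq_gsRow {n : ℕ} {Q : ℕ → ℕ → ℝ} {x : ℕ → ℝ} (h : (alive n x).Nonempty) :
    direction n Q x = gsRow n Q (aliveWeight x) ((alive n x).max' h) := by
  set p := (alive n x).max' h with hp
  have hpa : p ∈ alive n x := (alive n x).max'_mem h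
  have hpn := (mem_alive.1 hpa).1
  funext c
  rw [direction, sum_eq_single_of_mem p (mem_range.2 hpn), if_neg]
  · rw [sum_eq_zero]
    · exact lt_irrefl 0
    · intro i hi
      split_ifs with hpi
      · refine aliveWeight_eq_zero (mem_range.1 hi) fun hia => ?_
        exact absurd ((alive n x).le_max' i hia) (not_le.2 hpi)
      · rfl
  · intro j hj hjp
    rcases lt_or_gt_of_ne hjp with hlt | hlt
    · rw [if_pos]
      refine sum_pos' (fun i _ => ?_) ⟨p, mem_range.2 hpn, ?_⟩
      · split_ifs
        · exact aliveWeight_nonneg x i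
        · exact le_rfl
      · rw [if_pos hlt, aliveWeight_eq_one hpa]; exact one_pos
    · rw [gsRow_of_weight_eq_zero, ite_self]
      refine aliveWeight_eq_zero (mem_range.1 hj) fun hja => ?_
      exact absurd ((alive n x).le_max' j hja) (not_le.2 hlt)

theorem direction_of_alive_eq_empty {n : ℕ} {Q : ℕ → ℕ → ℝ} {x : ℕ → ℝ} (h : alive n x = ∅)
    (c : ℕ) : direction n Q x c = 0 :=
  sum_eq_zero fun j hj => by
    rw [gsRow_of_weight_eq_zero (aliveWeight_eq_zero (mem_range.1 hj) (by simp [h])), ite_self]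

theorem direction_frozen {n : ℕ} {Q : ℕ → ℕ → ℝ} {x : ℕ → ℝ} {j : ℕ} (hj : j < n)
    (hja : j ∉ alive n x) : direction n Q x j = 0 :=
  sum_eq_zero fun i _ => by
    rw [gsRow_apply_of_weight_eq_zero (aliveWeight_eq_zero hj hja), ite_self]

theorem maxStep_spec {x u : ℕ → ℝ} {k : ℕ} (hx : ∀ j < k, |x j| ≤ 1)
    (hu : ∀ j < k, u j ≠ 0 → |x j| < 1) :
    0 < maxStep x u k ∧ (∀ j < k, |x j + maxStep x u k * u j| ≤ 1) ∧
      (maxStep x u k = 2 ∨ ∃ j < k, |x j| < 1 ∧ |x j + maxStep x u k * u j| = 1) := by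
  induction k with
  | zero => simp [maxStep]
  | succ k ih =>
    obtain ⟨hpos, hle, htight⟩ := ih (fun j hj => hx j (by omega)) (fun j hj => hu j (by omega))
    -- a shorter step keeps the earlier coordinates in range by convexity
    have hshort : ∀ d, 0 < d → d ≤ maxStep x u k → ∀ j < k, |x j + d * u j| ≤ 1 := by
      intro d hd hdk j hj
      obtain ⟨h1, h2⟩ := abs_le.1 (hle j hj)
      obtain ⟨h3, h4⟩ := abs_le.1 (hx j (by omega))
      rw [abs_le]
      rcases le_total 0 (u j) with h | h
      · constructor <;> nlinarith
      · constructor <;> nlinarith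
    have hnew : ∀ d, 0 < d → d ≤ maxStep x u k → u k ≠ 0 → |x k + d * u k| = 1 →
        0 < d ∧ (∀ j < k + 1, |x j + d * u j| ≤ 1) ∧
          (d = 2 ∨ ∃ j < k + 1, |x j| < 1 ∧ |x j + d * u j| = 1) := by
      intro d hd hdk huk hk
      refine ⟨hd, fun j hj => ?_, .inr ⟨k, by omega, hu k (by omega) huk, hk⟩⟩
      rcases Nat.lt_succ_iff_lt_or_eq.1 hj with hj | rfl
      · exact hshort d hd hdk j hj
      · exact hk.le
    have hold : |x k + maxStep x u k * u k| ≤ 1 →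
        0 < maxStep x u k ∧ (∀ j < k + 1, |x j + maxStep x u k * u j| ≤ 1) ∧
          (maxStep x u k = 2 ∨ ∃ j < k + 1, |x j| < 1 ∧ |x j + maxStep x u k * u j| = 1) := by
      intro hk
      refine ⟨hpos, fun j hj => ?_, htight.imp_right fun ⟨j, hj, h⟩ => ⟨j, by omega, h⟩⟩
      rcases Nat.lt_succ_iff_lt_or_eq.1 hj with hj | rfl
      · exact hle j hj
      · exact hk
    rw [maxStep]
    obtain ⟨hx1, hx2⟩ := abs_le.1 (hx k (by omega))
    split_ifs with h1 h2 h3 h4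
    · have := abs_lt.1 (hu k (by omega) h1.ne')
      refine hnew _ (div_pos (by linarith) h1) h2.le h1.ne' ?_
      rw [div_mul_cancel₀ _ h1.ne']; simp
    · refine hold (abs_le.2 ⟨by nlinarith, ?_⟩)
      rw [not_lt, le_div_iff₀ h1] at h2
      linarith
    · have := abs_lt.1 (hu k (by omega) h3.ne)
      refine hnew _ (div_pos_of_neg_of_neg (by linarith) h3) h4.le h3.ne ?_
      rw [div_mul_cancel₀ _ h3.ne]; simp
    · refine hold (abs_le.2 ⟨?_, by nlinarith⟩)
      rw [not_lt, le_div_iff_of_neg h3] at h4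
      linarith
    · have : u k = 0 := le_antisymm (not_lt.1 h1) (not_lt.1 h3)
      exact hold (by rw [this, mul_zero, add_zero]; exact hx k (by omega))

section

variable {n : ℕ} {Q : ℕ → ℕ → ℝ} {x : ℕ → ℝ}

theorem chooseStep_eq_or (d e U : ℝ) : chooseStep d e U = d ∨ chooseStep d e U = -e := by
  rw [chooseStep]
  split_ifs <;> simp

theorem forward_spec (hx : ∀ j < n, |x j| ≤ 1) :
    0 < maxStep x (direction n Q x) n ∧
      (∀ j < n, |x j + maxStep x (direction n Q x) n * direction n Q x j| ≤ 1) ∧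
      (maxStep x (direction n Q x) n = 2 ∨ ∃ j < n, |x j| < 1 ∧
        |x j + maxStep x (direction n Q x) n * direction n Q x j| = 1) :=
  maxStep_spec hx fun j hj hu => by
    by_contra h
    exact hu (direction_frozen hj fun hja => h (mem_alive.1 hja).2)

theorem backward_spec (hx : ∀ j < n, |x j| ≤ 1) :
    0 < maxStep x (fun j => 0 - direction n Q x j) n ∧
      (∀ j < n, |x j + -maxStep x (fun j => 0 - direction n Q x j) n * direction n Q x j| ≤ 1) ∧
      (maxStep x (fun j => 0 - direction n Q x j) n = 2 ∨ ∃ j < n, |x j| < 1 ∧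
        |x j + -maxStep x (fun j => 0 - direction n Q x j) n * direction n Q x j| = 1) := by
  have h := maxStep_spec (x := x) (u := fun j => 0 - direction n Q x j) hx fun j hj hu => by
    by_contra h
    exact hu (by rw [direction_frozen hj fun hja => h (mem_alive.1 hja).2, sub_zero])
  simpa only [zero_sub, mul_neg, neg_mul] using h

theorem abs_walkStep_le (hx : ∀ j < n, |x j| ≤ 1) (U : ℝ) : ∀ j < n, |walkStep n Q x U j| ≤ 1 := by
  intro j hj
  rw [walkStep]
  rcases chooseStep_eq_or (maxStep x (direction n Q x) n)
    (maxStep x (fun j => 0 - direction n Q x j) n) U with h | h <;> rw [h]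
  · exact (forward_spec hx).2.1 j hj
  · exact (backward_spec hx).2.1 j hj

/-- Every step freezes a coordinate. -/
theorem card_alive_walkStep_lt (hx : ∀ j < n, |x j| ≤ 1) (U : ℝ) (h : (alive n x).Nonempty) :
    (alive n (walkStep n Q x U)).card < (alive n x).card := by
  have hpa := (alive n x).max'_mem h
  have hpn := (mem_alive.1 hpa).1
  have hpx := abs_lt.1 (mem_alive.1 hpa).2
  have hup : direction n Q x ((alive n x).max' h) = 1 := by
    rw [direction_eq_gsRow h, gsRow_self, aliveWeight_eq_one hpa]
  have htight : ∃ j < n, |x j| < 1 ∧ |walkStep n Q x U j| = 1 := by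
    simp only [walkStep]
    rcases chooseStep_eq_or (maxStep x (direction n Q x) n)
      (maxStep x (fun j => 0 - direction n Q x j) n) U with h' | h' <;> rw [h']
    · obtain ⟨-, h1, h2 | h2⟩ := forward_spec (Q := Q) hx
      · have := (abs_le.1 (h1 _ hpn)).2
        rw [h2, hup] at this
        linarith
      · exact h2
    · obtain ⟨-, h1, h2 | h2⟩ := backward_spec (Q := Q) hx
      · have := (abs_le.1 (h1 _ hpn)).1
        rw [h2, hup] at this
        linarith
      · exact h2
  obtain ⟨j, hj, hj1, hj2⟩ := htight
  refine card_lt_card ⟨fun i hi => ?_, fun hsub => ?_⟩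
  · obtain ⟨hin, hi1⟩ := mem_alive.1 hi
    by_contra hia
    rw [walkStep, direction_frozen hin hia, mul_zero, add_zero] at hi1
    exact hia (mem_alive.2 ⟨hin, hi1⟩)
  · exact (mem_alive.1 (hsub (mem_alive.2 ⟨hj, hj1⟩))).2.ne hj2

theorem abs_walk_le (f : ℕ → ℝ) (t : ℕ) : ∀ j < n, |walk n Q f t j| ≤ 1 := by
  induction t with
  | zero => simp [walk]
  | succ t ih => exact abs_walkStep_le ih _

theorem alive_walk (f : ℕ → ℝ) : alive n (walk n Q f n) = ∅ := by
  have key : ∀ t, (alive n (walk n Q f t)).card ≤ n - t := by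
    intro t
    induction t with
    | zero => exact (card_filter_le _ _).trans (by simp)
    | succ t ih =>
      rcases (alive n (walk n Q f t)).eq_empty_or_nonempty with h | h
      · have : walk n Q f (t + 1) = walk n Q f t := by
          funext j
          rw [walk, walkStep, direction_of_alive_eq_empty h, mul_zero, add_zero]
        rw [this, h]
        simp
      · have := card_alive_walkStep_lt (Q := Q) (abs_walk_le f t) (f t) h
        rw [walk]
        omega
  have := key n
  rw [Nat.sub_self, Nat.le_zero, card_eq_zero] at this
  exact this

theorem abs_walk_eq_one (f : ℕ → ℝ) {j : ℕ} (hj : j < n) : |walk n Q f n j| = 1 := by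
  refine le_antisymm (abs_walk_le f n j hj) (not_lt.1 fun h => ?_)
  have : j ∈ alive n (walk n Q f n) := mem_alive.2 ⟨hj, h⟩
  simp [alive_walk] at this

/-! ### The walk in Euclidean space -/

variable {E : Type*} [NormedAddCommGroup E] [InnerProductSpace ℝ E]

local notation "⟪" x ", " y "⟫" => inner ℝ x y

theorem inner_position {v : ℕ → E} {c : ℝ} (hv : ∀ i < n, ∀ j < n, ⟪v i, v j⟫ = c * Q i j)
    (y z : ℕ → ℝ) : ⟪position v n y, position v n z⟫ = c * bil n Q y z := by
  simp only [position, sum_inner, inner_sum, bil, mul_sum]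
  rw [sum_comm]
  refine sum_congr rfl fun i hi => sum_congr rfl fun j hj => ?_
  rw [inner_smul_left, inner_smul_right, hv i (mem_range.1 hi) j (mem_range.1 hj),
    RCLike.conj_to_real]
  ring

theorem position_single (v : ℕ → E) {i : ℕ} (hi : i < n) :
    position v n (fun c => if i = c then 1 else 0) = v i := by
  rw [position, sum_eq_single_of_mem i (mem_range.2 hi) (fun j _ hj => by simp [hj.symm])]
  simp

variable [FiniteDimensional ℝ E]

/-- The Gram-Schmidt row of the pivot is the direction of the walk. -/
theorem isDirection_direction {v : ℕ → E} {c : ℝ} (hQ : SymmOn n Q)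
    (hpos : ∀ y : ℕ → ℝ, (∃ j < n, y j ≠ 0) → 0 < bil n Q y y)
    (hv : ∀ i < n, ∀ j < n, ⟪v i, v j⟫ = c * Q i j) (h : (alive n x).Nonempty) :
    IsDirection v n (alive n x) ((alive n x).max' h) (direction n Q x) := by
  set p := (alive n x).max' h with hp
  have hpa : p ∈ alive n x := (alive n x).max'_mem h
  have hpn := (mem_alive.1 hpa).1
  have hup : direction n Q x p = 1 := by
    rw [direction_eq_gsRow h, gsRow_self, aliveWeight_eq_one hpa]
  refine ⟨hup, fun j hj hja => direction_frozen hj hja, ?_⟩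
  set V := spanOf v ((alive n x).erase p) with hV
  have hmem : v p - position v n (direction n Q x) ∈ V := by
    have e : v p - position v n (direction n Q x) =
        -∑ j ∈ (range n).erase p, direction n Q x j • v j := by
      rw [position, ← add_sum_erase _ _ (mem_range.2 hpn), hup, one_smul]
      abel
    rw [e]
    refine neg_mem (sum_mem fun j hj => ?_)
    obtain ⟨hjp, hjn⟩ := mem_erase.1 hj
    by_cases hja : j ∈ alive n x
    · exact V.smul_mem _ (mem_spanOf v (mem_erase.2 ⟨hjp, hja⟩))
    · rw [direction_frozen (mem_range.1 hjn) hja, zero_smul]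
      exact zero_mem V
  have hnull : ∀ j < n, bil n Q (gsRow n Q (aliveWeight x) j) (gsRow n Q (aliveWeight x) j) = 0 →
      ∀ c < n, gsRow n Q (aliveWeight x) j c = 0 := by
    intro j hj h0 c _
    by_cases hja : j ∈ alive n x
    · refine absurd h0 (hpos _ ⟨j, hj, ?_⟩).ne'
      rw [gsRow_self, aliveWeight_eq_one hja]
      exact one_ne_zero
    · exact gsRow_of_weight_eq_zero (aliveWeight_eq_zero hj hja) c
  have horth : position v n (direction n Q x) ∈ Vᗮ := by
    rw [hV, spanOf, Submodule.mem_orthogonal]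
    intro w hw
    induction hw using Submodule.span_induction with
    | mem w hw =>
      obtain ⟨i, hi, rfl⟩ := hw
      obtain ⟨hip, hia⟩ := mem_erase.1 (by exact_mod_cast hi : i ∈ (alive n x).erase p)
      have hin := (mem_alive.1 hia).1
      have hlt : i < p := lt_of_le_of_ne ((alive n x).le_max' i hia) hip
      rw [← position_single v hin, inner_position hv, direction_eq_gsRow h, ← hp]
      -- the basis vector `i` is a combination of the Gram-Schmidt rows up to `i`
      set t : ℕ → ℝ := fun j => (∑ l ∈ range n, Q i l * gsRow n Q (aliveWeight x) j l) /
        bil n Q (gsRow n Q (aliveWeight x) j) (gsRow n Q (aliveWeight x) j) with ht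
      have e : (fun c => if i = c then (1 : ℝ) else 0) = fun c =>
          ∑ j ∈ range (i + 1), (if j = i then 1 else t j) * gsRow n Q (aliveWeight x) j c := by
        funext c
        have e' : ∑ j ∈ range i, (if j = i then 1 else t j) * gsRow n Q (aliveWeight x) j c =
            ∑ j ∈ range i, t j * gsRow n Q (aliveWeight x) j c :=
          sum_congr rfl fun j hj => by rw [if_neg (mem_range.1 hj).ne]
        rw [sum_range_succ, if_pos rfl, one_mul, gsRow_eq n Q (aliveWeight x) i c,
          aliveWeight_eq_one hia, one_mul, e', add_sub_cancel]
      rw [e, bil_sum_left, sum_eq_zero, mul_zero]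
      intro j hj
      rw [bil_gsRow_eq_zero hQ hnull hpn (by have := mem_range.1 hj; omega), mul_zero]
    | zero => exact inner_zero_left _
    | add a b _ _ ha hb => rw [inner_add_left, ha, hb, add_zero]
    | smul r a _ ha => rw [inner_smul_left, ha, mul_zero]
  have hproj : V.starProjection (v p) = v p - position v n (direction n Q x) := by
    refine Submodule.eq_starProjection_of_mem_of_inner_eq_zero hmem fun w hw => ?_
    rw [sub_sub_cancel]
    exact Submodule.inner_left_of_mem_orthogonal hw horth
  change _ = v p - V.starProjection (v p)
  rw [hproj, sub_sub_cancel]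

/-- One step of the walk increases the expected potential at most by the rounding factor. -/
theorem expect_potential_walkStep_le {v : ℕ → E} {c : ℝ} (θ : E) (hc : 0 < c) (hQ : SymmOn n Q)
    (hpos : ∀ y : ℕ → ℝ, (∃ j < n, y j ≠ 0) → 0 < bil n Q y y)
    (hv : ∀ i < n, ∀ j < n, ⟪v i, v j⟫ = c * Q i j) (hv1 : ∀ j < n, ‖v j‖ ≤ 1)
    (hx : ∀ j < n, |x j| ≤ 1) :
    expect (dyadic n) (fun U => ENNReal.ofReal (potential θ v n (walkStep n Q x U))) ≤
      ENNReal.ofReal ((1 + 2 / 2 ^ n) * potential θ v n x) := by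
  have hfac : (1 : ℝ) ≤ 1 + 2 / 2 ^ n := by
    have : (0 : ℝ) < 2 / 2 ^ n := by positivity
    linarith
  rcases (alive n x).eq_empty_or_nonempty with h | h
  · have : ∀ U, walkStep n Q x U = x := fun U => by
      funext j
      rw [walkStep, direction_of_alive_eq_empty h, mul_zero, add_zero]
    simp only [this, expect_const]
    exact ENNReal.ofReal_le_ofReal (le_mul_of_one_le_left (potential_pos θ v n x).le hfac)
  · have hdir := isDirection_direction hQ hpos hv h
    have hpn := (mem_alive.1 ((alive n x).max'_mem h)).1
    have hw : residual v (alive n x) ((alive n x).max' h) ≠ 0 := by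
      rw [← hdir.position_eq]
      intro h0
      have h1 := inner_position hv (direction n Q x) (direction n Q x)
      rw [h0, inner_zero_left] at h1
      have h2 := hpos (direction n Q x) ⟨_, hpn, by rw [hdir.pivot]; exact one_ne_zero⟩
      have := mul_pos hc h2
      linarith
    obtain ⟨hd, hd1, -⟩ := forward_spec (Q := Q) hx
    obtain ⟨he, he1, -⟩ := backward_spec (Q := Q) hx
    set d := maxStep x (direction n Q x) n with hddef
    set e := maxStep x (fun j => 0 - direction n Q x j) n with hedef
    have hmart := potential_move_two_le θ h hdir hv1 hw hx hd he hd1 he1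
    set F := potential θ v n fun j => x j + d * direction n Q x j with hF
    set G := potential θ v n fun j => x j + -e * direction n Q x j with hG
    have hFpos : 0 ≤ F := (potential_pos _ _ _ _).le
    have hGpos : 0 ≤ G := (potential_pos _ _ _ _).le
    have hsum : 0 < d + e := by linarith
    have hd' : 1 - e / (d + e) = d / (d + e) := by field_simp; ring
    have he' : 1 - d / (d + e) = e / (d + e) := by field_simp; ring
    by_cases hde : d < e
    · have hfun : (fun U => ENNReal.ofReal (potential θ v n (walkStep n Q x U))) = fun U =>
          if U ≤ d / (d + e) then ENNReal.ofReal G else ENNReal.ofReal F := by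
        funext U
        have hiff : U ≤ d / (d + e) ↔ ¬ d < U * (d + e) := by rw [le_div_iff₀ hsum, not_lt]
        have hstep : walkStep n Q x U = fun j => x j + chooseStep d e U * direction n Q x j := rfl
        rw [hstep, chooseStep, if_pos hde, zero_sub]
        by_cases h : d < U * (d + e)
        · rw [if_pos h, if_neg (hiff.not.2 (not_not.2 h))]
        · rw [if_neg h, if_pos (hiff.2 h)]
      rw [hfun]
      refine (expect_dyadic_ite_le n (by positivity) ?_ hGpos hFpos).trans
        (ENNReal.ofReal_le_ofReal ?_)
      · rw [div_le_iff₀ hsum]; linarith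
      · rw [he']
        gcongr
        linarith
    · have hfun : (fun U => ENNReal.ofReal (potential θ v n (walkStep n Q x U))) = fun U =>
          if U ≤ e / (d + e) then ENNReal.ofReal F else ENNReal.ofReal G := by
        funext U
        have hiff : U ≤ e / (d + e) ↔ ¬ e < U * (d + e) := by rw [le_div_iff₀ hsum, not_lt]
        have hstep : walkStep n Q x U = fun j => x j + chooseStep d e U * direction n Q x j := rfl
        rw [hstep, chooseStep, if_neg hde, zero_sub]
        by_cases h : e < U * (d + e)
        · rw [if_pos h, if_neg (hiff.not.2 (not_not.2 h))]
        · rw [if_neg h, if_pos (hiff.2 h)]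
      rw [hfun]
      refine (expect_dyadic_ite_le n (by positivity) ?_ hFpos hGpos).trans
        (ENNReal.ofReal_le_ofReal ?_)
      · rw [div_le_iff₀ hsum]; linarith
      · rw [hd']
        gcongr

theorem expect_potential_walk_le {v : ℕ → E} {c : ℝ} (θ : E) (hc : 0 < c) (hQ : SymmOn n Q)
    (hpos : ∀ y : ℕ → ℝ, (∃ j < n, y j ≠ 0) → 0 < bil n Q y y)
    (hv : ∀ i < n, ∀ j < n, ⟪v i, v j⟫ = c * Q i j) (hv1 : ∀ j < n, ‖v j‖ ≤ 1) (t : ℕ) :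
    expect (dyadics n t) (fun f => ENNReal.ofReal (potential θ v n (walk n Q f t))) ≤
      ENNReal.ofReal ((1 + 2 / 2 ^ n) ^ t * potential θ v n 0) := by
  induction t with
  | zero => exact (expect_pure _ _).le.trans (by simp [walk])
  | succ t ih =>
    have hfac : (0 : ℝ) ≤ 1 + 2 / 2 ^ n := by positivity
    have e : dyadics n (t + 1) =
        (dyadics n t).bind fun f => (dyadic n).map fun u => Function.update f t u := rfl
    rw [e, expect_bind]
    simp only [expect_map, Function.comp_def, walk, Function.update_self]
    calc _ ≤ expect (dyadics n t) fun f => ENNReal.ofReal (1 + 2 / 2 ^ n) *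
          ENNReal.ofReal (potential θ v n (walk n Q f t)) := by
          refine expect_mono fun f => ?_
          have hcongr : ∀ u, walk n Q (Function.update f t u) t = walk n Q f t := fun u =>
            walk_congr fun s hs => Function.update_of_ne hs.ne _ _
          simp only [hcongr]
          rw [← ENNReal.ofReal_mul hfac]
          exact expect_potential_walkStep_le θ hc hQ hpos hv hv1 (abs_walk_le f t)
      _ ≤ _ := by
          rw [expect_const_mul, pow_succ', mul_assoc, ENNReal.ofReal_mul hfac]
          gcongr

/-- The endpoint of the walk is subgaussian, up to the factor `exp 2` for rounding probabilities. -/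
theorem expect_exp_walk_le {v : ℕ → E} {c : ℝ} (θ : E) (hc : 0 < c) (hQ : SymmOn n Q)
    (hpos : ∀ y : ℕ → ℝ, (∃ j < n, y j ≠ 0) → 0 < bil n Q y y)
    (hv : ∀ i < n, ∀ j < n, ⟪v i, v j⟫ = c * Q i j) (hv1 : ∀ j < n, ‖v j‖ ≤ 1) :
    expect (dyadics n n)
      (fun f => ENNReal.ofReal (Real.exp ⟪θ, position v n (walk n Q f n)⟫)) ≤
      ENNReal.ofReal (Real.exp (2 + ‖θ‖ ^ 2 / 2)) := by
  have h := expect_potential_walk_le θ hc hQ hpos hv hv1 n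
  simp only [potential_of_alive_eq_empty θ v (alive_walk _)] at h
  refine h.trans (ENNReal.ofReal_le_ofReal ?_)
  rw [Real.exp_add]
  have h1 : (1 + 2 / 2 ^ n : ℝ) ^ n ≤ Real.exp 2 := by
    calc (1 + 2 / 2 ^ n : ℝ) ^ n ≤ Real.exp (2 / 2 ^ n) ^ n := by
          gcongr
          rw [add_comm]
          exact Real.add_one_le_exp _
      _ = Real.exp (n * (2 / 2 ^ n)) := by rw [← Real.exp_nat_mul]
      _ ≤ Real.exp 2 := by
          rw [Real.exp_le_exp]
          have : (n : ℝ) ≤ 2 ^ n := by exact_mod_cast Nat.lt_two_pow_self.le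
          rw [mul_div_assoc', div_le_iff₀ (by positivity)]
          linarith
  exact mul_le_mul h1 (potential_zero_le θ v n) (potential_pos _ _ _ _).le (Real.exp_pos _).le

end

end GramSchmidtWalk

namespace RealRAM

open Finset GramSchmidtWalk

/-! ### The program that runs the walk -/

/-- Store in the array `d` the largest step in the direction held by the array `a`. -/
def boundCode (a d : ℕ) : Stmt :=
  .seq (.assign d 4 4 (.const 2)) <| .loop 41 1 <| .assign d 4 4 <|
    .lt (.const 0) (.cell a 4 41)
      (.lt ((.const 1 - .cell 2 4 41) / .cell a 4 41) (.cell d 4 4)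
        ((.const 1 - .cell 2 4 41) / .cell a 4 41) (.cell d 4 4))
      (.lt (.cell a 4 41) (.const 0)
        (.lt ((.const (-1) - .cell 2 4 41) / .cell a 4 41) (.cell d 4 4)
          ((.const (-1) - .cell 2 4 41) / .cell a 4 41) (.cell d 4 4))
        (.cell d 4 4))

/-- The choice between two steps. -/
def chooseExpr (d e u : Expr) : Expr :=
  .lt d e (.lt d (u * (d + e)) d (.const 0 - e)) (.lt e (u * (d + e)) (.const 0 - e) d)

/-- One step of the walk, from the position in the array `2`. The array `5` holds the Gram matrix
and the array `3` the random numbers. -/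
def walkBody : Stmt :=
  .seq (.row 7 4 41 1 (.lt (.cell 2 4 41 * .cell 2 4 41) (.const 1) (.const 1) (.const 0))) <|
  .seq (gsCode 5) <|
  .seq (.row 10 4 41 1 (.sum 42 1 (.lt (.const 0)
    (.sum 43 1 (.nlt 42 43 (.cell 7 4 43) (.const 0))) (.const 0) (.cell 8 42 41)))) <|
  .seq (.row 15 4 41 1 (.const 0 - .cell 10 4 41)) <|
  .seq (boundCode 10 16) <|
  .seq (boundCode 15 17) <|
  .seq (.assign 18 4 4 (chooseExpr (.cell 16 4 4) (.cell 17 4 4) (.cell 3 4 40))) <|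
  .row 2 4 41 1 (.cell 2 4 41 + .cell 18 4 4 * .cell 10 4 41)

/-- Run the walk from `0`. -/
def walkCode : Stmt := .seq (.row 2 4 41 1 (.const 0)) (.loop 40 1 walkBody)

section

variable {n : ℕ} {ρ : ℕ → ℕ} {σ : Store}

theorem boundCode_spec {a d : ℕ} (h1 : ρ 1 = n) (h4 : ρ 4 = 0) (had : a ≠ d) (h2d : 2 ≠ d)
    {x u : ℕ → ℝ} (hx : ∀ j < n, σ 2 0 j = x j) (hu : ∀ j < n, σ a 0 j = u j) :
    (boundCode a d).den ρ σ d 0 0 = maxStep x u n := by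
  set σ₁ := (Stmt.assign d 4 4 (.const 2)).den ρ σ with hσ₁
  have hf : ∀ b, b ≠ d → σ₁ b = σ b := fun b hb =>
    Stmt.den_eq_of_notMem_writes (by simpa [Stmt.writes] using hb) _ _
  have h0 : σ₁ d 0 0 = 2 := by
    rw [hσ₁, Stmt.den_assign]
    simp [h4, Expr.eval_const]
  rw [boundCode, Stmt.den_seq, ← hσ₁, ← h1]
  refine (Stmt.den_loop_induction (fun k τ => (∀ b, b ≠ d → τ b = σ b) ∧ τ d 0 0 = maxStep x u k)
    ⟨hf, h0⟩ ?_).2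
  rintro k τ hk ⟨hτ, hd⟩
  rw [h1] at hk
  refine ⟨fun b hb => (Stmt.den_eq_of_notMem_writes (by simpa [Stmt.writes] using hb) _ _).trans
    (hτ b hb), ?_⟩
  have hx' := hx k hk
  have hu' := hu k hk
  rw [← hτ 2 h2d] at hx'
  rw [← hτ a had] at hu'
  rw [Stmt.den_assign]
  simp [Expr.eval_lt, Expr.eval_const, Expr.eval_cell, Expr.eval_sub, Expr.eval_div, h4, hx', hu',
    hd, maxStep]

theorem eval_chooseExpr (d e u : Expr) : (chooseExpr d e u).eval ρ σ =
    chooseStep (d.eval ρ σ) (e.eval ρ σ) (u.eval ρ σ) := by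
  simp [chooseExpr, chooseStep, Expr.eval_lt, Expr.eval_const, Expr.eval_sub, Expr.eval_mul,
    Expr.eval_add]

theorem walkBody_spec {t : ℕ} (h1 : ρ 1 = n) (h4 : ρ 4 = 0) (h40 : ρ 40 = t)
    {x : ℕ → ℝ} (hx : ∀ j < n, σ 2 0 j = x j) :
    ∀ j < n, walkBody.den ρ σ 2 0 j = walkStep n (σ 5) x (σ 3 0 t) j := by
  rw [walkBody, Stmt.den_seq, Stmt.den_row (aliveWeight x) (by norm_num)]
  swap
  · intro j hj τ hτ _ _
    rw [h1] at hj
    simp [Expr.eval_lt, Expr.eval_const, Expr.eval_cell, Expr.eval_mul, h4, hτ, hx j hj,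
      aliveWeight]
  set σ₁ : Store := Function.update σ 7 fun i j => if i = ρ 4 ∧ j < ρ 1 then aliveWeight x j
    else σ 7 i j with hσ₁
  have hf₁ : ∀ a, a ≠ 7 → σ₁ a = σ a := fun a ha => by rw [hσ₁, Function.update_of_ne ha]
  have h7 : ∀ k < n, σ₁ 7 0 k = aliveWeight x k := fun k hk => by simp [hσ₁, h1, h4, hk]
  rw [Stmt.den_seq]
  set σ₂ := (gsCode 5).den ρ σ₁ with hσ₂
  have hf₂ : ∀ a, a ∉ [8, 9] → σ₂ a = σ₁ a := by
    intro a ha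
    simp only [List.mem_cons, not_or] at ha
    exact Stmt.den_eq_of_notMem_writes (by simp [gsCode, Stmt.row, Stmt.writes, ha.1, ha.2.1]) _ _
  have h8 : ∀ k < n, ∀ c < n, σ₂ 8 k c = gsRow n (σ 5) (aliveWeight x) k c :=
    gsCode_spec h1 h4 (by norm_num) (by norm_num)
      (fun a _ b _ => by rw [hf₁ 5 (by norm_num)]) h7
  have h7₂ : ∀ k < n, σ₂ 7 0 k = aliveWeight x k := by rwa [hf₂ 7 (by decide)]
  set u := direction n (σ 5) x with hu
  rw [Stmt.den_seq, Stmt.den_row u (by norm_num)]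
  swap
  · intro j hj τ hτ _ _
    rw [h1] at hj
    simp only [Expr.eval_sum, Expr.eval_lt, Expr.eval_const, Expr.eval_nlt, Expr.eval_cell]
    simp [h1, h4, hτ, hu, direction]
    refine sum_congr rfl fun i hi => ?_
    rw [h8 i (mem_range.1 hi) j hj, sum_congr rfl fun l hl => by rw [h7₂ l (mem_range.1 hl)]]
  set σ₃ : Store := Function.update σ₂ 10 fun i j => if i = ρ 4 ∧ j < ρ 1 then u j
    else σ₂ 10 i j with hσ₃
  rw [Stmt.den_seq, Stmt.den_row (fun j => 0 - u j) (by norm_num)]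
  swap
  · intro j hj τ hτ _ _
    simp only [Expr.eval_sub, Expr.eval_const, Expr.eval_cell]
    rw [hτ 10 (by norm_num)]
    simp [h4, hσ₃, hj]
  set σ₄ : Store := Function.update σ₃ 15 fun i j => if i = ρ 4 ∧ j < ρ 1 then 0 - u j
    else σ₃ 15 i j with hσ₄
  have hf₄ : ∀ a, a ∉ [7, 8, 9, 10, 15] → σ₄ a = σ a := by
    intro a ha
    simp only [List.mem_cons, not_or] at ha
    rw [hσ₄, Function.update_of_ne ha.2.2.2.2.1, hσ₃, Function.update_of_ne ha.2.2.2.1, hf₂ a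
      (by simp [ha]), hf₁ a ha.1]
  have hx₄ : ∀ j < n, σ₄ 2 0 j = x j := by rwa [hf₄ 2 (by decide)]
  have h10 : ∀ j < n, σ₄ 10 0 j = u j := fun j hj => by simp [hσ₄, hσ₃, h1, h4, hj]
  have h15 : ∀ j < n, σ₄ 15 0 j = 0 - u j := fun j hj => by simp [hσ₄, h1, h4, hj]
  have hw : ∀ a d b, b ≠ d → ∀ τ, (boundCode a d).den ρ τ b = τ b := fun a d b hb τ =>
    Stmt.den_eq_of_notMem_writes (by simp [boundCode, Stmt.writes, hb]) _ _
  rw [Stmt.den_seq]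
  set σ₅ := (boundCode 10 16).den ρ σ₄ with hσ₅
  have h16 : σ₅ 16 0 0 = maxStep x u n :=
    boundCode_spec h1 h4 (by norm_num) (by norm_num) hx₄ h10
  have hf₅ : ∀ a, a ≠ 16 → σ₅ a = σ₄ a := fun a ha => hw _ _ a ha _
  rw [Stmt.den_seq]
  set σ₆ := (boundCode 15 17).den ρ σ₅ with hσ₆
  have h17 : σ₆ 17 0 0 = maxStep x (fun j => 0 - u j) n :=
    boundCode_spec h1 h4 (by norm_num) (by norm_num) (by rwa [hf₅ 2 (by norm_num)])
      (by rwa [hf₅ 15 (by norm_num)])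
  have hf₆ : ∀ a, a ≠ 17 → σ₆ a = σ₅ a := fun a ha => hw _ _ a ha _
  rw [Stmt.den_seq, Stmt.den_assign, eval_chooseExpr]
  simp only [Expr.eval_cell]
  rw [h4, h40, h17, hf₆ 16 (by norm_num), h16, hf₆ 3 (by norm_num), hf₅ 3 (by norm_num),
    hf₄ 3 (by decide)]
  set σ₇ : Store := Function.update σ₆ 18 fun i j => if i = 0 ∧ j = 0 then
    chooseStep (maxStep x u n) (maxStep x (fun j => 0 - u j) n) (σ 3 0 t) else σ₆ 18 i j with hσ₇
  have hf₇ : ∀ a, a ∉ [16, 17, 18] → σ₇ a = σ₄ a := by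
    intro a ha
    simp only [List.mem_cons, not_or] at ha
    rw [hσ₇, Function.update_of_ne ha.2.2.1, hf₆ a ha.2.1, hf₅ a ha.1]
  intro j hj
  rw [Stmt.den_row (walkStep n (σ 5) x (σ 3 0 t)) (by norm_num)]
  · simp [h1, h4, hj]
  · intro j hj τ hτ _ hτ'
    rw [h1] at hj
    rw [h4] at hτ'
    simp only [Expr.eval_add, Expr.eval_mul, Expr.eval_cell]
    rw [hτ 18 (by norm_num), hτ 10 (by norm_num), hf₇ 10 (by decide)]
    simp only [Function.update_self, Function.update_of_ne (show (4 : ℕ) ≠ 41 by norm_num), h4]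
    rw [hτ', hf₇ 2 (by decide), hx₄ j hj, h10 j hj]
    simp [hσ₇, walkStep, hu]

theorem walkCode_spec (h1 : ρ 1 = n) (h4 : ρ 4 = 0) :
    ∀ j < n, walkCode.den ρ σ 2 0 j = walk n (σ 5) (σ 3 0) n j := by
  rw [walkCode, Stmt.den_seq, Stmt.den_row (fun _ => 0) (by norm_num)
    (fun j _ τ _ _ _ => by simp [Expr.eval_const])]
  set σ₁ : Store := Function.update σ 2 fun i j => if i = ρ 4 ∧ j < ρ 1 then 0 else σ 2 i j
    with hσ₁
  have hw : ∀ a, a ∈ [3, 5] → a ∉ walkBody.writes := by decide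
  have key := Stmt.den_loop_induction (ρ := ρ) (σ := σ₁) (r := 40) (b := 1) (c := walkBody)
    (fun t τ => τ 3 = σ 3 ∧ τ 5 = σ 5 ∧ ∀ j < n, τ 2 0 j = walk n (σ 5) (σ 3 0) t j)
    ⟨by simp [hσ₁], by simp [hσ₁], fun j hj => by simp [hσ₁, h1, h4, hj, walk]⟩ (by
      rintro t τ _ ⟨h3, h5, h2⟩
      refine ⟨(Stmt.den_eq_of_notMem_writes (hw 3 (by simp)) _ _).trans h3,
        (Stmt.den_eq_of_notMem_writes (hw 5 (by simp)) _ _).trans h5, ?_⟩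
      have := walkBody_spec (ρ := Function.update ρ 40 t) (t := t) (by simpa) (by simpa)
        (by simp) h2
      rwa [h3, h5] at this)
  rw [h1] at key
  exact key.2.2

end

end RealRAM

namespace GramSchmidtWalk

open Finset RealRAM

/-! ### Certificates from factorizations -/

local notation "⟪" x ", " y "⟫" => inner ℝ x y

/-- The matrix `A` with the columns outside `J` replaced by zero. -/
noncomputable def masked {m n : ℕ} (A : Matrix (Fin m) (Fin n) ℝ) (J : Finset (Fin n))
    (i j : ℕ) : ℝ :=
  (inputState A J).arr 0 i j * (inputState A J).arr 1 0 j

section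

variable {m n : ℕ} {A : Matrix (Fin m) (Fin n) ℝ} {J : Finset (Fin n)}

theorem masked_of_mem (i : Fin m) {j : Fin n} (hj : j ∈ J) : masked A J i j = A i j := by
  simp [masked, inputState, hj]

theorem masked_of_notMem (i : ℕ) {j : Fin n} (hj : j ∉ J) : masked A J i j = 0 := by
  simp [masked, inputState, hj]

theorem masked_eq_zero {i j : ℕ} (h : ¬ (i < m ∧ j < n)) : masked A J i j = 0 := by
  simp only [masked, inputState, if_true, dif_neg h, zero_mul]

end

/-- Vectors that factor `A` give a certificate: the Gram matrix of the column vectors, normalized. -/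
theorem certificate_of_inner {E : Type*} [NormedAddCommGroup E] [InnerProductSpace ℝ E]
    {m n : ℕ} {A : ℕ → ℕ → ℝ} {b c : ℕ → E} {r s R : ℝ}
    (hA : ∀ i < m, ∀ j < n, A i j = ⟪b i, c j⟫) (hb : ∀ i < m, ‖b i‖ ≤ r)
    (hc : ∀ j < n, ‖c j‖ ≤ s) (hs : 0 < s) (hR : (r * s) ^ 2 ≤ R) :
    Certificate m n A R fun j k => ⟪c j, c k⟫ / s ^ 2 := by
  have hs2 : 0 < s ^ 2 := by positivity
  have habs : ∀ j < n, ∀ k < n, |⟪c j, c k⟫ / s ^ 2| ≤ 1 := by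
    intro j hj k hk
    rw [abs_div, abs_of_pos hs2, div_le_one hs2, sq]
    exact (abs_real_inner_le_norm _ _).trans
      (mul_le_mul (hc j hj) (hc k hk) (norm_nonneg _) hs.le)
  refine ⟨fun j hj => (le_abs_self _).trans (habs j hj j hj), habs, fun i hi x => ?_⟩
  have e1 := inner_position (n := n) (v := c) (c := s ^ 2)
    (Q := fun j k => ⟪c j, c k⟫ / s ^ 2) (fun i _ j _ => (mul_div_cancel₀ _ hs2.ne').symm) x x
  have e2 : dot n (A i) x = ⟪b i, position c n x⟫ := by
    rw [dot, position, inner_sum]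
    refine sum_congr rfl fun j hj => ?_
    rw [inner_smul_right, hA i hi j (mem_range.1 hj), mul_comm]
  rw [bil_gap, e2, sub_nonneg]
  rw [real_inner_self_eq_norm_sq] at e1
  set y := ‖position c n x‖
  set q := bil n (fun j k => ⟪c j, c k⟫ / s ^ 2) x x
  have hy : 0 ≤ y := norm_nonneg _
  have hq : 0 ≤ q := by
    have : 0 ≤ s ^ 2 * q := e1 ▸ sq_nonneg y
    exact nonneg_of_mul_nonneg_right this hs2
  have h1 : |⟪b i, position c n x⟫| ≤ r * y :=
    (abs_real_inner_le_norm _ _).trans (mul_le_mul_of_nonneg_right (hb i hi) hy)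
  calc ⟪b i, position c n x⟫ * ⟪b i, position c n x⟫ = |⟪b i, position c n x⟫| ^ 2 := by
        rw [sq_abs, sq]
    _ ≤ (r * y) ^ 2 := pow_le_pow_left₀ (abs_nonneg _) h1 2
    _ = (r * s) ^ 2 * q := by rw [mul_pow, e1]; ring
    _ ≤ R * q := mul_le_mul_of_nonneg_right hR hq

/-- The set whose infimum is `γ₂`. -/
def factorValues {m n : ℕ} (A : Matrix (Fin m) (Fin n) ℝ) : Set ℝ :=
  {t : ℝ | ∃ (k : ℕ) (B : Matrix (Fin m) (Fin k) ℝ) (C : Matrix (Fin k) (Fin n) ℝ)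
    (r s : ℝ), A = B * C ∧ 0 ≤ r ∧ 0 ≤ s ∧
      (∀ i, ‖WithLp.toLp 2 (B i)‖ ≤ r) ∧
      (∀ j, ‖WithLp.toLp 2 (fun l => C l j)‖ ≤ s) ∧ t = r * s}

section

variable {m n : ℕ} {A : Matrix (Fin m) (Fin n) ℝ} {J : Finset (Fin n)}

theorem nonneg_of_mem_factorValues {t : ℝ} (ht : t ∈ factorValues A) : 0 ≤ t := by
  obtain ⟨k, B, C, r, s, -, hr, hs, -, -, rfl⟩ := ht
  positivity

theorem factorValues_nonempty (A : Matrix (Fin m) (Fin n) ℝ) : (factorValues A).Nonempty := by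
  refine ⟨_, n, A, 1, ∑ i, ‖WithLp.toLp 2 (A i)‖,
    ∑ j, ‖WithLp.toLp 2 fun l => (1 : Matrix (Fin n) (Fin n) ℝ) l j‖, (Matrix.mul_one A).symm,
    by positivity, by positivity, fun i => ?_, fun j => ?_, rfl⟩
  · exact single_le_sum (f := fun i => ‖WithLp.toLp 2 (A i)‖) (fun _ _ => norm_nonneg _)
      (mem_univ i)
  · exact single_le_sum
      (f := fun j => ‖WithLp.toLp 2 fun l => (1 : Matrix (Fin n) (Fin n) ℝ) l j‖)
      (fun _ _ => norm_nonneg _) (mem_univ j)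

theorem gamma2_nonneg (A : Matrix (Fin m) (Fin n) ℝ) : 0 ≤ gamma2 A :=
  Real.sInf_nonneg fun _ => nonneg_of_mem_factorValues

/-- A factorization bounds the entries of the matrix, and certifies the square of its value. -/
theorem abs_masked_le_and_exists_certificate {t : ℝ} (ht : t ∈ factorValues A)
    (hA : ∃ i j, masked A J i j ≠ 0) :
    (∀ i j, |masked A J i j| ≤ t) ∧
      ∀ R, t ^ 2 ≤ R → ∃ Z, Certificate m n (masked A J) R Z := by
  obtain ⟨k, B, C, r, s, hBC, hr, hs, hB, hC, rfl⟩ := ht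
  classical
  set b : ℕ → EuclideanSpace ℝ (Fin k) := fun i =>
    if h : i < m then WithLp.toLp 2 (B ⟨i, h⟩) else 0 with hb
  set c : ℕ → EuclideanSpace ℝ (Fin k) := fun j =>
    if h : ∃ h : j < n, (⟨j, h⟩ : Fin n) ∈ J then WithLp.toLp 2 (fun l => C l ⟨j, h.1⟩) else 0
    with hc
  have hbr : ∀ i, ‖b i‖ ≤ r := fun i => by
    simp only [hb]; split_ifs with h
    · exact hB _
    · simpa using hr
  have hcs : ∀ j, ‖c j‖ ≤ s := fun j => by
    simp only [hc]; split_ifs with h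
    · exact hC _
    · simpa using hs
  have hbc : ∀ i j, masked A J i j = ⟪b i, c j⟫ := by
    intro i j
    by_cases hi : i < m
    · by_cases hj : ∃ h : j < n, (⟨j, h⟩ : Fin n) ∈ J
      · obtain ⟨hjn, hjJ⟩ := hj
        have := masked_of_mem (A := A) (⟨i, hi⟩ : Fin m) hjJ
        simp only [hb, hc, dif_pos hi, dif_pos (⟨hjn, hjJ⟩ : ∃ h : j < n, (⟨j, h⟩ : Fin n) ∈ J)]
        rw [this, hBC, Matrix.mul_apply, EuclideanSpace.inner_toLp_toLp, dotProduct]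
        simp [mul_comm]
      · simp only [hc, dif_neg hj, inner_zero_right]
        by_cases hjn : j < n
        · exact masked_of_notMem i (j := ⟨j, hjn⟩) fun h => hj ⟨hjn, h⟩
        · exact masked_eq_zero fun h => hjn h.2
    · simp only [hb, dif_neg hi, inner_zero_left]
      exact masked_eq_zero fun h => hi h.1
  have habs : ∀ i j, |masked A J i j| ≤ r * s := fun i j => by
    rw [hbc]
    exact (abs_real_inner_le_norm _ _).trans (mul_le_mul (hbr i) (hcs j) (norm_nonneg _) hr)
  refine ⟨habs, fun R hR => ⟨_, certificate_of_inner (fun i _ j _ => hbc i j) (fun i _ => hbr i)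
    (fun j _ => hcs j) (hs.lt_of_ne fun h => ?_) hR⟩⟩
  obtain ⟨i, j, hij⟩ := hA
  have := habs i j
  rw [← h, mul_zero] at this
  exact hij (abs_nonpos_iff.1 this)

/-- The identity matrix is a certificate for the sum of the squares of the entries. -/
theorem exists_certificate_sum_sq {A : ℕ → ℕ → ℝ} {R : ℝ}
    (hR : ∑ i ∈ range m, ∑ j ∈ range n, A i j * A i j ≤ R) : ∃ Z, Certificate m n A R Z := by
  set S := ∑ i ∈ range m, ∑ j ∈ range n, A i j * A i j with hS
  have hS0 : 0 ≤ S := sum_nonneg fun _ _ => sum_nonneg fun _ _ => mul_self_nonneg _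
  set b : ℕ → EuclideanSpace ℝ (Fin n) := fun i => WithLp.toLp 2 fun j => A i j with hb
  set c : ℕ → EuclideanSpace ℝ (Fin n) := fun j =>
    WithLp.toLp 2 fun l => if (l : ℕ) = j then 1 else 0 with hc
  refine ⟨_, certificate_of_inner (b := b) (c := c) (r := √S) (s := 1) (fun i _ j hj => ?_)
    (fun i hi => ?_) (fun j hj => ?_) one_pos (by rwa [mul_one, Real.sq_sqrt hS0])⟩
  · rw [hb, hc, EuclideanSpace.inner_toLp_toLp, dotProduct,
      sum_eq_single_of_mem (⟨j, hj⟩ : Fin n) (mem_univ _)]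
    · simp
    · intro l _ hl
      rw [if_neg fun h => hl (Fin.ext h), zero_mul]
  · rw [EuclideanSpace.norm_eq]
    refine Real.sqrt_le_sqrt ?_
    refine le_trans (le_of_eq ?_) (single_le_sum (f := fun i => ∑ j ∈ range n, A i j * A i j)
      (fun i _ => sum_nonneg fun _ _ => mul_self_nonneg _) (mem_range.2 hi))
    simp only [hb, Real.norm_eq_abs, sq_abs, ← sq, sum_range]
  · rw [EuclideanSpace.norm_eq, Real.sqrt_le_one, sum_eq_single_of_mem (⟨j, hj⟩ : Fin n)
      (mem_univ _)]
    · simp [hc]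
    · intro l _ hl
      have : (l : ℕ) ≠ j := fun h => hl (Fin.ext h)
      simp [hc, this]

/-- Among the multiples of the mean square of the entries, the least one with a certificate
approximates the square of `γ₂` up to the factor `2`. -/
theorem exists_level {s : ℝ}
    (hs : (∑ i ∈ range m, ∑ j ∈ range n, masked A J i j * masked A J i j) / (m * n) = s)
    (hspos : 0 < s) :
    ∃ K : ℕ, 2 ≤ K ∧ K ≤ m * n + 1 ∧ (∃ Z, Certificate m n (masked A J) (K * s) Z) ∧
      K * s ≤ 2 * gamma2 A ^ 2 := by
  classical
  set S := ∑ i ∈ range m, ∑ j ∈ range n, masked A J i j * masked A J i j with hS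
  have hmn : (0 : ℝ) < m * n := by
    refine lt_of_le_of_ne (by positivity) fun h => ?_
    rw [← h, div_zero] at hs
    exact hspos.ne hs
  have hmn1 : 1 ≤ m * n := by exact_mod_cast hmn
  have hSs : S = m * n * s := by rw [← hs, mul_div_cancel₀ _ hmn.ne']
  have hne : ∃ i j, masked A J i j ≠ 0 := by
    by_contra! h
    rw [hS] at hSs
    simp only [h, mul_zero, sum_const_zero] at hSs
    exact (mul_pos hmn hspos).ne hSs
  have htop : ∃ Z, Certificate m n (masked A J) (((m * n + 1 : ℕ) : ℝ) * s) Z := by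
    refine exists_certificate_sum_sq ?_
    rw [← hS, hSs]
    push_cast
    nlinarith
  have hex : ∃ K : ℕ, 2 ≤ K ∧ ∃ Z, Certificate m n (masked A J) (K * s) Z :=
    ⟨m * n + 1, by omega, htop⟩
  obtain ⟨h2, hZ⟩ := Nat.find_spec hex
  set K := Nat.find hex with hK
  refine ⟨K, h2, Nat.find_min' hex ⟨by omega, htop⟩, hZ, ?_⟩
  have key : ∀ t ∈ factorValues A, K * s ≤ 2 * t ^ 2 := by
    intro t ht
    obtain ⟨habs, hcert⟩ := abs_masked_le_and_exists_certificate ht hne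
    rcases h2.eq_or_lt with h | h
    -- the mean square of the entries is at most `t ^ 2`
    · have : S ≤ m * n * t ^ 2 := by
        calc S ≤ ∑ i ∈ range m, ∑ j ∈ range n, t ^ 2 := by
              refine sum_le_sum fun i _ => sum_le_sum fun j _ => ?_
              rw [← sq, ← sq_abs]
              exact pow_le_pow_left₀ (abs_nonneg _) (habs i j) 2
          _ = m * n * t ^ 2 := by simp [mul_assoc]
      rw [hSs] at this
      have := le_of_mul_le_mul_left this hmn
      rw [← h]
      push_cast
      linarith
    -- the multiple `K - 1` has no certificate, hence is less than `t ^ 2`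
    · have hmin := Nat.find_min hex (m := K - 1) (by omega)
      have hlt : ((K - 1 : ℕ) : ℝ) * s < t ^ 2 := by
        by_contra! hle
        exact hmin ⟨by omega, hcert _ hle⟩
      have hcast : ((K - 1 : ℕ) : ℝ) = K - 1 := by rw [Nat.cast_sub (by omega), Nat.cast_one]
      have h2' : (2 : ℝ) ≤ K := by exact_mod_cast h2
      rw [hcast] at hlt
      nlinarith
  have hle : √(K * s / 2) ≤ gamma2 A := by
    refine le_csInf (factorValues_nonempty A) fun t ht => ?_
    rw [Real.sqrt_le_left (nonneg_of_mem_factorValues ht)]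
    linarith [key t ht]
  have := Real.sqrt_le_left (gamma2_nonneg A) |>.1 hle
  linarith

end

end GramSchmidtWalk

namespace GramSchmidtWalk

open Finset RealRAM

/-! ### The discrepancy of the walk -/

local notation "⟪" x ", " y "⟫" => inner ℝ x y

section

variable {n : ℕ} {Q : ℕ → ℕ → ℝ}

theorem posDef_of_bil_pos (hQ : SymmOn n Q)
    (hpos : ∀ y : ℕ → ℝ, (∃ j < n, y j ≠ 0) → 0 < bil n Q y y) :
    (Matrix.of fun i j : Fin n => Q i j).PosDef := by
  refine .of_dotProduct_mulVec_pos ?_ fun x hx => ?_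
  · ext i j
    simpa using hQ j j.2 i i.2
  · obtain ⟨j, hj⟩ := Function.ne_iff.1 hx
    refine lt_of_lt_of_eq (hpos (fun j => if h : j < n then x ⟨j, h⟩ else 0)
      ⟨j, j.2, by simpa using hj⟩) ?_
    simp [bil, sum_range, dotProduct, Matrix.mulVec, mul_sum, mul_assoc]

open scoped MatrixOrder in
/-- A positive form is a Gram matrix, up to scaling. -/
theorem exists_inner_eq {c : ℝ} (hc : 0 ≤ c) (hQ : SymmOn n Q)
    (hpos : ∀ y : ℕ → ℝ, (∃ j < n, y j ≠ 0) → 0 < bil n Q y y) :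
    ∃ v : ℕ → EuclideanSpace ℝ (Fin n), ∀ i < n, ∀ j < n, ⟪v i, v j⟫ = c * Q i j := by
  obtain ⟨B, hB⟩ := CStarAlgebra.nonneg_iff_eq_star_mul_self.1
    (posDef_of_bil_pos hQ hpos).posSemidef.nonneg
  refine ⟨fun i => if h : i < n then WithLp.toLp 2 fun l => √c * B l ⟨i, h⟩ else 0,
    fun i hi j hj => ?_⟩
  have h := congrFun (congrFun hB ⟨i, hi⟩) ⟨j, hj⟩
  simp only [Matrix.of_apply, Matrix.star_eq_conjTranspose, Matrix.mul_apply,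
    Matrix.conjTranspose_apply, star_trivial] at h
  simp only [dif_pos hi, dif_pos hj]
  rw [EuclideanSpace.inner_toLp_toLp, dotProduct, h, mul_sum]
  refine sum_congr rfl fun l _ => ?_
  rw [Pi.star_apply, star_trivial]
  linear_combination B l ⟨i, hi⟩ * B l ⟨j, hj⟩ * Real.mul_self_sqrt hc

/-- The functional `a` is represented by a vector of norm at most `√(r / c)`. -/
theorem exists_inner_position_eq_dot {v : ℕ → EuclideanSpace ℝ (Fin n)} {c r : ℝ} {a : ℕ → ℝ}
    (hc : 0 < c) (hr : 0 ≤ r) (hQ : SymmOn n Q)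
    (hpos : ∀ y : ℕ → ℝ, (∃ j < n, y j ≠ 0) → 0 < bil n Q y y)
    (hv : ∀ i < n, ∀ j < n, ⟪v i, v j⟫ = c * Q i j)
    (ha : ∀ y : ℕ → ℝ, (∃ j < n, y j ≠ 0) → 0 < bil n (gap r Q a) y y) :
    ∃ θ : EuclideanSpace ℝ (Fin n), (∀ x, ⟪θ, position v n x⟫ = dot n a x) ∧
      ‖θ‖ ^ 2 ≤ r / c := by
  obtain ⟨z, hz⟩ := Matrix.mulVec_surjective_iff_isUnit.2 (posDef_of_bil_pos hQ hpos).isUnit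
    fun j => a j
  set y : ℕ → ℝ := fun j => if h : j < n then z ⟨j, h⟩ else 0 with hy
  have hQy : ∀ x, bil n Q y x = dot n a x := by
    intro x
    rw [bil_comm hQ]
    rw [bil, dot]
    refine sum_congr rfl fun i hi => ?_
    rw [mem_range] at hi
    rw [← congrFun hz ⟨i, hi⟩, Matrix.mulVec, dotProduct, sum_mul, sum_range]
    refine sum_congr rfl fun j _ => ?_
    simp [hy]
    ring
  have hθ : ∀ x, ⟪(1 / c) • position v n y, position v n x⟫ = dot n a x := by
    intro x
    rw [inner_smul_left, inner_position hv, hQy, RCLike.conj_to_real]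
    field_simp
  refine ⟨(1 / c) • position v n y, hθ, ?_⟩
  -- with `w = a · y = yᵀ Q y`, the form gives `w ^ 2 ≤ r w`
  have e : ‖(1 / c) • position v n y‖ ^ 2 = dot n a y / c := by
    rw [← real_inner_self_eq_norm_sq, inner_smul_right, hθ]
    ring
  rw [e]
  refine div_le_div_of_nonneg_right ?_ hc.le
  by_cases h : ∃ j < n, y j ≠ 0
  · have h1 := ha y h
    have h2 := hpos y h
    rw [bil_gap, hQy] at h1
    rw [hQy] at h2
    nlinarith
  · push Not at h
    rw [dot, sum_eq_zero fun j hj => by rw [h j (mem_range.1 hj), mul_zero]]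
    exact hr

/-- The tail bound for all rows together. -/
theorem expect_discrepancy_le {m : ℕ} {A : ℕ → ℕ → ℝ} {r : ℝ} (hm : 2 ≤ m) (hr : 0 < r)
    (hQ : SymmOn n Q) (hgood : GoodGram m n A r Q) :
    expect (dyadics n n) (fun f => if ∀ i < m,
      |dot n (A i) (walk n Q f n)| ≤ 8 * √(3 * r) * √(Real.log m) then 0 else 1) ≤ 1 / 2 := by
  classical
  have hpos := fun y hy => hgood.bil_pos (by omega) hr.le (x := y) hy
  obtain ⟨v, hv⟩ := exists_inner_eq (c := 1 / 3) (by norm_num) hQ hpos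
  have hv1 : ∀ j < n, ‖v j‖ ≤ 1 := fun j hj => by
    have h1 := hv j hj j hj
    have h2 := hgood.diag j hj
    rw [real_inner_self_eq_norm_sq] at h1
    nlinarith [norm_nonneg (v j)]
  set L := Real.log m with hL
  have hm' : (2 : ℝ) ≤ m := by exact_mod_cast hm
  have hexpL : Real.exp L = m := Real.exp_log (by linarith)
  have hL2 : 0.69 ≤ L := by
    have h1 := Real.log_two_gt_d9
    have h2 := Real.log_le_log (by norm_num) hm'
    linarith
  have hsL : √L ^ 2 = L := Real.sq_sqrt (by linarith)
  have hsr : √(3 * r) ^ 2 = 3 * r := Real.sq_sqrt (by positivity)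
  have hsr0 : 0 < √(3 * r) := Real.sqrt_pos.2 (by positivity)
  -- the exponent for which the tail bound is nearly optimal
  set lam := 2 * √L / √(3 * r) with hlam
  have hlam0 : 0 ≤ lam := by positivity
  have hlamr : lam ^ 2 * (3 * r) = 4 * L := by
    rw [hlam, div_pow, hsr, mul_pow, hsL]
    field_simp
    norm_num
  have hlamτ : lam * (8 * √(3 * r) * √L) = 16 * L := by
    rw [hlam]
    field_simp
    linear_combination 16 * hsL
  set τ := 8 * √(3 * r) * √L with hτ
  have hexp : ∀ i < m, ∀ ε : ℝ, ε ^ 2 = 1 → expect (dyadics n n) (fun f => ENNReal.ofReal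
      (Real.exp (ε * lam * dot n (A i) (walk n Q f n)))) ≤
        ENNReal.ofReal (Real.exp (2 + 2 * L)) := by
    intro i hi ε hε
    obtain ⟨θ, hθ, hθr⟩ := exists_inner_position_eq_dot (c := 1 / 3) (by norm_num) hr.le hQ hpos hv
      (hgood.pos i hi)
    have h := expect_exp_walk_le ((ε * lam) • θ) (by norm_num) hQ hpos hv hv1
    simp only [inner_smul_left, hθ, RCLike.conj_to_real] at h
    refine h.trans (ENNReal.ofReal_le_ofReal (Real.exp_le_exp.2 ?_))
    rw [norm_smul, mul_pow, Real.norm_eq_abs, sq_abs, mul_pow, hε, one_mul]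
    have := mul_le_mul_of_nonneg_left hθr (sq_nonneg lam)
    have e : lam ^ 2 * (r / (1 / 3)) = 4 * L := by rw [← hlamr]; ring
    linarith
  have hchernoff : ∀ f, (if ∀ i < m, |dot n (A i) (walk n Q f n)| ≤ τ then (0 : ENNReal) else 1) ≤
      ∑ i ∈ range m, (ENNReal.ofReal (Real.exp (-(16 * L))) *
        ENNReal.ofReal (Real.exp (1 * lam * dot n (A i) (walk n Q f n))) +
        ENNReal.ofReal (Real.exp (-(16 * L))) *
        ENNReal.ofReal (Real.exp (-1 * lam * dot n (A i) (walk n Q f n)))) := by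
    intro f
    split_ifs with h
    · exact zero_le
    · push Not at h
      obtain ⟨i, hi, hlt⟩ := h
      refine le_trans ?_ (single_le_sum (fun _ _ => zero_le) (mem_range.2 hi))
      rw [← ENNReal.ofReal_mul (Real.exp_nonneg _), ← ENNReal.ofReal_mul (Real.exp_nonneg _),
        ← Real.exp_add, ← Real.exp_add, ← ENNReal.ofReal_one]
      rcases lt_abs.1 hlt with h | h
      · refine le_add_right (ENNReal.ofReal_le_ofReal (Real.one_le_exp ?_))
        have := mul_le_mul_of_nonneg_left h.le hlam0
        linarith
      · refine le_add_left (ENNReal.ofReal_le_ofReal (Real.one_le_exp ?_))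
        have := mul_le_mul_of_nonneg_left h.le hlam0
        linarith
  calc _ ≤ _ := expect_mono hchernoff
    _ ≤ ∑ i ∈ range m, ENNReal.ofReal (2 * Real.exp (2 - 14 * L)) := by
        rw [expect_finsetSum]
        refine sum_le_sum fun i hi => ?_
        rw [expect_add, expect_const_mul, expect_const_mul]
        have e : 2 * Real.exp (2 - 14 * L) =
            Real.exp (-(16 * L)) * Real.exp (2 + 2 * L) +
            Real.exp (-(16 * L)) * Real.exp (2 + 2 * L) := by
          rw [← Real.exp_add, two_mul]
          ring_nf
        rw [e, ENNReal.ofReal_add (by positivity) (by positivity),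
          ENNReal.ofReal_mul (Real.exp_nonneg _)]
        rw [mem_range] at hi
        gcongr
        · exact hexp i hi 1 (by norm_num)
        · exact hexp i hi (-1) (by norm_num)
    _ = ENNReal.ofReal (2 * Real.exp (2 - 13 * L)) := by
        rw [sum_const, card_range, nsmul_eq_mul, ← ENNReal.ofReal_natCast,
          ← ENNReal.ofReal_mul (by positivity), ← hexpL]
        congr 1
        rw [mul_left_comm, ← Real.exp_add]
        ring_nf
    _ ≤ ENNReal.ofReal (1 / 2) := by
        refine ENNReal.ofReal_le_ofReal ?_
        have h1 : Real.exp (2 - 13 * L) ≤ Real.exp (-6) := Real.exp_le_exp.2 (by linarith)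
        have h2 : (7 : ℝ) ≤ Real.exp 6 := by
          have := Real.add_one_le_exp (6 : ℝ)
          linarith
        have h3 : Real.exp (-6) ≤ 1 / 7 := by
          rw [Real.exp_neg, ← one_div]
          exact one_div_le_one_div_of_le (by norm_num) h2
        linarith
    _ = 1 / 2 := by
        rw [ENNReal.ofReal_div_of_pos (by norm_num)]
        simp

end

end GramSchmidtWalk

namespace RealRAM

open Finset GramSchmidtWalk

/-! ### The algorithm -/

/-- Set up the constant registers, find a Gram matrix, and draw the random numbers. -/
def prepareCode : Prog :=
  .seq (.seq (.op (.natConst 2 1)) (.seq (.op (.natConst 3 5)) gramCode.code)) sampleCode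

/-- The whole algorithm. -/
def balanceCode : Prog := .seq prepareCode walkCode.code

/-- The memory after the constant registers are set up. -/
def startState {m n : ℕ} (A : Matrix (Fin m) (Fin n) ℝ) (J : Finset (Fin n)) : State :=
  ((inputState A J).setReg 2 1).setReg 3 5

/-- The Gram matrix found by the algorithm. -/
noncomputable def gramMatrix {m n : ℕ} (A : Matrix (Fin m) (Fin n) ℝ) (J : Finset (Fin n)) :
    ℕ → ℕ → ℝ :=
  gramCode.den (startState A J).reg (startState A J).arr 5

theorem run_nil (T : ℕ) (s : State) : run T ⟨[], s⟩ = PMF.pure ⟨[], s⟩ := by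
  induction T with
  | zero => rfl
  | succ T ih =>
    change (step _).bind (run T) = _
    simp [step, ih]

theorem RunsTo.run_eq {P : Prog} {s s' : State} {τ T : ℕ} (h : RunsTo P s s' τ) (hT : τ ≤ T) :
    run T ⟨[P], s⟩ = PMF.pure ⟨[], s'⟩ := by
  have := h [] (T - τ)
  rwa [Nat.sub_add_cancel hT, run_nil] at this

/-- The algorithm halts in polynomial time with the endpoint of the walk. -/
theorem exists_runFrom_balanceCode : ∃ time : Polynomial ℕ, ∀ (m n : ℕ)
    (A : Matrix (Fin m) (Fin n) ℝ) (J : Finset (Fin n)), ∃ (D : PMF State) (g : State → State),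
      balanceCode.runFrom (time.eval (m + n)) (inputState A J) = D.map (fun s => ⟨[], g s⟩) ∧
      D.map State.samples = dyadics n n ∧ ∀ s ∈ D.support, ∀ j < n,
        (g s).arr 2 0 j = walk n (gramMatrix A J) s.samples n j := by
  obtain ⟨p, hp⟩ := gramCode.correct
  obtain ⟨q, hq⟩ := walkCode.correct
  -- `5` bounds the constant in register `3`, which also serves as the length of a loop
  refine ⟨p.comp (Polynomial.X + 5) + q.comp (Polynomial.X + 5) +
    Polynomial.X * (Polynomial.X * 13 + 8) + 12, fun m n A J => ?_⟩
  have hstart : Agree [0, 1, 2, 3, 4] (m + n + 5) (startState A J) (startState A J).reg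
      (startState A J).arr := by
    refine ⟨by decide, fun _ _ => rfl, fun _ _ => rfl, ?_, ?_, fun b hb => ?_⟩
    · simp [startState, State.setReg_reg]
    · simp [startState, State.setReg_reg, inputState]
    · interval_cases b <;> simp [startState, State.setReg_reg, inputState] <;> omega
  obtain ⟨s₁, τ₁, hrun₁, hτ₁, hreg₁, harr₁⟩ := hp _ _ _ _ _ hstart (by decide)
  have hpre := (runsTo_op (o := .natConst 2 1) (s := inputState A J) rfl).seq
    ((runsTo_op (o := .natConst 3 5) rfl).seq hrun₁)
  have hreg : s₁.reg 0 = m ∧ s₁.reg 1 = n ∧ s₁.reg 2 = 1 ∧ s₁.reg 3 = 5 ∧ s₁.reg 4 = 0 := by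
    simp only [hreg₁ _ (show 0 ∈ [0, 1, 2, 3, 4] by decide),
      hreg₁ _ (show 1 ∈ [0, 1, 2, 3, 4] by decide), hreg₁ _ (show 2 ∈ [0, 1, 2, 3, 4] by decide),
      hreg₁ _ (show 3 ∈ [0, 1, 2, 3, 4] by decide), hreg₁ _ (show 4 ∈ [0, 1, 2, 3, 4] by decide)]
    simp [startState, State.setReg_reg, inputState]
  obtain ⟨h0, h1, h2, h3, h4⟩ := hreg
  have hs3 : s₁.arr 3 = 0 := by
    rw [harr₁ 3 (by norm_num), Stmt.den_eq_of_notMem_writes (by decide)]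
    simp [startState, inputState]
    rfl
  obtain ⟨D, hD, hI, hmap⟩ := samples_sampleCode h0 h1 h2 h3 h4 hs3
  have hgram : ∀ s ∈ D.support, s.arr 5 = gramMatrix A J := fun s hs => by
    obtain ⟨i, h⟩ := hI s hs
    rw [h.arr 5 (by norm_num) (by norm_num), harr₁ 5 (by norm_num), gramMatrix]
  have hwalk : ∀ s : State, ∃ s', s ∈ D.support → ∃ τ, RunsTo walkCode.code s s' τ ∧
      τ ≤ q.eval (m + n + 5) ∧ ∀ j < n, s'.arr 2 0 j = walk n (gramMatrix A J) s.samples n j := by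
    intro s
    by_cases hs : s ∈ D.support
    · obtain ⟨i, h⟩ := hI s hs
      have hagree : Agree [0, 1, 2, 3, 4] (m + n + 5) s s.reg s.arr := by
        refine ⟨by decide, fun _ _ => rfl, fun _ _ => rfl, h.reg2, h.reg4, fun b hb => ?_⟩
        interval_cases b <;> simp only [h.reg0, h.reg1, h.reg2, h.reg3] <;> omega
      obtain ⟨s', τ, hrun, hτ, -, harr⟩ := hq _ _ _ _ _ hagree (by decide)
      refine ⟨s', fun _ => ⟨τ, hrun, hτ, fun j hj => ?_⟩⟩
      rw [harr 2 (by norm_num), walkCode_spec h.reg1 h.reg4 j hj, hgram s hs]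
      rfl
    · exact ⟨s, fun h => absurd h hs⟩
  choose g hg using hwalk
  refine ⟨D, g, ?_, hmap, fun s hs => ?_⟩
  · set τ := n * (n * 13 + 8) + 3 + (τ₁ + 1 + 1 + 1 + 1) + 1 with hτdef
    have hrun : Runs prepareCode (inputState A J) D τ := by
      have := hpre.runs.seq (D' := fun _ => D) (d := sampleCode) (fun s' hs' => by
        rw [PMF.support_pure, Set.mem_singleton_iff] at hs'
        rw [hs']
        exact hD)
      rwa [PMF.pure_bind] at this
    set T := (p.comp (Polynomial.X + 5) + q.comp (Polynomial.X + 5) +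
      Polynomial.X * (Polynomial.X * 13 + 8) + 12).eval (m + n) with hT
    have hle : q.eval (m + n + 5) + τ + 1 ≤ T := by
      have h' : n * (n * 13 + 8) ≤ (m + n) * ((m + n) * 13 + 8) := by gcongr <;> omega
      rw [hT, hτdef]
      simp only [Polynomial.eval_add, Polynomial.eval_mul, Polynomial.eval_comp, Polynomial.eval_X,
        Polynomial.eval_ofNat]
      omega
    obtain ⟨u, hu⟩ := Nat.exists_eq_add_of_le' hle
    have hTu : T = (u + q.eval (m + n + 5)) + τ + 1 := by omega
    have hstep : balanceCode.runFrom T (inputState A J) =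
        run ((u + q.eval (m + n + 5)) + τ) ⟨[prepareCode, walkCode.code], inputState A J⟩ := by
      rw [hTu]
      change (step _).bind (run _) = _
      simp only [step, balanceCode, PMF.pure_bind]
    -- the running time of the walk depends on the memory, but halted configurations stay put
    rw [hstep, hrun, ← PMF.bind_pure_comp]
    refine bind_congr_support fun s hs => ?_
    obtain ⟨τ', hr, hτ', -⟩ := hg s hs
    exact hr.run_eq (by omega)
  · obtain ⟨-, -, -, h⟩ := hg s hs
    exact h

end RealRAM

namespace GramSchmidtWalk

open Finset RealRAM

variable {m n : ℕ}

theorem mulVec_restrictCols (A : Matrix (Fin m) (Fin n) ℝ) (J : Finset (Fin n)) (s : State)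
    (i : Fin m) : (restrictCols A J).mulVec (s.output J) i = dot n (masked A J i) (s.arr 2 0) := by
  rw [dot, sum_range, Matrix.mulVec, dotProduct]
  rw [← sum_subset (subset_univ J) fun j _ hj => by rw [masked_of_notMem _ hj, zero_mul],
    ← sum_coe_sort J]
  refine sum_congr rfl fun j _ => ?_
  rw [masked_of_mem i j.2]
  rfl

/-- An event whose failure has probability at most one half has probability at least one half. -/
theorem le_toOuterMeasure_of_expect_le {α : Type*} {D : PMF α} {P : α → Prop} [DecidablePred P]
    {S : Set α} (h : expect D (fun a => if P a then 0 else 1) ≤ 1 / 2)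
    (hS : ∀ a ∈ D.support, P a → a ∈ S) : 1 / 2 ≤ D.toOuterMeasure S := by
  have h1 : (1 : ENNReal) ≤ expect D (fun a => if P a then 0 else 1) + D.toOuterMeasure S := by
    unfold RealRAM.expect
    rw [PMF.toOuterMeasure_apply, ← ENNReal.tsum_add, ← D.tsum_coe]
    refine ENNReal.tsum_le_tsum fun a => ?_
    by_cases ha : a ∈ D.support
    · by_cases hP : P a
      · simp [hP, hS a ha hP]
      · simp [hP]
    · simp [(D.apply_eq_zero_iff a).2 ha]
  by_contra! hlt
  have h2 := ENNReal.add_lt_add_of_le_of_lt (h.trans_lt (by simp)).ne h hlt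
  rw [ENNReal.add_halves] at h2
  exact absurd h1 (not_le.2 h2)

/-- With probability at least one half, the endpoint of the walk has small discrepancy. -/
theorem expect_discrepancy_gramMatrix_le (A : Matrix (Fin m) (Fin n) ℝ) (J : Finset (Fin n)) (hm : 2 ≤ m) :
    expect (dyadics n n) (fun f => if ∀ i < m,
      |dot n (masked A J i) (walk n (gramMatrix A J) f n)| ≤ 20 * gamma2 A * √(Real.log m)
      then 0 else 1) ≤ 1 / 2 := by
  set s := (∑ i ∈ range m, ∑ j ∈ range n, masked A J i j * masked A J i j) / (m * n) with hs
  have hγ := gamma2_nonneg A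
  have hnum : 0 ≤ ∑ i ∈ range m, ∑ j ∈ range n, masked A J i j * masked A J i j :=
    sum_nonneg fun _ _ => sum_nonneg fun _ _ => mul_self_nonneg _
  have hs0 : 0 ≤ s := div_nonneg hnum (by positivity)
  rcases hs0.eq_or_lt with h0 | hspos
  -- the matrix vanishes on `J`; the search may fail, but every coloring has discrepancy `0`
  · have hzero : ∀ i < m, ∀ x, dot n (masked A J i) x = 0 := by
      intro i hi x
      refine sum_eq_zero fun j hj => ?_
      have hmn : (m * n : ℝ) ≠ 0 := by
        have := mem_range.1 hj
        have hm0 : 0 < m := by omega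
        have hn0 : 0 < n := by omega
        positivity
      rw [hs, eq_comm, div_eq_zero_iff, or_iff_left hmn,
        sum_eq_zero_iff_of_nonneg fun _ _ => sum_nonneg fun _ _ => mul_self_nonneg _] at h0
      have h1 := h0 i (mem_range.2 hi)
      rw [sum_eq_zero_iff_of_nonneg fun _ _ => mul_self_nonneg _] at h1
      rw [mul_self_eq_zero.1 (h1 j hj), zero_mul]
    have hall : ∀ f, ∀ i < m, |dot n (masked A J i) (walk n (gramMatrix A J) f n)| ≤
        20 * gamma2 A * √(Real.log m) := fun f i hi => by
      rw [hzero i hi, abs_zero]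
      positivity
    simp only [if_pos (hall _), expect_const]
    exact zero_le
  · have hn : 0 < n := by
      rcases Nat.eq_zero_or_pos n with h | h
      · have hn0 : (n : ℝ) = 0 := by rw [h, Nat.cast_zero]
        rw [hs, hn0, mul_zero, div_zero] at hspos
        exact absurd hspos (lt_irrefl 0)
      · exact h
    obtain ⟨K, hK, hK', ⟨Z, hZ⟩, hKγ⟩ := exists_level hs.symm hspos
    obtain ⟨hQ, hgood⟩ := gramCode_spec (ρ := (startState A J).reg) (σ := (startState A J).arr)
      (A := masked A J)
      (by simp [startState, State.setReg_reg, inputState])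
      (by simp [startState, State.setReg_reg, inputState])
      (by simp [startState, State.setReg_reg])
      (by simp [startState, State.setReg_reg, inputState]) (by omega) hn (fun _ _ _ => rfl)
      (fun i j hij => by rw [masked_eq_zero hij]; simp [startState, inputState])
      (fun a _ b _ => by simp [startState, inputState]) hs.symm hspos hK hK' hZ
    have hr : 0 < K * s := by
      have : (0 : ℝ) < K := by exact_mod_cast (by omega : 0 < K)
      positivity
    refine le_trans (expect_mono fun f => ?_) (expect_discrepancy_le hm hr hQ hgood)
    have hbound : 8 * √(3 * (K * s)) ≤ 20 * gamma2 A := by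
      have : √(3 * (K * s)) ≤ 5 / 2 * gamma2 A := by
        rw [Real.sqrt_le_left (by positivity)]
        nlinarith
      linarith
    split_ifs with h1 h2
    · exact le_rfl
    · exact zero_le
    · refine absurd (fun i hi => ?_) h1
      rename_i h3
      exact (h3 i hi).trans (mul_le_mul_of_nonneg_right hbound (Real.sqrt_nonneg _))
    · exact le_rfl

end GramSchmidtWalk

open GramSchmidtWalk RealRAM in
theorem corollary5 :
    ∃ (P : RealRAM.Prog) (time : Polynomial ℕ) (C p : ℝ), 0 < C ∧ 0 < p ∧
      ∀ (m n : ℕ) (A : Matrix (Fin m) (Fin n) ℝ) (J : Finset (Fin n)),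
        -- polynomial time, and the output is always a coloring of `J`
        (∀ c ∈ (P.runFrom (time.eval (m + n)) (RealRAM.inputState A J)).support,
          c.Halted ∧ ∀ j : J, c.state.output J j = 1 ∨ c.state.output J j = -1) ∧
        -- with constant probability its discrepancy is small
        (2 ≤ m →
          ENNReal.ofReal p ≤
            (P.runFrom (time.eval (m + n)) (RealRAM.inputState A J)).toOuterMeasure
              {c | ‖(restrictCols A J).mulVec (c.state.output J)‖ ≤
                C * gamma2 A * Real.sqrt (Real.log m)}) := by
  classical
  obtain ⟨time, htime⟩ := exists_runFrom_balanceCode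
  refine ⟨balanceCode, time, 20, 1 / 2, by norm_num, by norm_num, fun m n A J => ?_⟩
  obtain ⟨D, g, hrun, hmap, hg⟩ := htime m n A J
  rw [hrun]
  refine ⟨fun c hc => ?_, fun hm => ?_⟩
  · obtain ⟨s, hs, rfl⟩ := (PMF.mem_support_map_iff ..).1 hc
    refine ⟨rfl, fun j => ?_⟩
    have h1 : (g s).output J j = walk n (gramMatrix A J) s.samples n (j : Fin n) :=
      hg s hs _ (j : Fin n).2
    rw [h1]
    exact (abs_eq zero_le_one).1 (abs_walk_eq_one _ (j : Fin n).2)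
  · have h := expect_discrepancy_gramMatrix_le A J hm
    rw [← hmap, expect_map] at h
    rw [PMF.toOuterMeasure_map_apply, ENNReal.ofReal_div_of_pos (by norm_num), ENNReal.ofReal_one,
      ENNReal.ofReal_ofNat]
    refine le_toOuterMeasure_of_expect_le h fun s hs hP => ?_
    have hγ := gamma2_nonneg A
    rw [Set.mem_preimage, Set.mem_ofPred_eq, pi_norm_le_iff_of_nonneg (by positivity)]
    intro i
    rw [mulVec_restrictCols, Real.norm_eq_abs]
    refine le_trans (le_of_eq ?_) (hP i i.2)
    exact congrArg _ (Finset.sum_congr rfl fun j hj => by rw [hg s hs j (Finset.mem_range.1 hj)])
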